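/- Let $\Bbbk$ be a commutative ring of characteristic $\neq 2$. Let $F$ be an $\mathbb N$-graded Frobenius superalgebra over $\Bbbk$, finitely generated and free over $\Bbbk$, with a parity-preserving homogeneous trace map $\mathrm{tr}\colon F\to\Bbbk$ of degree $-\delta$ (where $\delta$ is the maximal degree of $F$); that is, $f\mapsto\big(g\mapsto(-1)^{\bar f\bar g}\,\mathrm{tr}(gf)\big)$ is an isomorphism $F\to\mathrm{Hom}_\Bbbk(F,\Bbbk)$. Let $\psi$ be the Nakayama automorphism of $F$, so that $\mathrm{tr}(fg)=(-1)^{\bar f\bar g}\,\mathrm{tr}(g\psi(f))$. Assume that $\psi$ has finite order $\theta$, that the characteristic of $\Bbbk$ does not divide $\theta$, and that $F$ has a basis of eigenvectors of $\psi$. Let $B$ be a homogeneous basis of $F$, with left dual basis $\{b^\vee\}$, $\mathrm{tr}(b^\vee c)=\delta_{b,c}$. (For nonhomogeneous elements, sign conventions are extended linearly.) For $n\ge 0$, let $F^{\otimes n}$ be the super tensor power, on which $S_n$ acts by superpermutations $\mathsf f\mapsto{}^\pi\mathsf f$; write $f_i=1^{\otimes(i-1)}\otimes f\otimes1^{\otimes(n-i)}$,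 $\psi_i=\mathrm{id}^{\otimes(i-1)}\otimes\psi\otimes\mathrm{id}^{\otimes(n-i)}$, and $t_{i,j}=\sum_{b\in B}b_i\,(b^\vee)_j$. The affine wreath product algebra $\mathcal A_n(F)$ is the free product of $\Bbbk[x_1,\dots,x_n]$, $F^{\otimes n}$ and $\Bbbk S_n$ modulo the relations $$\mathsf f x_i=x_i\psi_i(\mathsf f),\quad s_ix_j=x_js_i\ (j\ne i,i+1),\quad s_ix_i=x_{i+1}s_i-t_{i,i+1},\quad \pi\mathsf f={}^\pi\mathsf f\,\pi ,$$ where $s_i=(i\;i+1)$; it is an $\mathbb N$-graded superalgebra in which each $x_i$ is even of degree $\delta$, permutations are even of degree $0$, and $F^{\otimes n}$ keeps its degrees and parities. For $m\in\mathbb Z$ put $F_\psi^{(m)}=\{f\in F:\psi(f)=f,\ gf=(-1)^{\bar f\bar g}f\psi^m(g)\ \forall g\in F\}$ and let $\mathbf F_1^{(m)}$ be the set of elements of $F_\psi^{(m)}\otimes F_\psi^{(0)}\otimes\cdots\otimes F_\psi^{(0)}\subseteq F^{\otimes n}$ invariant under superpermutation by all $\pi\in S_n$ with $\pi(1)=1$.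 For $1\le m\le\theta$ choose $e_m\in\mathbb N$ and even elements $\mathbf c^{(m,1)},\dots,\mathbf c^{(m,e_m)}\in\mathbf F_1^{(m)}$ of degree $m\delta$; denote this choice by $\mathbf C$, and set $d=d_{\mathbf C}=\sum_{m=1}^\theta m\,e_m$. Let $\mathcal A_n^{\mathbf C}(F)$ be the quotient of $\mathcal A_n(F)$ by the two-sided ideal generated by $$\chi_{\mathbf C}=\prod_{m=1}^\theta\prod_{j=1}^{e_m}\big(x_1^m-\mathbf c^{(m,j)}\big)$$ (for $n=0$, put $\mathcal A_0^{\mathbf C}(F)=\mathcal A_0(F)=\Bbbk$). **Theorem.** There is a unique linear map $\mathrm{tr}_{\mathbf C}\colon\mathcal A_n^{\mathbf C}(F)\to\Bbbk$ with $$\mathrm{tr}_{\mathbf C}(x^\alpha\,\mathsf f\,\pi)=\delta_{\alpha,(d-1,\dots,d-1)}\,\mathrm{tr}^{\otimes n}(\mathsf f)\,\delta_{\pi,1}$$ for all $\mathsf f\in F^{\otimes n}$, $\pi\in S_n$ and $\alpha\in\mathbb N^n$ with $\alpha_1,\dots,\alpha_n<d$. With the grading and parity inherited from $\mathcal A_n(F)$,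 $\mathcal A_n^{\mathbf C}(F)$ is an $\mathbb N$-graded Frobenius superalgebra with trace map $\mathrm{tr}_{\mathbf C}$: it is finitely generated projective over $\Bbbk$, $\mathrm{tr}_{\mathbf C}$ is parity-preserving and homogeneous of degree $-nd\delta$, and $a\mapsto\big(b\mapsto(-1)^{\bar a\bar b}\,\mathrm{tr}_{\mathbf C}(ba)\big)$ is an isomorphism onto the dual of $\mathcal A_n^{\mathbf C}(F)$. Its Nakayama automorphism is given by $$x_i\mapsto x_i,\qquad \mathsf f\mapsto(\psi^{d})^{\otimes n}(\mathsf f),\qquad \pi\mapsto\pi\qquad(1\le i\le n,\ \mathsf f\in F^{\otimes n},\ \pi\in S_n).$$ In particular $\mathcal A_n^{\mathbf C}(F)$ is symmetric (this Nakayama automorphism is the identity) if $d$ is a multiple of the order $\theta$ of $\psi$; hence it is symmetric whenever $F$ is symmetric (i.e. $\psi=\mathrm{id}$). -/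

import Mathlib

namespace AffineWreath

noncomputable section

open scoped TensorProduct

universe u v w

section Super

variable {k : Type u} {A : Type v} [CommRing k] [Ring A] [Algebra k A]

/-- The sign `(-1)^a` of a parity `a`. -/
def paritySign (a : ZMod 2) : ℤ := if a = 0 then 1 else -1

theorem paritySign_add (a b : ZMod 2) : paritySign (a + b) = paritySign a * paritySign b := by
  revert a b; decide

theorem paritySign_zero : paritySign 0 = 1 := by decide

variable (𝒜 : ℕ × ZMod 2 → Submodule k A)

/-- Projection of a graded superalgebra (graded by pairs (degree, parity)) onto its part of
parity `ε`. -/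
def parityProj [GradedAlgebra 𝒜] (ε : ZMod 2) : A →ₗ[k] A :=
  (DirectSum.decomposeLinearEquiv 𝒜).symm.toLinearMap ∘ₗ
    DFinsupp.filterLinearMap k (fun p => 𝒜 p) (fun p => p.2 = ε) ∘ₗ
      (DirectSum.decomposeLinearEquiv 𝒜).toLinearMap

/-- For a bilinear map `φ`, the bilinear map that on elements `a`, `b` homogeneous in parity is
`(-1)^(|a||b|) φ a b`. -/
def signed [GradedAlgebra 𝒜] {M : Type w} [AddCommGroup M] [Module k M]
    (φ : A →ₗ[k] A →ₗ[k] M) : A →ₗ[k] A →ₗ[k] M :=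
  ∑ a : ZMod 2, ∑ b : ZMod 2,
    paritySign (a * b) • φ.compl₁₂ (parityProj 𝒜 a) (parityProj 𝒜 b)

/-- The map `a ↦ (b ↦ (-1)^(|a||b|) tr (b a))` from `A` to its dual. -/
def traceForm [GradedAlgebra 𝒜] (tr : A →ₗ[k] k) : A →ₗ[k] Module.Dual k A :=
  signed 𝒜 ((LinearMap.mul k A).flip.compr₂ tr)

/-- `tr` makes the graded superalgebra `A` a Frobenius superalgebra: `A` is finitely generated
projective over `k`, `tr` is parity-preserving and homogeneous of degree `-D`, and the induced map
from `A` to its dual is an isomorphism. -/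
structure IsFrobenius [GradedAlgebra 𝒜] (D : ℕ) (tr : A →ₗ[k] k) : Prop where
  finite : Module.Finite k A
  projective : Module.Projective k A
  homogeneous : ∀ p : ℕ × ZMod 2, p ≠ (D, 0) → ∀ a ∈ 𝒜 p, tr a = 0
  bijective : Function.Bijective (traceForm 𝒜 tr)

/-- `ψ` satisfies the defining property `tr (a b) = (-1)^(|a||b|) tr (b ψ(a))` of the Nakayama
automorphism. -/
def IsNakayama [GradedAlgebra 𝒜] (tr : A →ₗ[k] k) (ψ : A ≃ₐ[k] A) : Prop :=
  ∀ a b : A, tr (a * b) =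
    signed 𝒜 ((LinearMap.mul k A).flip.compr₂ tr ∘ₗ ψ.toLinearMap) a b

section Facts

variable {𝒜} [GradedAlgebra 𝒜]

theorem parityProj_of_mem (ε : ZMod 2) {p : ℕ × ZMod 2} {a : A} (ha : a ∈ 𝒜 p) :
    parityProj 𝒜 ε a = if p.2 = ε then a else 0 := by
  simp only [parityProj, LinearMap.comp_apply, LinearEquiv.coe_coe,
    DirectSum.decomposeLinearEquiv_apply]
  rw [DirectSum.decompose_of_mem 𝒜 ha]
  change (DirectSum.decomposeLinearEquiv 𝒜).symm (DFinsupp.filter _ (DFinsupp.single _ _)) = _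
  by_cases h : p.2 = ε
  · rw [DFinsupp.filter_single_pos (p := fun p : ℕ × ZMod 2 => p.2 = ε) _ _ h, if_pos h]
    exact DirectSum.decompose_symm_of 𝒜 _
  · rw [DFinsupp.filter_single_neg (p := fun p : ℕ × ZMod 2 => p.2 = ε) _ _ h, if_neg h, map_zero]

theorem sum_parityProj (a : A) : ∑ ε, parityProj 𝒜 ε a = a := by
  induction a using DirectSum.Decomposition.inductionOn 𝒜 with
  | zero => simp
  | homogeneous m => simp [parityProj_of_mem _ m.2]
  | add a b ha hb => simp only [map_add, Finset.sum_add_distrib, ha, hb]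

theorem parityProj_parityProj (ε η : ZMod 2) (a : A) :
    parityProj 𝒜 ε (parityProj 𝒜 η a) = if ε = η then parityProj 𝒜 η a else 0 := by
  induction a using DirectSum.Decomposition.inductionOn 𝒜 with
  | zero => simp
  | @homogeneous p m =>
    rw [parityProj_of_mem _ m.2]
    by_cases h : p.2 = η
    · subst h
      simp [parityProj_of_mem _ m.2, eq_comm]
    · simp [h]
  | add a b ha hb =>
    simp only [map_add, ha, hb]
    split_ifs <;> simp

theorem parityProj_mul (ε η κ : ZMod 2) (a b : A) :
    parityProj 𝒜 κ (parityProj 𝒜 ε a * parityProj 𝒜 η b) =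
      if κ = ε + η then parityProj 𝒜 ε a * parityProj 𝒜 η b else 0 := by
  induction a using DirectSum.Decomposition.inductionOn 𝒜 with
  | zero => simp
  | @homogeneous p m =>
    induction b using DirectSum.Decomposition.inductionOn 𝒜 with
    | zero => simp
    | @homogeneous q l =>
      rw [parityProj_of_mem _ m.2, parityProj_of_mem _ l.2]
      by_cases h : p.2 = ε
      · by_cases h' : q.2 = η
        · subst h h'
          simp only [if_true]
          rw [parityProj_of_mem κ (SetLike.mul_mem_graded m.2 l.2)]
          simp [eq_comm]
        · simp [h']
      · simp [h]
    | add a b ha hb =>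
      simp only [map_add, mul_add, ha, hb]
      split_ifs <;> simp
  | add a b ha hb =>
    simp only [map_add, add_mul, ha, hb]
    split_ifs <;> simp

theorem parityProj_one (ε : ZMod 2) : parityProj 𝒜 ε (1 : A) = if ε = 0 then 1 else 0 := by
  rw [parityProj_of_mem ε (SetLike.GradedOne.one_mem (A := 𝒜))]
  simp [eq_comm]

theorem signed_apply {M : Type w} [AddCommGroup M] [Module k M] (φ : A →ₗ[k] A →ₗ[k] M)
    (a b : A) : signed 𝒜 φ a b =
      ∑ ε, ∑ η, paritySign (ε * η) • φ (parityProj 𝒜 ε a) (parityProj 𝒜 η b) := by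
  simp [signed, LinearMap.sum_apply]

variable {D : ℕ} {tr : A →ₗ[k] k}

theorem IsFrobenius.tr_proj (h : IsFrobenius 𝒜 D tr) (ε : ZMod 2) (a : A) :
    tr (parityProj 𝒜 ε a) = if ε = 0 then tr a else 0 := by
  induction a using DirectSum.Decomposition.inductionOn 𝒜 with
  | zero => simp
  | @homogeneous p m =>
    rw [parityProj_of_mem _ m.2]
    by_cases hp : p = (D, 0)
    · subst hp
      by_cases hε : ε = 0
      · simp [hε]
      · simp [hε, Ne.symm hε]
    · simp only [h.homogeneous p hp _ m.2, ite_self]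
      split_ifs <;> simp [h.homogeneous p hp _ m.2]
  | add a b ha hb =>
    simp only [map_add, ha, hb]
    split_ifs <;> simp

theorem IsFrobenius.tr_mul_proj (h : IsFrobenius 𝒜 D tr) (ε η : ZMod 2) (a b : A) :
    tr (parityProj 𝒜 ε a * parityProj 𝒜 η b) =
      if ε = η then tr (parityProj 𝒜 ε a * b) else 0 := by
  have key : ∀ ε η : ZMod 2, ε ≠ η → tr (parityProj 𝒜 ε a * parityProj 𝒜 η b) = 0 := by
    intro ε η hne
    have h1 := h.tr_proj 0 (parityProj 𝒜 ε a * parityProj 𝒜 η b)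
    rw [parityProj_mul, if_neg, map_zero, if_pos rfl] at h1
    · exact h1.symm
    · clear h1; revert ε η; decide
  split_ifs with hε
  · subst hε
    conv_rhs => rw [← sum_parityProj (𝒜 := 𝒜) b, Finset.mul_sum, map_sum]
    rw [Finset.sum_eq_single ε]
    · intro x _ hx; exact key _ _ hx.symm
    · simp
  · exact key _ _ hε

/-- The parity involution `a ↦ (-1)^|a| a`. -/
def parityInv (𝒜 : ℕ × ZMod 2 → Submodule k A) [GradedAlgebra 𝒜] : A →ₗ[k] A :=
  ∑ ε, paritySign ε • parityProj 𝒜 ε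

theorem parityInv_apply (a : A) : parityInv 𝒜 a = ∑ ε, paritySign ε • parityProj 𝒜 ε a := by
  simp [parityInv, LinearMap.sum_apply]

theorem parityProj_parityInv (ε : ZMod 2) (a : A) :
    parityProj 𝒜 ε (parityInv 𝒜 a) = paritySign ε • parityProj 𝒜 ε a := by
  rw [parityInv_apply, map_sum, Finset.sum_eq_single ε]
  · rw [map_zsmul, parityProj_parityProj, if_pos rfl]
  · intro x _ hx; rw [map_zsmul, parityProj_parityProj, if_neg hx.symm, smul_zero]
  · simp

theorem parityInv_parityProj (ε : ZMod 2) (a : A) :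
    parityInv 𝒜 (parityProj 𝒜 ε a) = paritySign ε • parityProj 𝒜 ε a := by
  rw [parityInv_apply, Finset.sum_eq_single ε]
  · rw [parityProj_parityProj, if_pos rfl]
  · intro x _ hx; rw [parityProj_parityProj, if_neg hx, smul_zero]
  · simp

theorem parityInv_parityInv (a : A) : parityInv 𝒜 (parityInv 𝒜 a) = a := by
  rw [parityInv_apply (parityInv 𝒜 a)]
  conv_rhs => rw [← sum_parityProj (𝒜 := 𝒜) a]
  refine Finset.sum_congr rfl fun ε _ => ?_
  rw [parityProj_parityInv, smul_smul,
    show paritySign ε * paritySign ε = 1 by revert ε; decide, one_smul]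

theorem parityInv_mul (a b : A) :
    parityInv 𝒜 (a * b) = parityInv 𝒜 a * parityInv 𝒜 b := by
  conv_lhs => rw [← sum_parityProj (𝒜 := 𝒜) a, ← sum_parityProj (𝒜 := 𝒜) b]
  rw [parityInv_apply a, parityInv_apply b, Finset.sum_mul_sum, Finset.sum_mul_sum, map_sum]
  refine Finset.sum_congr rfl fun ε _ => ?_
  rw [map_sum]
  refine Finset.sum_congr rfl fun η _ => ?_
  rw [smul_mul_smul_comm, ← paritySign_add, parityInv_apply, Finset.sum_eq_single (ε + η)]
  · rw [parityProj_mul, if_pos rfl]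
  · intro x _ hx; rw [parityProj_mul, if_neg hx, smul_zero]
  · simp

theorem parityInv_one : parityInv 𝒜 (1 : A) = 1 := by
  rw [parityInv_apply, Finset.sum_eq_single 0]
  · rw [parityProj_one, if_pos rfl, paritySign_zero, one_smul]
  · intro x _ hx; rw [parityProj_one, if_neg hx, smul_zero]
  · simp

theorem IsFrobenius.tr_parityInv (h : IsFrobenius 𝒜 D tr) (a : A) :
    tr (parityInv 𝒜 a) = tr a := by
  rw [parityInv_apply, map_sum, Finset.sum_eq_single 0]
  · rw [map_zsmul, h.tr_proj, if_pos rfl, paritySign_zero, one_smul]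
  · intro x _ hx; rw [map_zsmul, h.tr_proj, if_neg hx, smul_zero]
  · simp

/-- The map `a ↦ (b ↦ tr (a b))` is bijective as well. -/
theorem IsFrobenius.bijective_mul (h : IsFrobenius 𝒜 D tr) :
    Function.Bijective ((LinearMap.mul k A).compr₂ tr) := by
  have := h.finite
  have := h.projective
  have hfac : ⇑((LinearMap.mul k A).compr₂ tr).flip = traceForm 𝒜 tr ∘ parityInv 𝒜 := by
    funext a
    ext b
    have e1 : traceForm 𝒜 tr (parityInv 𝒜 a) b = ∑ ε, ∑ η, paritySign (ε * η) •
        tr (parityProj 𝒜 η b * parityProj 𝒜 ε (parityInv 𝒜 a)) := by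
      rw [traceForm, signed_apply]; rfl
    change tr (b * a) = traceForm 𝒜 tr (parityInv 𝒜 a) b
    rw [e1, Finset.sum_comm]
    conv_lhs => rw [← sum_parityProj (𝒜 := 𝒜) b, Finset.sum_mul, map_sum]
    refine Finset.sum_congr rfl fun η _ => ?_
    rw [Finset.sum_eq_single η]
    · rw [parityProj_parityInv, mul_smul_comm, map_zsmul, smul_smul, h.tr_mul_proj, if_pos rfl]
      rw [show paritySign (η * η) * paritySign η = 1 by revert η; decide, one_smul]
    · intro x _ hx
      rw [parityProj_parityInv, mul_smul_comm, map_zsmul, h.tr_mul_proj, if_neg hx.symm,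
        smul_zero, smul_zero]
    · simp
  have hp : ((LinearMap.mul k A).compr₂ tr).flip.IsPerfPair := by
    refine LinearMap.IsPerfPair.of_bijective _ ?_
    rw [hfac]
    exact h.bijective.comp (Function.Involutive.bijective parityInv_parityInv)
  exact LinearMap.IsPerfPair.bijective_right ((LinearMap.mul k A).compr₂ tr).flip

theorem IsFrobenius.bijective_mul_flip (h : IsFrobenius 𝒜 D tr) :
    Function.Bijective ((LinearMap.mul k A).compr₂ tr).flip := by
  have := h.finite
  have := h.projective
  have hp : ((LinearMap.mul k A).compr₂ tr).IsPerfPair :=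
    LinearMap.IsPerfPair.of_bijective _ h.bijective_mul
  exact LinearMap.IsPerfPair.bijective_right ((LinearMap.mul k A).compr₂ tr)

theorem IsFrobenius.eq_of_tr_mul (h : IsFrobenius 𝒜 D tr) {a b : A}
    (hab : ∀ c, tr (c * a) = tr (c * b)) : a = b :=
  h.bijective_mul_flip.1 (LinearMap.ext hab)

theorem signed_nakayama (ψ : A ≃ₐ[k] A) (a b : A) :
    signed 𝒜 ((LinearMap.mul k A).flip.compr₂ tr ∘ₗ ψ.toLinearMap) a b =
      ∑ ε, ∑ η, paritySign (ε * η) • tr (parityProj 𝒜 η b * ψ (parityProj 𝒜 ε a)) := by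
  rw [signed_apply]; rfl

theorem IsNakayama.unique (h : IsFrobenius 𝒜 D tr) {ψ ψ' : A ≃ₐ[k] A}
    (hψ : IsNakayama 𝒜 tr ψ) (hψ' : IsNakayama 𝒜 tr ψ') : ψ = ψ' := by
  have key : ∀ χ : A ≃ₐ[k] A, IsNakayama 𝒜 tr χ → ∀ ε η a b,
      tr (parityProj 𝒜 η b * χ (parityProj 𝒜 ε a)) =
        paritySign (ε * η) * tr (parityProj 𝒜 ε a * parityProj 𝒜 η b) := by
    intro χ hχ ε η a b
    rw [hχ (parityProj 𝒜 ε a) (parityProj 𝒜 η b), signed_nakayama, Finset.sum_eq_single ε, Finset.sum_eq_single η]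
    · rw [parityProj_parityProj, parityProj_parityProj, if_pos rfl, if_pos rfl, zsmul_eq_mul,
        ← mul_assoc, ← Int.cast_mul,
        show paritySign (ε * η) * paritySign (ε * η) = 1 by revert ε η; decide]
      simp
    · intro x _ hx; simp [parityProj_parityProj, hx]
    · simp
    · intro x _ hx; simp [parityProj_parityProj, hx]
    · simp
  ext a
  refine h.eq_of_tr_mul fun c => ?_
  rw [← sum_parityProj (𝒜 := 𝒜) a, ← sum_parityProj (𝒜 := 𝒜) c]
  simp only [map_sum, Finset.sum_mul, Finset.mul_sum]
  refine Finset.sum_congr rfl fun ε _ => Finset.sum_congr rfl fun η _ => ?_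
  rw [key ψ hψ, key ψ' hψ']

theorem IsFrobenius.exists_nakayama (h : IsFrobenius 𝒜 D tr) :
    ∃ ψ : A ≃ₐ[k] A, IsNakayama 𝒜 tr ψ := by
  let N : A ≃ₗ[k] A := (LinearEquiv.ofBijective _ h.bijective_mul).trans
    (LinearEquiv.ofBijective _ h.bijective_mul_flip).symm
  have hN : ∀ a c, tr (c * N a) = tr (a * c) := fun a c =>
    LinearMap.congr_fun ((LinearEquiv.ofBijective _ h.bijective_mul_flip).apply_symm_apply
      (LinearEquiv.ofBijective _ h.bijective_mul a)) c
  have hN1 : N 1 = 1 := h.eq_of_tr_mul fun c => by rw [hN, one_mul, mul_one]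
  have hNm : ∀ a b, N (a * b) = N a * N b := fun a b => h.eq_of_tr_mul fun c => by
    rw [hN, ← mul_assoc, hN, ← mul_assoc, hN, mul_assoc]
  let γ : A ≃ₗ[k] A := LinearEquiv.ofInvolutive (parityInv 𝒜) parityInv_parityInv
  refine ⟨(AlgEquiv.ofLinearEquiv N hN1 hNm).trans
    (AlgEquiv.ofLinearEquiv γ parityInv_one parityInv_mul), fun a b => ?_⟩
  have key : ∀ ε η, tr (parityProj 𝒜 η b * parityInv 𝒜 (N (parityProj 𝒜 ε a))) =
      paritySign η • tr (parityProj 𝒜 ε a * parityProj 𝒜 η b) := by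
    intro ε η
    rw [← h.tr_parityInv, parityInv_mul, parityInv_parityInv, parityInv_parityProj,
      smul_mul_assoc, map_zsmul, hN]
  have e : signed 𝒜 ((LinearMap.mul k A).flip.compr₂ tr ∘ₗ
      ((AlgEquiv.ofLinearEquiv N hN1 hNm).trans
        (AlgEquiv.ofLinearEquiv γ parityInv_one parityInv_mul)).toLinearMap) a b =
      ∑ ε, ∑ η, paritySign (ε * η) •
        tr (parityProj 𝒜 η b * parityInv 𝒜 (N (parityProj 𝒜 ε a))) :=
    signed_nakayama _ a b
  rw [e]
  conv_lhs => rw [← sum_parityProj (𝒜 := 𝒜) a, Finset.sum_mul, map_sum]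
  refine Finset.sum_congr rfl fun ε _ => ?_
  rw [Finset.sum_eq_single ε]
  · rw [key, smul_smul, show paritySign (ε * ε) * paritySign ε = 1 by revert ε; decide, one_smul,
      h.tr_mul_proj, if_pos rfl]
  · intro x _ hx
    rw [key, h.tr_mul_proj, if_neg hx.symm, smul_zero, smul_zero]
  · simp

/-- The Nakayama automorphism: the unique algebra automorphism `ψ` such that
`tr (a b) = (-1)^(|a||b|) tr (b ψ(a))`. -/
def nakayama (h : IsFrobenius 𝒜 D tr) : A ≃ₐ[k] A :=
  h.exists_nakayama.choose

theorem isNakayama_nakayama (h : IsFrobenius 𝒜 D tr) : IsNakayama 𝒜 tr (nakayama h) :=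
  h.exists_nakayama.choose_spec

theorem nakayama_eq (h : IsFrobenius 𝒜 D tr) {ψ : A ≃ₐ[k] A} (hψ : IsNakayama 𝒜 tr ψ) :
    nakayama h = ψ :=
  IsNakayama.unique h (isNakayama_nakayama h) hψ

/-- The left dual of a basis: the elements `b^∨` with `tr (b^∨ c) = δ_{b,c}`. -/
def leftDual (h : IsFrobenius 𝒜 D tr) {ι : Type w} (B : Module.Basis ι k A) (i : ι) : A :=
  (LinearEquiv.ofBijective _ h.bijective_mul).symm (B.coord i)

theorem tr_leftDual_mul (h : IsFrobenius 𝒜 D tr) {ι : Type w} [DecidableEq ι]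
    (B : Module.Basis ι k A) (i j : ι) :
    tr (leftDual h B i * B j) = if i = j then 1 else 0 := by
  have := LinearMap.congr_fun ((LinearEquiv.ofBijective _ h.bijective_mul).apply_symm_apply
      (B.coord i)) (B j)
  refine this.trans ?_
  rw [Module.Basis.coord_apply, Module.Basis.repr_self, Finsupp.single_apply]
  simp [eq_comm]

end Facts

/-! The super tensor power of a graded superalgebra. -/

/-- The `n`-th tensor power of the graded superalgebra `A`, with multiplication
`(f_1 ⊗ ⋯ ⊗ f_n) (g_1 ⊗ ⋯ ⊗ g_n) = (-1)^(∑_{j < i} |f_i| |g_j|) f_1 g_1 ⊗ ⋯ ⊗ f_n g_n`. -/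
def SuperTensorPower (_𝒜 : ℕ × ZMod 2 → Submodule k A) (n : ℕ) : Type (max u v) :=
  ⨂[k] _ : Fin n, A

namespace SuperTensorPower

variable (n : ℕ)

instance : AddCommGroup (SuperTensorPower 𝒜 n) :=
  inferInstanceAs (AddCommGroup (⨂[k] _ : Fin n, A))

instance : Module k (SuperTensorPower 𝒜 n) :=
  inferInstanceAs (Module k (⨂[k] _ : Fin n, A))

/-- The pure tensor `f_1 ⊗ ⋯ ⊗ f_n`. -/
def pure : MultilinearMap k (fun _ : Fin n => A) (SuperTensorPower 𝒜 n) :=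
  PiTensorProduct.tprod k

/-- The linear map `g_1 ⊗ ⋯ ⊗ g_n`. -/
def map (g : Fin n → A →ₗ[k] A) : SuperTensorPower 𝒜 n →ₗ[k] SuperTensorPower 𝒜 n :=
  PiTensorProduct.map (R := k) (s := fun _ : Fin n => A) (t := fun _ : Fin n => A) g

/-- The unsigned multiplication `(⊗ f_i) (⊗ g_i) = ⊗ f_i g_i`. -/
def rawMul : SuperTensorPower 𝒜 n →ₗ[k] SuperTensorPower 𝒜 n →ₗ[k] SuperTensorPower 𝒜 n :=
  PiTensorProduct.mul (R := k) (A := fun _ : Fin n => A)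

/-- The projection onto the span of the pure tensors whose `i`-th factor has parity `ε i`. -/
def proj [GradedAlgebra 𝒜] (ε : Fin n → ZMod 2) :
    SuperTensorPower 𝒜 n →ₗ[k] SuperTensorPower 𝒜 n :=
  map 𝒜 n fun i => parityProj 𝒜 (ε i)

/-- The Koszul sign of moving `g_1 ⊗ ⋯ ⊗ g_n` into `f_1 ⊗ ⋯ ⊗ f_n` when these have parities
`η` and `ε`. -/
def mulSign {n : ℕ} (ε η : Fin n → ZMod 2) : ℤ :=
  paritySign (∑ i, ∑ j, if j < i then ε i * η j else 0)

/-- The signed multiplication. -/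
def superMul [GradedAlgebra 𝒜] :
    SuperTensorPower 𝒜 n →ₗ[k] SuperTensorPower 𝒜 n →ₗ[k] SuperTensorPower 𝒜 n :=
  ∑ ε : Fin n → ZMod 2, ∑ η : Fin n → ZMod 2,
    mulSign ε η • (rawMul 𝒜 n).compl₁₂ (proj 𝒜 n ε) (proj 𝒜 n η)

section Facts

variable {𝒜 n}

@[simp] theorem map_pure (g : Fin n → A →ₗ[k] A) (f : Fin n → A) :
    map 𝒜 n g (pure 𝒜 n f) = pure 𝒜 n fun i => g i (f i) :=
  PiTensorProduct.map_tprod _ _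

@[simp] theorem rawMul_pure (f g : Fin n → A) :
    rawMul 𝒜 n (pure 𝒜 n f) (pure 𝒜 n g) = pure 𝒜 n (f * g) :=
  PiTensorProduct.mul_tprod_tprod _ _

theorem hom_ext {M : Type w} [AddCommGroup M] [Module k M] {p q : SuperTensorPower 𝒜 n →ₗ[k] M}
    (h : ∀ f, p (pure 𝒜 n f) = q (pure 𝒜 n f)) : p = q :=
  PiTensorProduct.ext (MultilinearMap.ext h)

theorem rawMul_assoc (a b c : SuperTensorPower 𝒜 n) :
    rawMul 𝒜 n (rawMul 𝒜 n a b) c = rawMul 𝒜 n a (rawMul 𝒜 n b c) :=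
  PiTensorProduct.mul_assoc a b c

variable [GradedAlgebra 𝒜]

theorem proj_pure (ε : Fin n → ZMod 2) (f : Fin n → A) :
    proj 𝒜 n ε (pure 𝒜 n f) = pure 𝒜 n fun i => parityProj 𝒜 (ε i) (f i) :=
  map_pure _ _

theorem proj_proj (ε η : Fin n → ZMod 2) (a : SuperTensorPower 𝒜 n) :
    proj 𝒜 n ε (proj 𝒜 n η a) = if ε = η then proj 𝒜 n η a else 0 := by
  have : proj 𝒜 n ε ∘ₗ proj 𝒜 n η = if ε = η then proj 𝒜 n η else 0 := by
    refine hom_ext fun f => ?_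
    rw [LinearMap.comp_apply, proj_pure, proj_pure]
    split_ifs with h
    · subst h
      rw [proj_pure]
      simp [parityProj_parityProj]
    · obtain ⟨i, hi⟩ := Function.ne_iff.mp h
      rw [LinearMap.zero_apply]
      refine (pure 𝒜 n).map_coord_zero i ?_
      rw [parityProj_parityProj, if_neg hi]
  rw [← LinearMap.comp_apply, this]
  split_ifs <;> rfl

theorem sum_proj (a : SuperTensorPower 𝒜 n) : ∑ ε, proj 𝒜 n ε a = a := by
  have : ∑ ε, proj 𝒜 n ε = LinearMap.id := by
    refine hom_ext fun f => ?_
    rw [LinearMap.sum_apply, LinearMap.id_apply]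
    simp_rw [proj_pure]
    rw [← (pure 𝒜 n).map_sum (fun i ε => parityProj 𝒜 ε (f i))]
    simp_rw [sum_parityProj]
  rw [← LinearMap.sum_apply, this, LinearMap.id_apply]

theorem proj_rawMul (ε η κ : Fin n → ZMod 2) (a b : SuperTensorPower 𝒜 n) :
    proj 𝒜 n κ (rawMul 𝒜 n (proj 𝒜 n ε a) (proj 𝒜 n η b)) =
      if κ = ε + η then rawMul 𝒜 n (proj 𝒜 n ε a) (proj 𝒜 n η b) else 0 := by
  have : ((rawMul 𝒜 n).compl₁₂ (proj 𝒜 n ε) (proj 𝒜 n η)).compr₂ (proj 𝒜 n κ) =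
      if κ = ε + η then (rawMul 𝒜 n).compl₁₂ (proj 𝒜 n ε) (proj 𝒜 n η) else 0 := by
    refine hom_ext fun f => hom_ext fun g => ?_
    rw [LinearMap.compr₂_apply, LinearMap.compl₁₂_apply, proj_pure, proj_pure, rawMul_pure,
      proj_pure]
    split_ifs with h
    · subst h
      rw [LinearMap.compl₁₂_apply, proj_pure, proj_pure, rawMul_pure]
      congr 1
      funext i
      simp [parityProj_mul]
    · obtain ⟨i, hi⟩ := Function.ne_iff.mp h
      rw [LinearMap.zero_apply, LinearMap.zero_apply]
      refine (pure 𝒜 n).map_coord_zero i ?_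
      rw [Pi.mul_apply, parityProj_mul]
      exact if_neg hi
  have h2 := LinearMap.congr_fun (LinearMap.congr_fun this a) b
  rw [LinearMap.compr₂_apply, LinearMap.compl₁₂_apply] at h2
  rw [h2]
  split_ifs <;> rfl

theorem proj_one (ε : Fin n → ZMod 2) :
    proj 𝒜 n ε (pure 𝒜 n 1) = if ε = 0 then pure 𝒜 n 1 else 0 := by
  rw [proj_pure]
  split_ifs with h
  · subst h; congr 1; funext i; simp [parityProj_one]
  · obtain ⟨i, hi⟩ := Function.ne_iff.mp h
    refine (pure 𝒜 n).map_coord_zero i ?_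
    rw [Pi.one_apply, parityProj_one]
    exact if_neg hi

theorem superMul_apply (a b : SuperTensorPower 𝒜 n) : superMul 𝒜 n a b =
    ∑ ε, ∑ η, mulSign ε η • rawMul 𝒜 n (proj 𝒜 n ε a) (proj 𝒜 n η b) := by
  simp [superMul, LinearMap.sum_apply]

theorem mulSign_add_left (ε η κ : Fin n → ZMod 2) :
    mulSign (ε + η) κ = mulSign ε κ * mulSign η κ := by
  rw [mulSign, mulSign, mulSign, ← paritySign_add, ← Finset.sum_add_distrib]
  simp_rw [← Finset.sum_add_distrib]
  congr! 3
  split_ifs <;> simp [add_mul]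

theorem mulSign_add_right (ε η κ : Fin n → ZMod 2) :
    mulSign ε (η + κ) = mulSign ε η * mulSign ε κ := by
  rw [mulSign, mulSign, mulSign, ← paritySign_add, ← Finset.sum_add_distrib]
  simp_rw [← Finset.sum_add_distrib]
  congr! 3
  split_ifs <;> simp [mul_add]

theorem superMul_proj_left (ε : Fin n → ZMod 2) (a b : SuperTensorPower 𝒜 n) :
    superMul 𝒜 n (proj 𝒜 n ε a) b =
      ∑ η, mulSign ε η • rawMul 𝒜 n (proj 𝒜 n ε a) (proj 𝒜 n η b) := by
  rw [superMul_apply, Finset.sum_eq_single ε]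
  · simp [proj_proj]
  · intro x _ hx; simp [proj_proj, hx]
  · simp

theorem superMul_proj_proj (ε η : Fin n → ZMod 2) (a b : SuperTensorPower 𝒜 n) :
    superMul 𝒜 n (proj 𝒜 n ε a) (proj 𝒜 n η b) =
      mulSign ε η • rawMul 𝒜 n (proj 𝒜 n ε a) (proj 𝒜 n η b) := by
  rw [superMul_proj_left, Finset.sum_eq_single η]
  · simp [proj_proj]
  · intro x _ hx; simp [proj_proj, hx]
  · simp

theorem superMul_rawMul (ε η κ : Fin n → ZMod 2) (a b c : SuperTensorPower 𝒜 n) :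
    superMul 𝒜 n (rawMul 𝒜 n (proj 𝒜 n ε a) (proj 𝒜 n η b)) (proj 𝒜 n κ c) =
      mulSign (ε + η) κ •
        rawMul 𝒜 n (rawMul 𝒜 n (proj 𝒜 n ε a) (proj 𝒜 n η b)) (proj 𝒜 n κ c) := by
  have h := superMul_proj_proj (ε + η) κ (rawMul 𝒜 n (proj 𝒜 n ε a) (proj 𝒜 n η b)) c
  rwa [proj_rawMul, if_pos rfl] at h

theorem rawMul_superMul (ε η κ : Fin n → ZMod 2) (a b c : SuperTensorPower 𝒜 n) :
    superMul 𝒜 n (proj 𝒜 n ε a) (rawMul 𝒜 n (proj 𝒜 n η b) (proj 𝒜 n κ c)) =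
      mulSign ε (η + κ) •
        rawMul 𝒜 n (proj 𝒜 n ε a) (rawMul 𝒜 n (proj 𝒜 n η b) (proj 𝒜 n κ c)) := by
  have h := superMul_proj_proj ε (η + κ) a (rawMul 𝒜 n (proj 𝒜 n η b) (proj 𝒜 n κ c))
  rwa [proj_rawMul, if_pos rfl] at h

theorem superMul_assoc (a b c : SuperTensorPower 𝒜 n) :
    superMul 𝒜 n (superMul 𝒜 n a b) c = superMul 𝒜 n a (superMul 𝒜 n b c) := by
  have key : ∀ ε η κ : Fin n → ZMod 2,
      superMul 𝒜 n (superMul 𝒜 n (proj 𝒜 n ε a) (proj 𝒜 n η b)) (proj 𝒜 n κ c) =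
      superMul 𝒜 n (proj 𝒜 n ε a) (superMul 𝒜 n (proj 𝒜 n η b) (proj 𝒜 n κ c)) := by
    intro ε η κ
    rw [superMul_proj_proj, superMul_proj_proj, map_zsmul, map_zsmul, LinearMap.smul_apply,
      superMul_rawMul, rawMul_superMul, rawMul_assoc, smul_smul, smul_smul, mulSign_add_left,
      mulSign_add_right]
    congr 1
    ring
  rw [← sum_proj a, ← sum_proj b, ← sum_proj c]
  simp only [map_sum, LinearMap.sum_apply, key]

theorem mulSign_zero_left (ε : Fin n → ZMod 2) : mulSign 0 ε = 1 := by
  simp [mulSign, paritySign_zero]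

theorem mulSign_zero_right (ε : Fin n → ZMod 2) : mulSign ε 0 = 1 := by
  simp [mulSign, paritySign_zero]

theorem one_superMul (a : SuperTensorPower 𝒜 n) : superMul 𝒜 n (pure 𝒜 n 1) a = a := by
  have h1 : proj 𝒜 n 0 (pure 𝒜 n 1) = pure 𝒜 n 1 := by rw [proj_one, if_pos rfl]
  have h := superMul_proj_left 0 (pure 𝒜 n 1) a
  simp only [h1, mulSign_zero_left, one_smul] at h
  rw [h, ← map_sum, sum_proj]
  exact PiTensorProduct.one_mul a

theorem superMul_one (a : SuperTensorPower 𝒜 n) : superMul 𝒜 n a (pure 𝒜 n 1) = a := by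
  have h1 : proj 𝒜 n 0 (pure 𝒜 n 1) = pure 𝒜 n 1 := by rw [proj_one, if_pos rfl]
  conv_rhs => rw [← sum_proj a]
  conv_lhs => rw [← sum_proj a, map_sum, LinearMap.sum_apply]
  refine Finset.sum_congr rfl fun ε _ => ?_
  have h := superMul_proj_proj ε 0 a (pure 𝒜 n 1)
  rw [h1, mulSign_zero_right, one_smul] at h
  rw [h]
  exact PiTensorProduct.mul_one _

end Facts

instance [GradedAlgebra 𝒜] : Ring (SuperTensorPower 𝒜 n) where
  __ := (inferInstance : AddCommGroup (SuperTensorPower 𝒜 n))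
  mul a b := superMul 𝒜 n a b
  one := pure 𝒜 n 1
  mul_assoc := superMul_assoc
  one_mul := one_superMul
  mul_one := superMul_one
  left_distrib a b c := map_add (superMul 𝒜 n a) b c
  right_distrib a b c := LinearMap.map_add₂ (superMul 𝒜 n) a b c
  zero_mul a := LinearMap.map_zero₂ (superMul 𝒜 n) a
  mul_zero a := map_zero (superMul 𝒜 n a)

instance [GradedAlgebra 𝒜] : Algebra k (SuperTensorPower 𝒜 n) :=
  Algebra.ofModule (fun r a b => LinearMap.map_smul₂ (superMul 𝒜 n) r a b)
    (fun r a b => map_smul (superMul 𝒜 n a) r b)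

/-- `f_i = 1 ⊗ ⋯ ⊗ 1 ⊗ f ⊗ 1 ⊗ ⋯ ⊗ 1`, with `f` in position `i`. -/
def single (i : Fin n) (f : A) : SuperTensorPower 𝒜 n :=
  pure 𝒜 n (Function.update 1 i f)

/-- `id ⊗ ⋯ ⊗ id ⊗ ψ ⊗ id ⊗ ⋯ ⊗ id`, with `ψ` in position `i`. -/
def mapAt (i : Fin n) (ψ : A →ₗ[k] A) : SuperTensorPower 𝒜 n →ₗ[k] SuperTensorPower 𝒜 n :=
  map 𝒜 n (Function.update (fun _ => LinearMap.id) i ψ)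

/-- `tr^{⊗n}`, i.e. `f_1 ⊗ ⋯ ⊗ f_n ↦ tr f_1 ⋯ tr f_n`. -/
def trace (tr : A →ₗ[k] k) : SuperTensorPower 𝒜 n →ₗ[k] k :=
  PiTensorProduct.lift ((MultilinearMap.mkPiAlgebra k (Fin n) k).compLinearMap fun _ => tr)

/-- The Koszul sign of permuting by `π` the factors of a pure tensor with parities `ε`: a factor
`-1` for every inversion of `π` between two odd factors. -/
def permSign {n : ℕ} (π : Equiv.Perm (Fin n)) (ε : Fin n → ZMod 2) : ℤ :=
  paritySign (∑ i, ∑ j, if i < j ∧ π j < π i then ε i * ε j else 0)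

/-- The unsigned permutation of the factors, with `f_i` moved to position `π i`. -/
def rawPerm (π : Equiv.Perm (Fin n)) : SuperTensorPower 𝒜 n →ₗ[k] SuperTensorPower 𝒜 n :=
  (PiTensorProduct.reindex k (fun _ : Fin n => A) π).toLinearMap

/-- Superpermutation of the factors: `π · (f_1 ⊗ ⋯ ⊗ f_n)` is, up to the Koszul sign, the pure
tensor with `f_i` in position `π i`. -/
def perm [GradedAlgebra 𝒜] (π : Equiv.Perm (Fin n)) :
    SuperTensorPower 𝒜 n →ₗ[k] SuperTensorPower 𝒜 n :=
  ∑ ε : Fin n → ZMod 2, permSign π ε • (rawPerm 𝒜 n π ∘ₗ proj 𝒜 n ε)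

theorem rawPerm_pure (π : Equiv.Perm (Fin n)) (f : Fin n → A) :
    rawPerm 𝒜 n π (pure 𝒜 n f) = pure 𝒜 n fun i => f (π.symm i) :=
  PiTensorProduct.reindex_tprod _ _

theorem trace_pure (tr : A →ₗ[k] k) (f : Fin n → A) :
    trace 𝒜 n tr (pure 𝒜 n f) = ∏ i, tr (f i) :=
  (PiTensorProduct.lift.tprod _).trans (by simp)

/-- The part of the tensor power of given degree and parity. -/
def grading (p : ℕ × ZMod 2) : Submodule k (SuperTensorPower 𝒜 n) :=
  Submodule.span k {a | ∃ (q : Fin n → ℕ × ZMod 2) (f : Fin n → A),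
    (∀ i, f i ∈ 𝒜 (q i)) ∧ ∑ i, q i = p ∧ a = pure 𝒜 n f}

end SuperTensorPower

end Super

/-! The affine wreath product algebra and its cyclotomic quotients. -/

section Affine

variable {k : Type u} {F : Type v} [CommRing k] [Ring F] [Algebra k F]

/-- Generators `x_i`, the elements of `F^{⊗n}`, and the permutations. -/
inductive Gen (𝒜 : ℕ × ZMod 2 → Submodule k F) (n : ℕ) : Type (max u v)
  | x (i : Fin n) : Gen 𝒜 n
  | tens (f : SuperTensorPower 𝒜 n) : Gen 𝒜 n
  | perm (π : Equiv.Perm (Fin n)) : Gen 𝒜 n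

variable {𝒜 : ℕ × ZMod 2 → Submodule k F} [GradedAlgebra 𝒜] {δ : ℕ} {tr : F →ₗ[k] k}
  (hF : IsFrobenius 𝒜 δ tr) {ι : Type w} [Fintype ι] (B : Module.Basis ι k F)

/-- `t_{i,j} = ∑_b b_i (b^∨)_j`, an element of `F^{⊗n}`. -/
def teleporter (n : ℕ) (i j : Fin n) : SuperTensorPower 𝒜 n :=
  ∑ b : ι, SuperTensorPower.single 𝒜 n i (B b) *
    SuperTensorPower.single 𝒜 n j (leftDual hF B b)

/-- The defining relations of the affine wreath product algebra: those of `k[x_1, …, x_n]`, of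
`F^{⊗n}` and of `k S_n`, followed by the four families of relations between these factors. -/
inductive AffineRel (n : ℕ) : FreeAlgebra k (Gen 𝒜 n) → FreeAlgebra k (Gen 𝒜 n) → Prop
  | x_comm (i j : Fin n) : AffineRel n
      (FreeAlgebra.ι k (.x i) * FreeAlgebra.ι k (.x j))
      (FreeAlgebra.ι k (.x j) * FreeAlgebra.ι k (.x i))
  | tens_add (f g : SuperTensorPower 𝒜 n) : AffineRel n
      (FreeAlgebra.ι k (.tens (f + g)))
      (FreeAlgebra.ι k (.tens f) + FreeAlgebra.ι k (.tens g))
  | tens_smul (r : k) (f : SuperTensorPower 𝒜 n) : AffineRel n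
      (FreeAlgebra.ι k (.tens (r • f)))
      (r • FreeAlgebra.ι k (.tens f))
  | tens_one : AffineRel n (FreeAlgebra.ι k (.tens 1)) 1
  | tens_mul (f g : SuperTensorPower 𝒜 n) : AffineRel n
      (FreeAlgebra.ι k (.tens (f * g)))
      (FreeAlgebra.ι k (.tens f) * FreeAlgebra.ι k (.tens g))
  | perm_one : AffineRel n (FreeAlgebra.ι k (.perm 1)) 1
  | perm_mul (π σ : Equiv.Perm (Fin n)) : AffineRel n
      (FreeAlgebra.ι k (.perm (π * σ)))
      (FreeAlgebra.ι k (.perm π) * FreeAlgebra.ι k (.perm σ))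
  | tens_x (f : SuperTensorPower 𝒜 n) (i : Fin n) : AffineRel n
      (FreeAlgebra.ι k (.tens f) * FreeAlgebra.ι k (.x i))
      (FreeAlgebra.ι k (.x i) *
        FreeAlgebra.ι k (.tens (SuperTensorPower.mapAt 𝒜 n i (nakayama hF).toLinearMap f)))
  | simple_x_of_ne (i i' j : Fin n) (hi : (i : ℕ) + 1 = i') (hj : j ≠ i) (hj' : j ≠ i') :
      AffineRel n
      (FreeAlgebra.ι k (.perm (Equiv.swap i i')) * FreeAlgebra.ι k (.x j))
      (FreeAlgebra.ι k (.x j) * FreeAlgebra.ι k (.perm (Equiv.swap i i')))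
  | simple_x (i i' : Fin n) (hi : (i : ℕ) + 1 = i') : AffineRel n
      (FreeAlgebra.ι k (.perm (Equiv.swap i i')) * FreeAlgebra.ι k (.x i))
      (FreeAlgebra.ι k (.x i') * FreeAlgebra.ι k (.perm (Equiv.swap i i')) -
        FreeAlgebra.ι k (.tens (teleporter hF B n i i')))
  | perm_tens (π : Equiv.Perm (Fin n)) (f : SuperTensorPower 𝒜 n) : AffineRel n
      (FreeAlgebra.ι k (.perm π) * FreeAlgebra.ι k (.tens f))
      (FreeAlgebra.ι k (.tens (SuperTensorPower.perm 𝒜 n π f)) * FreeAlgebra.ι k (.perm π))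

/-- The affine wreath product algebra `𝒜_n(F)`. -/
def Affine (n : ℕ) : Type (max u v) := RingQuot (AffineRel hF B n)

namespace Affine

variable (n : ℕ)

instance : Ring (Affine hF B n) := inferInstanceAs (Ring (RingQuot _))

instance : Algebra k (Affine hF B n) := inferInstanceAs (Algebra k (RingQuot _))

/-- The image of a generator. -/
def gen (g : Gen 𝒜 n) : Affine hF B n :=
  RingQuot.mkAlgHom k (AffineRel hF B n) (FreeAlgebra.ι k g)

/-- Products of homogeneous generators, with their degree and parity: `x_i` is even of degree `δ`,
elements of `F^{⊗n}` keep their degree and parity, permutations are even of degree `0`. -/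
inductive IsMonomial : Affine hF B n → ℕ × ZMod 2 → Prop
  | one : IsMonomial 1 0
  | x_mul (i : Fin n) (a : Affine hF B n) (p : ℕ × ZMod 2) (ha : IsMonomial a p) :
      IsMonomial (gen hF B n (.x i) * a) ((δ, 0) + p)
  | tens_mul (f : SuperTensorPower 𝒜 n) (q : ℕ × ZMod 2) (hf : f ∈ SuperTensorPower.grading 𝒜 n q)
      (a : Affine hF B n) (p : ℕ × ZMod 2) (ha : IsMonomial a p) :
      IsMonomial (gen hF B n (.tens f) * a) (q + p)
  | perm_mul (π : Equiv.Perm (Fin n)) (a : Affine hF B n) (p : ℕ × ZMod 2)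
      (ha : IsMonomial a p) : IsMonomial (gen hF B n (.perm π) * a) p

/-- The part of `𝒜_n(F)` of given degree and parity. -/
def grading (p : ℕ × ZMod 2) : Submodule k (Affine hF B n) :=
  Submodule.span k {a | IsMonomial hF B n a p}

end Affine

/-- `F_ψ^{(m)}`: the elements `f` fixed by the Nakayama automorphism `ψ` such that
`g f = (-1)^(|f||g|) f ψ^m(g)` for all `g`. -/
def twistedCenter (m : ℤ) : Set F :=
  {f | nakayama hF f = f ∧
    ∀ g, g * f = signed 𝒜 ((LinearMap.mul k F).compl₂ (nakayama hF ^ m).toLinearMap) f g}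

/-- The elements of `F_ψ^{(0)} ⊗ ⋯ ⊗ F_ψ^{(m)} ⊗ ⋯ ⊗ F_ψ^{(0)}` (with `F_ψ^{(m)}` in position `i`)
that are invariant under superpermutation by the stabilizer of `i` in `S_n`. -/
def shiftSpace (n : ℕ) (i : Fin n) (m : ℤ) : Set (SuperTensorPower 𝒜 n) :=
  {u | u ∈ Submodule.span k {a | ∃ f : Fin n → F,
      (∀ j, f j ∈ twistedCenter hF (Function.update (0 : Fin n → ℤ) i m j)) ∧ a = SuperTensorPower.pure 𝒜 n f} ∧
    ∀ π : Equiv.Perm (Fin n), π i = i → SuperTensorPower.perm 𝒜 n π u = u}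

variable {n : ℕ} {θ : ℕ} {e : Fin θ → ℕ} (c : ∀ m : Fin θ, Fin (e m) → SuperTensorPower 𝒜 n)

/-- `∏_{m=1}^θ ∏_{j=1}^{e_m} (x_i^m - c^{(m,j)})`; the index `m : Fin θ` stands for `m + 1`. -/
def cycPoly (i : Fin n) : Affine hF B n :=
  (List.ofFn fun m : Fin θ => (List.ofFn fun j : Fin (e m) =>
    Affine.gen hF B n (.x i) ^ ((m : ℕ) + 1) - Affine.gen hF B n (.tens (c m j))).prod).prod

/-- The two-sided ideal generated by the cyclotomic polynomial in the first variable `x_1` (the zero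
ideal for `n = 0`, where there is no variable). -/
def cycIdeal : TwoSidedIdeal (Affine hF B n) :=
  TwoSidedIdeal.span {a | ∃ i : Fin n, (i : ℕ) = 0 ∧ a = cycPoly hF B c i}

/-- The cyclotomic wreath product algebra. -/
def Cyclotomic : Type (max u v) := (cycIdeal hF B c).ringCon.Quotient

namespace Cyclotomic

instance : Ring (Cyclotomic hF B c) :=
  inferInstanceAs (Ring (cycIdeal hF B c).ringCon.Quotient)

instance : Algebra k (Cyclotomic hF B c) :=
  inferInstanceAs (Algebra k (cycIdeal hF B c).ringCon.Quotient)

/-- The quotient map. -/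
def mk : Affine hF B n →ₐ[k] Cyclotomic hF B c :=
  (cycIdeal hF B c).ringCon.mkₐ k

/-- The image of `x_i`. -/
def x (i : Fin n) : Cyclotomic hF B c := mk hF B c (Affine.gen hF B n (.x i))

/-- The image of an element of `F^{⊗n}`. -/
def tens (f : SuperTensorPower 𝒜 n) : Cyclotomic hF B c :=
  mk hF B c (Affine.gen hF B n (.tens f))

/-- The image of a permutation. -/
def perm (π : Equiv.Perm (Fin n)) : Cyclotomic hF B c :=
  mk hF B c (Affine.gen hF B n (.perm π))

/-- `x_1^{α_1} ⋯ x_n^{α_n}`. -/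
def xPow (α : Fin n → ℕ) : Cyclotomic hF B c :=
  (List.ofFn fun i => x hF B c i ^ α i).prod

/-- The part of the cyclotomic quotient of given degree and parity. -/
def grading (p : ℕ × ZMod 2) : Submodule k (Cyclotomic hF B c) :=
  (Affine.grading hF B n p).map (mk hF B c).toLinearMap

/-- `T (x^α f π) = δ_{α,(d-1,…,d-1)} tr^{⊗n}(f) δ_{π,1}` for all `α` with all `α_i < d`. -/
def IsTopTrace (d : ℕ) (T : Cyclotomic hF B c →ₗ[k] k) : Prop :=
  ∀ (α : Fin n → ℕ) (f : SuperTensorPower 𝒜 n) (π : Equiv.Perm (Fin n)), (∀ i, α i < d) →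
    T (xPow hF B c α * tens hF B c f * perm hF B c π) =
      if (∀ i, α i + 1 = d) ∧ π = 1 then SuperTensorPower.trace 𝒜 n tr f else 0

end Cyclotomic

/-- The level `d = ∑_{m=1}^θ m e_m`; the index `m : Fin θ` stands for `m + 1`. -/
def level {θ : ℕ} (e : Fin θ → ℕ) : ℕ := ∑ m : Fin θ, ((m : ℕ) + 1) * e m

end Affine

end

end AffineWreath

open AffineWreath

/-! The argument is carried out for an abstract `WreathData`: a ring `R` (later `F^{⊗n}`) with an
action of `S_n`, commuting twists `Ψ_i` and teleporters `t_{i,j}`. In `R ⋊ S_n` the Jucys-Murphy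
element `J_i = ∑_{j<i} t_{j,i} (j i)` moves past scalars with the same twist as `x_i`, and the
defining relations amount to `π (x_i - J_i) π⁻¹ = x_{π i} - J_{π i}` (`perm_x`). This closed formula
defines operators on `(R ⋊ S_n) ⊗ k[x_1, …, x_n]`; their commutators intertwine the action of `R ⋊
S_n` up to twists and kill every `1 ⊗ x^α`, hence vanish (`K_eq_zero`). So the monomials `h x^α` are
independent, and linear forms on the affine algebra may be prescribed on them.

Let `χ_i` be the conjugates of the cyclotomic polynomial `χ_1`. Each is monic of degree `d` in `x_i`
modulo lower total degree, and the cyclotomic ideal is the union of the spaces `H S P_m` with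
bounded cofactor degree. As in a Gröbner basis argument, the syzygy `χ_i x_j^d - χ_j x_i^d` is a
combination with cofactors of degree less than `d` (`syzygy_mem`), since `χ_1` commutes with all
variables. Hence rewriting `x_i^d` is consistent (`exists_reduced_functional`), and the monomials
with all exponents less than `d` form a basis of the quotient over `R ⋊ S_n`
(`combination_bijective`).

The trace takes the coefficient of `x_1^{d-1} ⋯ x_n^{d-1}`, then the coefficient of the identity
permutation, then `tr^{⊗n}`. It kills everything of degree below `n(d-1)`, and elements of `R ⋊ S_n`
cross monomials up to lower degree and a twist that the trace does not see. So `x^α` pairs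
triangularly with its complement `x^{(d-1,…,d-1)-α}`, and nondegeneracy reduces to that of `tr^{⊗n}`
(`exists_sub_vanish`, `traceMap_surjective`).

For the Nakayama automorphism: permutations are trace-central; moving a tensor past the top monomial
gives `ψ^{d-1}` in each factor, and `tr^{⊗n}` gives one more `ψ` together with the parity sign
(`traceMap_tens`). For `x_1`, the Jucys-Murphy term from commuting past `π` cancels the one from
reducing `x^d`, and the remaining subleading coefficient of `χ_1` is fixed by `ψ`
(`traceMap_top_succ`, `traceMap_x_first`). The other variables are conjugates of `x_1` plus
Jucys-Murphy elements (`traceMap_x`).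

For `F^{⊗n}`, the axioms on teleporters are Casimir identities for dual bases. The grading of the
quotient comes from a coaction into a monoid algebra, and homogeneity of the trace from its
uniqueness. -/

namespace AffineWreath

noncomputable section

open scoped TensorProduct

universe u v w

set_option linter.unusedSectionVars false

/-! ### Wreath data, Jucys-Murphy elements and representations -/

section

open SkewMonoidAlgebra Equiv

/-- Induction on permutations of `Fin n` along adjacent transpositions. -/
theorem perm_induction_adjacent {n : ℕ} {P : Perm (Fin n) → Prop} (one : P 1)
    (swap_mul : ∀ (i i' : Fin n) (π : Perm (Fin n)), (i : ℕ) + 1 = i' → P π → P (swap i i' * π))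
    (π : Perm (Fin n)) : P π := by
  rcases n with _ | n
  · rwa [Subsingleton.elim π 1]
  · have h : π ∈ Submonoid.closure (Set.range fun i : Fin n => swap i.castSucc i.succ) := by
      rw [Perm.mclosure_swap_castSucc_succ]; trivial
    induction h using Submonoid.closure_induction_left with
    | one => exact one
    | mul_left x hx y _ ih =>
      obtain ⟨i, rfl⟩ := hx
      exact swap_mul _ _ _ (by simp) ih

/-- The structure of a ring `R` (such as a super tensor power of a Frobenius superalgebra) acted on
by `S_n` that enters the relations of an affine wreath product algebra. -/
structure WreathData (k : Type u) (R : Type v) (n : ℕ) [CommRing k] [Ring R] [Algebra k R]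
    [MulSemiringAction (Perm (Fin n)) R] where
  /-- The twist of the `i`-th variable. -/
  Ψ : Fin n → R ≃ₐ[k] R
  /-- The teleporters. -/
  t : Fin n → Fin n → R
  Ψ_comm : ∀ i j f, Ψ i (Ψ j f) = Ψ j (Ψ i f)
  smul_Ψ : ∀ (π : Perm (Fin n)) i f, π • Ψ i f = Ψ (π i) (π • f)
  smul_t : ∀ (π : Perm (Fin n)) i j, π • t i j = t (π i) (π j)
  mul_t : ∀ i j f, i ≠ j → f * t i j = t i j * Ψ i (swap i j • f)
  Ψ_t : ∀ i j, i ≠ j → Ψ j (t i j) = t j i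
  Ψ_t_of_ne : ∀ l i j, l ≠ i → l ≠ j → Ψ l (t i j) = t i j

variable {k : Type u} {R : Type v} {n : ℕ} [CommRing k] [Ring R] [Algebra k R]
  [MulSemiringAction (Perm (Fin n)) R]

namespace WreathData

variable (D : WreathData k R n)

theorem smul_Ψ_symm (π : Perm (Fin n)) (i f) : π • (D.Ψ i).symm f = (D.Ψ (π i)).symm (π • f) := by
  rw [AlgEquiv.eq_symm_apply, ← D.smul_Ψ, AlgEquiv.apply_symm_apply]

/-- `t_{i,j} (i j)`. -/
def τ (i j : Fin n) : SkewMonoidAlgebra R (Perm (Fin n)) := single (swap i j) (D.t i j)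

/-- The Jucys-Murphy elements. -/
def J (i : Fin n) : SkewMonoidAlgebra R (Perm (Fin n)) := ∑ j with j < i, D.τ j i

/-- The difference `J_i π - π J_{π⁻¹ i}`. -/
def dev (i : Fin n) (π : Perm (Fin n)) : SkewMonoidAlgebra R (Perm (Fin n)) :=
  D.J i * single π 1 - single π 1 * D.J (π⁻¹ i)

theorem C_mul_τ (i j : Fin n) (h : i ≠ j) (f : R) :
    single 1 f * D.τ i j = D.τ i j * single 1 (D.Ψ j f) := by
  rw [τ, single_mul_single, single_mul_single, one_smul, one_mul, mul_one, D.mul_t _ _ _ h,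
    D.smul_Ψ, swap_apply_right]

theorem C_mul_J (i : Fin n) (f : R) : single 1 f * D.J i = D.J i * single 1 (D.Ψ i f) := by
  rw [J, Finset.mul_sum, Finset.sum_mul]
  refine Finset.sum_congr rfl fun j hj => D.C_mul_τ _ _ (ne_of_lt (by simpa using hj)) _

theorem perm_mul_τ (π : Perm (Fin n)) (i j : Fin n) :
    single π 1 * D.τ i j = D.τ (π i) (π j) * single π 1 := by
  rw [τ, τ, single_mul_single, single_mul_single, smul_one, mul_one, one_mul, D.smul_t,
    Perm.mul_def, Perm.mul_def, swap_apply_apply]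
  congr 1
  ext; simp [Perm.mul_def]

theorem perm_mul_J (π : Perm (Fin n)) (i : Fin n) :
    single π 1 * D.J i = (∑ j with π⁻¹ j < i, D.τ j (π i)) * single π 1 := by
  rw [J, Finset.mul_sum, Finset.sum_mul]
  refine Finset.sum_equiv π (by simp) fun j _ => D.perm_mul_τ _ _ _

/-- After moving `π` to the right, both Jucys-Murphy sums consist of terms `τ j i`. Only those `j`
whose order relative to `i` is changed by `π⁻¹` survive, so an adjacent transposition leaves at most
one term. -/
theorem dev_eq (i : Fin n) (π : Perm (Fin n)) :
    D.dev i π = (∑ j with j < i, D.τ j i - ∑ j with π⁻¹ j < π⁻¹ i, D.τ j i) * single π 1 := by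
  rw [dev, perm_mul_J, sub_mul, J, ← Perm.mul_apply, mul_inv_cancel, Perm.one_apply]

/-- The cocycle rule that extends statements about adjacent transpositions to all of `S_n`. -/
theorem dev_mul (i : Fin n) (σ π : Perm (Fin n)) :
    D.dev i (σ * π) = D.dev i σ * single π 1 + single σ 1 * D.dev (σ⁻¹ i) π := by
  have : (single (σ * π) 1 : SkewMonoidAlgebra R (Perm (Fin n))) = single σ 1 * single π 1 := by
    simp [single_mul_single]
  rw [dev, dev, dev, this, mul_inv_rev, Perm.mul_apply, sub_mul, mul_sub]
  noncomm_ring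

theorem dev_one (i : Fin n) : D.dev i 1 = 0 := by
  simp [dev_eq]

/-- Since `J_i` crosses scalars with the same twist as `x_i`, the correction in the commutation of
`x_i` and `π` is compatible with the action of `R`. -/
theorem dev_mul_C (i : Fin n) (π : Perm (Fin n)) (g : R) :
    D.dev i π * single 1 g = single 1 ((D.Ψ i).symm (π • g)) * D.dev i π := by
  have h1 : (single π 1 : SkewMonoidAlgebra R (Perm (Fin n))) * single 1 g =
      single 1 (π • g) * single π 1 := by simp [single_mul_single]
  have h2 : D.J i * single 1 (π • g) = single 1 ((D.Ψ i).symm (π • g)) * D.J i := by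
    rw [C_mul_J, AlgEquiv.apply_symm_apply]
  have h3 : D.J (π⁻¹ i) * single 1 g = single 1 ((D.Ψ (π⁻¹ i)).symm g) * D.J (π⁻¹ i) := by
    rw [C_mul_J, AlgEquiv.apply_symm_apply]
  have h4 : (single π 1 : SkewMonoidAlgebra R (Perm (Fin n))) *
      single 1 ((D.Ψ (π⁻¹ i)).symm g) = single 1 ((D.Ψ i).symm (π • g)) * single π 1 := by
    simp [single_mul_single, D.smul_Ψ_symm]
  rw [dev, sub_mul, mul_assoc, h1, ← mul_assoc, h2, mul_assoc _ (D.J (π⁻¹ i)), h3,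
    ← mul_assoc (single π 1), h4, mul_sub, mul_assoc, mul_assoc]

theorem dev_succ {i i' : Fin n} (h : (i : ℕ) + 1 = i') : D.dev i' (swap i i') = single 1 (D.t i i') := by
  have hne : i ≠ i' := by rintro rfl; omega
  -- An adjacent transposition changes only the relative order of `i` and `i'`, so the two index
  -- sets differ by `i` alone.
  have : (Finset.univ.filter fun j : Fin n => j < i') =
      insert i (Finset.univ.filter fun j => (swap i i')⁻¹ j < (swap i i')⁻¹ i') := by
    ext j
    simp only [swap_inv, swap_apply_right, Finset.mem_filter, Finset.mem_univ, true_and,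
      Finset.mem_insert]
    rcases eq_or_ne j i with rfl | hj
    · simp only [true_or, iff_true, Fin.lt_def]; omega
    rcases eq_or_ne j i' with rfl | hj'
    · simp [hj]
    · simp only [swap_apply_of_ne_of_ne hj hj', hj, false_or, Fin.lt_def]
      have := Fin.val_ne_of_ne hj
      omega
  rw [dev_eq, this, Finset.sum_insert (by simpa using Fin.le_def.2 (by omega)), add_sub_cancel_right, τ,
    single_mul_single, swap_mul_self, smul_one, mul_one]

/-- The cocycle rule applied to `s * s = 1` expresses this value through the one at the other index
of the transposition. -/
theorem dev_self {i i' : Fin n} (h : (i : ℕ) + 1 = i') :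
    D.dev i (swap i i') = - single 1 (D.t i' i) := by
  have h1 := D.dev_mul i (swap i i') (swap i i')
  rw [swap_mul_self, dev_one, swap_inv, swap_apply_left, dev_succ D h] at h1
  have h2 : D.dev i (swap i i') * single (swap i i') 1 =
      - (single 1 (D.t i' i) * single (swap i i') 1) := by
    rw [eq_neg_of_add_eq_zero_left h1.symm]
    simp [single_mul_single, D.smul_t]
  have h3 : (single (swap i i') 1 : SkewMonoidAlgebra R (Perm (Fin n))) * single (swap i i') 1 = 1 := by
    simp [single_mul_single]
  calc _ = D.dev i (swap i i') * single (swap i i') 1 * single (swap i i') 1 := by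
        rw [mul_assoc, h3, mul_one]
    _ = _ := by rw [h2, neg_mul, mul_assoc, h3, mul_one]

theorem dev_of_ne {i i' j : Fin n} (h : (i : ℕ) + 1 = i') (hj : j ≠ i) (hj' : j ≠ i') :
    D.dev j (swap i i') = 0 := by
  have : (Finset.univ.filter fun l : Fin n => l < j) =
      (Finset.univ.filter fun l => (swap i i')⁻¹ l < (swap i i')⁻¹ j) := by
    ext l
    simp only [swap_inv, swap_apply_of_ne_of_ne hj hj', Finset.mem_filter, Finset.mem_univ, true_and]
    have := Fin.val_ne_of_ne hj
    have := Fin.val_ne_of_ne hj'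
    rcases eq_or_ne l i with rfl | hl
    · simp only [swap_apply_left, Fin.lt_def]; omega
    rcases eq_or_ne l i' with rfl | hl'
    · simp only [swap_apply_right, Fin.lt_def]; omega
    · rw [swap_apply_of_ne_of_ne hl hl']
  rw [dev_eq, this, sub_self, zero_mul]

end WreathData

variable [SMulCommClass (Perm (Fin n)) k R]

/-- The data defining a homomorphism from an affine wreath product algebra to `A`. -/
structure AffineRep (D : WreathData k R n) (A : Type w) [Ring A] [Algebra k A] where
  /-- The images of the elements of `R`. -/
  tens : R →ₐ[k] A
  /-- The images of the variables. -/
  x : Fin n → A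
  /-- The images of the permutations. -/
  perm : Perm (Fin n) →* A
  x_comm : ∀ i j, x i * x j = x j * x i
  tens_x : ∀ f i, tens f * x i = x i * tens (D.Ψ i f)
  simple_x_of_ne : ∀ i i' j : Fin n, (i : ℕ) + 1 = i' → j ≠ i → j ≠ i' →
    perm (swap i i') * x j = x j * perm (swap i i')
  simple_x : ∀ i i' : Fin n, (i : ℕ) + 1 = i' →
    perm (swap i i') * x i = x i' * perm (swap i i') - tens (D.t i i')
  perm_tens : ∀ π f, perm π * tens f = tens (π • f) * perm π

namespace AffineRep

variable {D : WreathData k R n} {A : Type w} [Ring A] [Algebra k A] (ρ : AffineRep D A)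

/-- The homomorphism from the wreath product. -/
def hat : SkewMonoidAlgebra R (Perm (Fin n)) →ₐ[k] A :=
  liftNCAlgHom ρ.tens ρ.perm fun {_ _} => (ρ.perm_tens _ _).symm

theorem hat_single (π : Perm (Fin n)) (f : R) : ρ.hat (single π f) = ρ.tens f * ρ.perm π :=
  liftNC_single _ _ _ _

theorem hat_C (f : R) : ρ.hat (single 1 f) = ρ.tens f := by
  rw [hat_single, map_one, mul_one]

theorem hat_perm (π : Perm (Fin n)) : ρ.hat (single π 1) = ρ.perm π := by
  rw [hat_single, map_one, one_mul]

/-- Equivalently, the elements `x_i - J_i` are permuted by `S_n`. The relations give this for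
adjacent transpositions, and the cocycle rule for `dev` does the rest. -/
theorem perm_x (π : Perm (Fin n)) :
    ∀ i, ρ.perm π * ρ.x i = ρ.x (π i) * ρ.perm π - ρ.hat (D.dev (π i) π) := by
  induction π using perm_induction_adjacent with
  | one => intro i; simp [D.dev_one]
  | swap_mul l l' π h ih =>
    intro i
    have key : ∀ j, ρ.perm (swap l l') * ρ.x j =
        ρ.x (swap l l' j) * ρ.perm (swap l l') - ρ.hat (D.dev (swap l l' j) (swap l l')) := by
      intro j
      rcases eq_or_ne j l with rfl | hj
      · rw [swap_apply_left, D.dev_succ h, hat_C, ρ.simple_x _ _ h]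
      -- The relation for the larger index is not a defining one; multiplying the relation for `x_l`
      -- by the transposition on both sides produces it and turns `t_{l,l'}` into `t_{l',l}`.
      rcases eq_or_ne j l' with rfl | hj'
      · have h1 := ρ.simple_x _ _ h
        have h2 : ρ.perm (swap l j) * ρ.perm (swap l j) = 1 := by
          rw [← map_mul, swap_mul_self, map_one]
        have h3 : ρ.perm (swap l j) * ρ.tens (D.t l j) * ρ.perm (swap l j) = ρ.tens (D.t j l) := by
          rw [ρ.perm_tens, D.smul_t, swap_apply_left, swap_apply_right, mul_assoc, h2, mul_one]
        have h4 : ρ.x j * ρ.perm (swap l j) = ρ.perm (swap l j) * ρ.x l + ρ.tens (D.t l j) := by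
          rw [h1, sub_add_cancel]
        rw [swap_apply_right, D.dev_self h, map_neg, hat_C, sub_neg_eq_add, ← h3]
        calc _ = ρ.perm (swap l j) * (ρ.x j * ρ.perm (swap l j)) * ρ.perm (swap l j) := by
              rw [mul_assoc, mul_assoc, h2, mul_one]
          _ = (ρ.perm (swap l j) * ρ.perm (swap l j)) * ρ.x l * ρ.perm (swap l j) +
              ρ.perm (swap l j) * ρ.tens (D.t l j) * ρ.perm (swap l j) := by
              rw [h4]; noncomm_ring
          _ = _ := by rw [h2, one_mul]
      · rw [swap_apply_of_ne_of_ne hj hj', D.dev_of_ne h hj hj', map_zero, sub_zero,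
          ρ.simple_x_of_ne _ _ _ h hj hj']
    rw [map_mul, mul_assoc, ih, mul_sub, ← mul_assoc, key, ← Perm.mul_apply, D.dev_mul, map_add,
      map_mul, map_mul, hat_perm, hat_perm]
    simp only [Perm.mul_apply, swap_inv, swap_apply_self]
    noncomm_ring

/-- Homomorphisms of algebras act on representations. -/
def comp {A' : Type*} [Ring A'] [Algebra k A'] (f : A →ₐ[k] A') : AffineRep D A' where
  tens := f.comp ρ.tens
  x i := f (ρ.x i)
  perm := (f : A →* A').comp ρ.perm
  x_comm i j := by rw [← map_mul, ρ.x_comm, map_mul]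
  tens_x g i := by simp only [AlgHom.comp_apply, ← map_mul, ρ.tens_x]
  simple_x_of_ne i i' j h h1 h2 := by
    simp only [MonoidHom.comp_apply, MonoidHom.coe_coe, ← map_mul,
      ρ.simple_x_of_ne i i' j h h1 h2]
  simple_x i i' h := by
    simp only [MonoidHom.comp_apply, MonoidHom.coe_coe, ← map_mul, ρ.simple_x i i' h, map_sub,
      AlgHom.comp_apply]
  perm_tens π g := by
    simp only [MonoidHom.comp_apply, MonoidHom.coe_coe, ← map_mul, ρ.perm_tens, AlgHom.comp_apply]

end AffineRep

end

/-! ### Monomials and the PBW representation -/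

section

open SkewMonoidAlgebra Equiv

theorem exponent_induction {n : ℕ} {P : (Fin n → ℕ) → Prop} (zero : P 0)
    (add_single : ∀ α i, P α → P (α + Pi.single i 1)) (α : Fin n → ℕ) : P α := by
  induction h : ∑ i, α i generalizing α with
  | zero =>
    have : α = 0 := by
      funext i
      simpa using (Finset.sum_eq_zero_iff.1 h) i (Finset.mem_univ i)
    rwa [this]
  | succ m ih =>
    obtain ⟨i, -, hi⟩ : ∃ i ∈ Finset.univ, α i ≠ 0 := by
      by_contra! hc
      rw [Finset.sum_eq_zero hc] at h
      omega
    have hα : α = (α - Pi.single i 1) + Pi.single i 1 := by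
      funext j
      rcases eq_or_ne j i with rfl | hj
      · simp; omega
      · simp [hj]
    rw [hα]
    refine add_single _ _ (ih _ ?_)
    rw [hα] at h
    simp only [Pi.add_apply, Finset.sum_add_distrib, Finset.sum_pi_single', Finset.mem_univ,
      if_true] at h
    omega

theorem prod_ofFn_mul {A : Type w} [Monoid A] {n : ℕ} (f g : Fin n → A)
    (h : ∀ i j, g i * f j = f j * g i) :
    (List.ofFn fun i => f i * g i).prod = (List.ofFn f).prod * (List.ofFn g).prod := by
  induction n with
  | zero => simp
  | succ n ih =>
    rw [List.ofFn_succ, List.ofFn_succ, List.ofFn_succ, List.prod_cons, List.prod_cons,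
      List.prod_cons, ih _ _ fun i j => h _ _]
    have : g 0 * (List.ofFn fun i : Fin n => f i.succ).prod =
        (List.ofFn fun i : Fin n => f i.succ).prod * g 0 := by
      refine (Commute.list_prod_right _ _ fun y hy => ?_).eq
      obtain ⟨j, rfl⟩ := (List.mem_ofFn' _ _).1 hy
      exact h _ _
    rw [mul_assoc, mul_assoc, ← mul_assoc (g 0), this, mul_assoc]

variable {k : Type u} {R : Type v} {n : ℕ} [CommRing k] [Ring R] [Algebra k R]
  [MulSemiringAction (Perm (Fin n)) R] [SMulCommClass (Perm (Fin n)) k R]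

namespace AffineRep

variable {D : WreathData k R n} {A : Type w} [Ring A] [Algebra k A] (ρ : AffineRep D A)

/-- `x_1^{α_1} ⋯ x_n^{α_n}`. -/
def xPow (α : Fin n → ℕ) : A := (List.ofFn fun i => ρ.x i ^ α i).prod

theorem xPow_zero : ρ.xPow 0 = 1 := by
  simp [xPow, List.ofFn_const]

theorem xPow_add (α β : Fin n → ℕ) : ρ.xPow (α + β) = ρ.xPow α * ρ.xPow β := by
  rw [xPow, xPow, xPow, ← prod_ofFn_mul _ _ fun i j => (show Commute _ _ from ρ.x_comm _ _).pow_pow _ _]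
  simp [pow_add]

theorem xPow_single (i : Fin n) (m : ℕ) : ρ.xPow (Pi.single i m) = ρ.x i ^ m := by
  rw [xPow]
  have : ∀ {n : ℕ} (x : Fin n → A) (i : Fin n),
      (List.ofFn fun j => x j ^ (Pi.single i m : Fin n → ℕ) j).prod = x i ^ m := by
    intro n
    induction n with
    | zero => intro x i; exact i.elim0
    | succ n ih =>
      intro x i
      rw [List.ofFn_succ, List.prod_cons]
      rcases Fin.eq_zero_or_eq_succ i with rfl | ⟨i, rfl⟩
      · simp [List.ofFn_const]
      · have := ih (fun j => x j.succ) i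
        simp only [Pi.single_apply, Fin.succ_inj] at this ⊢
        rw [this]
        simp [(Fin.succ_ne_zero i).symm]
  exact this _ _

theorem xPow_single_one (i : Fin n) : ρ.xPow (Pi.single i 1) = ρ.x i := by
  rw [xPow_single, pow_one]

theorem comp_xPow {A' : Type*} [Ring A'] [Algebra k A'] (f : A →ₐ[k] A') (α : Fin n → ℕ) :
    (ρ.comp f).xPow α = f (ρ.xPow α) := by
  rw [xPow, xPow, map_list_prod, List.map_ofFn]
  congr 2
  funext i
  simp [comp]

theorem comp_hat {A' : Type*} [Ring A'] [Algebra k A'] (f : A →ₐ[k] A')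
    (h : SkewMonoidAlgebra R (Perm (Fin n))) : (ρ.comp f).hat h = f (ρ.hat h) := by
  induction h using SkewMonoidAlgebra.induction_on with
  | zero => simp
  | single π g => simp [hat_single, comp]
  | add a b ha hb => simp only [map_add, ha, hb]

end AffineRep

/-! The representation on `(R ⋊ S_n) ⊗ k[x_1, …, x_n]`. -/

namespace WreathData

variable (D : WreathData k R n)

variable (k R n) in
/-- The inclusion of `R` in `R ⋊ S_n`. -/
def C : R →ₐ[k] SkewMonoidAlgebra R (Perm (Fin n)) where
  __ := singleOneRingHom
  commutes' _ := rfl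

theorem C_apply (f : R) : C k R n f = single 1 f := rfl

variable (R n) in
/-- The module `(R ⋊ S_n) ⊗ k[x_1, …, x_n]`. -/
def PBW : Type v := (Fin n → ℕ) →₀ SkewMonoidAlgebra R (Perm (Fin n))

namespace PBW

instance : AddCommGroup (PBW R n) := inferInstanceAs (AddCommGroup (_ →₀ _))

instance : Module k (PBW R n) := inferInstanceAs (Module k (_ →₀ _))

variable (k) in
/-- The element `h ⊗ x^α`. -/
def mon (α : Fin n → ℕ) : SkewMonoidAlgebra R (Perm (Fin n)) →ₗ[k] PBW R n := Finsupp.lsingle α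

/-- The linear map given by its values on the elements `h ⊗ x^α`. -/
def lift {M : Type*} [AddCommGroup M] [Module k M]
    (f : (Fin n → ℕ) → SkewMonoidAlgebra R (Perm (Fin n)) →ₗ[k] M) : PBW R n →ₗ[k] M :=
  Finsupp.lsum k f

@[simp] theorem lift_mon {M : Type*} [AddCommGroup M] [Module k M]
    (f : (Fin n → ℕ) → SkewMonoidAlgebra R (Perm (Fin n)) →ₗ[k] M) (α h) :
    lift f (mon k α h) = f α h :=
  Finsupp.lsum_single k f α h

theorem ext_mon {M : Type*} [AddCommGroup M] [Module k M] {f g : PBW R n →ₗ[k] M}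
    (h : ∀ α a, f (mon k α a) = g (mon k α a)) : f = g :=
  Finsupp.lhom_ext h

theorem ext {M : Type*} [AddCommGroup M] [Module k M] {f g : PBW R n →ₗ[k] M}
    (h : ∀ α π r, f (mon k α (single π r)) = g (mon k α (single π r))) : f = g :=
  ext_mon fun α a => LinearMap.congr_fun
    (SkewMonoidAlgebra.lhom_ext (φ := f ∘ₗ mon k α) (ψ := g ∘ₗ mon k α)
      fun π r => h α π r) a

end PBW

/-- The action of `x_i`. -/
def X (i : Fin n) : Module.End k (PBW R n) :=
  PBW.lift fun α => (Finsupp.lsum k fun π : Perm (Fin n) =>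
    (PBW.mon k (α + Pi.single (π⁻¹ i) 1) ∘ₗ lsingle k π +
      PBW.mon k α ∘ₗ LinearMap.mulRight k (D.dev i π) ∘ₗ lsingle k 1) ∘ₗ
        (D.Ψ i).symm.toLinearMap) ∘ₗ (coeffLinearEquiv (S := k) :
      SkewMonoidAlgebra R (Perm (Fin n)) ≃ₗ[k] _).toLinearMap

/-- With `h ⊗ x^α` read as `h x^α`, the formula is forced: `x_i` passes the scalar by `Ψ_i⁻¹`, and
`x_i π = π x_{π⁻¹ i} + dev i π`. -/
theorem X_single (i : Fin n) (α : Fin n → ℕ) (π : Perm (Fin n)) (g : R) :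
    D.X i (PBW.mon k α (single π g)) =
      PBW.mon k (α + Pi.single (π⁻¹ i) 1) (single π ((D.Ψ i).symm g)) +
        PBW.mon k α (single 1 ((D.Ψ i).symm g) * D.dev i π) := by
  have h : (coeffLinearEquiv (S := k) : SkewMonoidAlgebra R (Perm (Fin n)) ≃ₗ[k] _) (single π g) =
    Finsupp.single π g := rfl
  rw [X, PBW.lift_mon, LinearMap.comp_apply, LinearEquiv.coe_coe, h, Finsupp.lsum_single]
  simp [lsingle_apply]

variable (k R n) in
/-- The action of `R ⋊ S_n`. -/
def L : SkewMonoidAlgebra R (Perm (Fin n)) →ₐ[k] Module.End k (PBW R n) :=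
  AlgHom.ofLinearMap
    { toFun := fun h => PBW.lift fun α => PBW.mon k α ∘ₗ LinearMap.mulLeft k h
      map_add' := fun a b => PBW.ext_mon fun α h => by simp [add_mul]
      map_smul' := fun r a => PBW.ext_mon fun α h => by simp }
    (PBW.ext_mon fun α h => by simp)
    fun a b => PBW.ext_mon fun α h => by simp

theorem L_single (h h' : SkewMonoidAlgebra R (Perm (Fin n))) (α : Fin n → ℕ) :
    L k R n h (PBW.mon k α h') = PBW.mon k α (h * h') := by
  simp [L]

theorem L_mul_X (f : R) (i : Fin n) :
    L k R n (single 1 f) * D.X i = D.X i * L k R n (single 1 (D.Ψ i f)) := by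
  refine PBW.ext fun α π r => ?_
  rw [Module.End.mul_apply, Module.End.mul_apply, L_single, X_single, single_mul_single, one_mul,
    one_smul, X_single, map_mul (D.Ψ i).symm, AlgEquiv.symm_apply_apply, map_add, L_single, L_single,
    single_mul_single, one_mul, one_smul, ← mul_assoc, single_mul_single, one_mul, one_smul]

theorem L_perm_X (π : Perm (Fin n)) (i : Fin n) :
    D.X (π i) * L k R n (single π 1) =
      L k R n (single π 1) * D.X i + L k R n (D.dev (π i) π) := by
  refine PBW.ext fun α σ r => ?_
  have h : π⁻¹ (π i) = i := by simp
  rw [Module.End.mul_apply, LinearMap.add_apply, Module.End.mul_apply, L_single, X_single,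
    single_mul_single, one_mul, X_single, map_add, L_single, L_single, L_single, dev_mul, mul_inv_rev,
    Perm.mul_apply, h, single_mul_single, one_mul, smul_Ψ_symm, ← mul_assoc (single π 1),
    single_mul_single, mul_one, one_mul, smul_Ψ_symm, add_assoc, ← map_add]
  congr 2
  have h1 : (single σ r : SkewMonoidAlgebra R (Perm (Fin n))) = single 1 r * single σ 1 := by
    simp [single_mul_single]
  have h2 : (single π ((D.Ψ (π i)).symm (π • r)) : SkewMonoidAlgebra R (Perm (Fin n))) =
      single 1 ((D.Ψ (π i)).symm (π • r)) * single π 1 := by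
    simp [single_mul_single]
  rw [h1, ← mul_assoc, dev_mul_C, h2, mul_add, add_comm, mul_assoc, mul_assoc]

/-- The commutator of two variables. -/
def K (i j : Fin n) : Module.End k (PBW R n) := D.X i * D.X j - D.X j * D.X i

theorem K_L (i j : Fin n) (f : R) :
    L k R n (single 1 f) * D.K i j = D.K i j * L k R n (single 1 (D.Ψ j (D.Ψ i f))) := by
  have h1 : L k R n (single 1 f) * (D.X i * D.X j) =
      D.X i * D.X j * L k R n (single 1 (D.Ψ j (D.Ψ i f))) := by
    rw [← mul_assoc, L_mul_X, mul_assoc, L_mul_X, mul_assoc]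
  have h2 : L k R n (single 1 f) * (D.X j * D.X i) =
      D.X j * D.X i * L k R n (single 1 (D.Ψ j (D.Ψ i f))) := by
    rw [← mul_assoc, L_mul_X, mul_assoc, L_mul_X, mul_assoc, D.Ψ_comm]
  rw [K, mul_sub, sub_mul, h1, h2]

theorem K_perm (π : Perm (Fin n)) (i j : Fin n) :
    D.K (π i) (π j) * L k R n (single π 1) = L k R n (single π 1) * D.K i j +
      (L k R n (D.dev (π i) π) * D.X j - L k R n (D.dev (π j) π) * D.X i +
        D.X (π i) * L k R n (D.dev (π j) π) - D.X (π j) * L k R n (D.dev (π i) π)) := by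
  have h : ∀ i j, D.X (π i) * D.X (π j) * L k R n (single π 1) =
      L k R n (single π 1) * D.X i * D.X j + L k R n (D.dev (π i) π) * D.X j +
        D.X (π i) * L k R n (D.dev (π j) π) := by
    intro i j
    rw [mul_assoc, L_perm_X, mul_add, ← mul_assoc, L_perm_X, add_mul]
  rw [K, K, sub_mul, h, h]
  noncomm_ring

/-- The error terms of `K_perm` cancel here because each `dev` is a single teleporter up to sign:
variables outside its two indices commute with it, and by `Ψ_t` the variable `x_j` crosses `t_{i,j}`
by turning it into `t_{j,i}`. -/
theorem K_swap {l l' : Fin n} (h : (l : ℕ) + 1 = l') (i j : Fin n) (hij : i ≠ j) :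
    D.K (swap l l' i) (swap l l' j) * L k R n (single (swap l l') 1) =
      L k R n (single (swap l l') 1) * D.K i j := by
  have hne : l ≠ l' := by rintro rfl; omega
  rw [K_perm, add_eq_left (a := L k R n (single (swap l l') 1) * D.K i j)]
  have comm : ∀ a b c : Fin n, c ≠ a → c ≠ b →
      L k R n (single 1 (D.t a b)) * D.X c = D.X c * L k R n (single 1 (D.t a b)) := by
    intro a b c h1 h2
    rw [L_mul_X, D.Ψ_t_of_ne _ _ _ h1 h2]
  have tw : ∀ a b : Fin n, a ≠ b →
      L k R n (single 1 (D.t a b)) * D.X b = D.X b * L k R n (single 1 (D.t b a)) := by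
    intro a b h
    rw [L_mul_X, D.Ψ_t _ _ h]
  by_cases hi : i = l
  · subst hi
    by_cases hj : j = l'
    · subst hj
      rw [swap_apply_left, swap_apply_right, D.dev_succ h, D.dev_self h, map_neg, neg_mul, mul_neg,
        tw _ _ hne, tw _ _ hne.symm]
      abel
    · rw [swap_apply_left, swap_apply_of_ne_of_ne hij.symm hj, D.dev_succ h,
        D.dev_of_ne h hij.symm hj, map_zero, comm _ _ _ hij.symm hj]
      simp
  by_cases hi' : i = l'
  · subst hi'
    by_cases hj : j = l
    · subst hj
      rw [swap_apply_left, swap_apply_right, D.dev_succ h, D.dev_self h, map_neg, neg_mul, mul_neg,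
        tw _ _ hne, tw _ _ hne.symm]
      abel
    · rw [swap_apply_right, swap_apply_of_ne_of_ne hj hij.symm, D.dev_self h,
        D.dev_of_ne h hj hij.symm, map_zero, map_neg, neg_mul, mul_neg, comm _ _ _ hij.symm hj]
      simp
  rw [swap_apply_of_ne_of_ne hi hi', D.dev_of_ne h hi hi', map_zero, zero_mul, mul_zero]
  by_cases hj : j = l
  · subst hj
    rw [swap_apply_left, D.dev_succ h, comm _ _ _ hi hi']
    simp
  by_cases hj' : j = l'
  · subst hj'
    rw [swap_apply_right, D.dev_self h, map_neg, neg_mul, mul_neg, comm _ _ _ hi' hi]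
    simp
  rw [swap_apply_of_ne_of_ne hj hj', D.dev_of_ne h hj hj', map_zero]
  simp

theorem X_one (i : Fin n) (α : Fin n → ℕ) :
    D.X i (PBW.mon k α 1) = PBW.mon k (α + Pi.single i 1) 1 := by
  rw [SkewMonoidAlgebra.one_def, X_single, map_one, dev_one]
  simp

theorem K_one (i j : Fin n) (α : Fin n → ℕ) : D.K i j (PBW.mon k α 1) = 0 := by
  rw [K, LinearMap.sub_apply, Module.End.mul_apply, Module.End.mul_apply, X_one, X_one, X_one, X_one,
    add_right_comm, sub_self]

/-- The commutator intertwines scalars up to twists and permutations up to renaming indices, and it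
kills `1 ⊗ x^α`. These vectors generate the module over `R ⋊ S_n`. -/
theorem K_eq_zero (i j : Fin n) : D.K i j = 0 := by
  by_cases hij : i = j
  · rw [hij, K, sub_self]
  have key : ∀ π : Perm (Fin n), ∀ i j, i ≠ j →
      D.K (π i) (π j) * L k R n (single π 1) = L k R n (single π 1) * D.K i j := by
    intro π
    induction π using perm_induction_adjacent with
    | one => intro i j _; simp
    | swap_mul l l' π h ih =>
      intro i j hij
      have : (single (swap l l' * π) 1 : SkewMonoidAlgebra R (Perm (Fin n))) =
        single (swap l l') 1 * single π 1 := by simp [single_mul_single]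
      rw [this, map_mul, ← mul_assoc, Perm.mul_apply, Perm.mul_apply,
        D.K_swap h _ _ (π.injective.ne hij), mul_assoc, ih _ _ hij, mul_assoc]
  refine PBW.ext fun α π r => ?_
  have h1 : PBW.mon k α (single π r) =
      L k R n (single 1 r) (L k R n (single π 1) (PBW.mon k α 1)) := by
    rw [L_single, L_single, mul_one, single_mul_single, one_mul, one_smul, mul_one]
  -- Writing the scalar as a double twist makes it the right-hand scalar in `K_L`, so that it can be
  -- pulled out on the left.
  have h2 : r = D.Ψ j (D.Ψ i ((D.Ψ i).symm ((D.Ψ j).symm r))) := by simp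
  have h3 := key π (π⁻¹ i) (π⁻¹ j) (by simpa using hij)
  simp only [← Perm.mul_apply, mul_inv_cancel, Perm.one_apply] at h3
  rw [h1, h2, ← Module.End.mul_apply, ← K_L, Module.End.mul_apply, ← Module.End.mul_apply (D.K i j),
    h3, Module.End.mul_apply, K_one]
  simp

/-- The representation of the affine wreath product algebra on `(R ⋊ S_n) ⊗ k[x_1, …, x_n]`. -/
def pbwRep : AffineRep D (Module.End k (PBW R n)) where
  tens := (L k R n).comp (C k R n)
  x := D.X
  perm := (L k R n : _ →* _).comp (of R (Perm (Fin n)))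
  x_comm i j := sub_eq_zero.1 (D.K_eq_zero i j)
  tens_x f i := D.L_mul_X f i
  simple_x_of_ne i i' j h hj hj' := by
    have := D.L_perm_X (swap i i') j
    rw [swap_apply_of_ne_of_ne hj hj', D.dev_of_ne h hj hj', map_zero, add_zero] at this
    exact this.symm
  simple_x i i' h := by
    have := D.L_perm_X (swap i i') i
    rw [swap_apply_left, D.dev_succ h] at this
    exact eq_sub_of_add_eq this.symm
  perm_tens π f := by
    simp [C_apply, ← map_mul, single_mul_single]

theorem pbwRep_hat (h : SkewMonoidAlgebra R (Perm (Fin n))) : D.pbwRep.hat h = L k R n h := by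
  induction h using SkewMonoidAlgebra.induction_on with
  | zero => simp
  | single π f =>
    rw [AffineRep.hat_single]
    simp [pbwRep, C_apply, ← map_mul, single_mul_single]
  | add a b ha hb => simp only [map_add, ha, hb]

theorem pbwRep_xPow (α : Fin n → ℕ) : D.pbwRep.xPow α (PBW.mon k 0 1) = PBW.mon k α 1 := by
  suffices ∀ β, D.pbwRep.xPow α (PBW.mon k β 1) = PBW.mon k (β + α) 1 by simpa using this 0
  induction α using exponent_induction with
  | zero => simp [AffineRep.xPow_zero]
  | add_single α i ih =>
    intro β
    have : D.pbwRep.x i = D.X i := rfl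
    rw [AffineRep.xPow_add, AffineRep.xPow_single_one, Module.End.mul_apply, this, X_one, ih,
      add_assoc, add_comm (Pi.single i 1)]

end WreathData

/-- If the action on `(R ⋊ S_n) ⊗ k[x_1, …, x_n]` factors through `A`, then there are linear maps on
`A` with prescribed values on monomials. -/
theorem AffineRep.exists_functional {D : WreathData k R n} {A : Type w} [Ring A] [Algebra k A]
    (ρ : AffineRep D A) (Φ : A →ₐ[k] Module.End k (WreathData.PBW R n)) (hΦ : ρ.comp Φ = D.pbwRep)
    {M : Type*} [AddCommGroup M] [Module k M]
    (w : (Fin n → ℕ) → SkewMonoidAlgebra R (Perm (Fin n)) →ₗ[k] M) :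
    ∃ E : A →ₗ[k] M, ∀ h α, E (ρ.hat h * ρ.xPow α) = w α h := by
  refine ⟨WreathData.PBW.lift w ∘ₗ (LinearMap.applyₗ (WreathData.PBW.mon k 0 1)) ∘ₗ Φ.toLinearMap,
    fun h α => ?_⟩
  have h1 : Φ (ρ.hat h) = WreathData.L k R n h := by
    rw [← D.pbwRep_hat, ← hΦ, comp_hat]
  have h2 : Φ (ρ.xPow α) = D.pbwRep.xPow α := by
    rw [← hΦ, comp_xPow]
  simp [h1, h2, D.pbwRep_xPow, WreathData.L_single]

end

/-! ### The filtration by degree in the variables -/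

section

open SkewMonoidAlgebra Equiv

variable {k : Type u} {R : Type v} {n : ℕ} [CommRing k] [Ring R] [Algebra k R]
  [MulSemiringAction (Perm (Fin n)) R] [SMulCommClass (Perm (Fin n)) k R]

namespace AffineRep

variable {D : WreathData k R n} {A : Type w} [Ring A] [Algebra k A] (ρ : AffineRep D A)

/-- The image of `R ⋊ S_n`. -/
def H : Submodule k A := Subalgebra.toSubmodule ρ.hat.range

/-- The span of the monomials in the variables of degree less than `m`. -/
def P (m : ℕ) : Submodule k A := Submodule.span k {a | ∃ α : Fin n → ℕ, ∑ i, α i < m ∧ a = ρ.xPow α}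

/-- The filtration by degree in the variables. -/
def filt (m : ℕ) : Submodule k A := ρ.H * ρ.P m

theorem hat_mem_H (h) : ρ.hat h ∈ ρ.H := ⟨h, rfl⟩

theorem tens_mem_H (f) : ρ.tens f ∈ ρ.H := ⟨_, ρ.hat_C f⟩

theorem perm_mem_H (π) : ρ.perm π ∈ ρ.H := ⟨_, ρ.hat_perm π⟩

theorem one_mem_H : (1 : A) ∈ ρ.H := ⟨1, map_one _⟩

theorem xPow_mem_P {α : Fin n → ℕ} {m : ℕ} (h : ∑ i, α i < m) : ρ.xPow α ∈ ρ.P m :=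
  Submodule.subset_span ⟨α, h, rfl⟩

theorem one_mem_P (m : ℕ) : (1 : A) ∈ ρ.P (m + 1) := by
  rw [← ρ.xPow_zero]; exact ρ.xPow_mem_P (by simp)

theorem H_mul_H : ρ.H * ρ.H = ρ.H := by
  rw [H, Subalgebra.isIdempotentElem_toSubmodule]

theorem H_eq_span : ρ.H = Submodule.span k {a | ∃ f π, a = ρ.tens f * ρ.perm π} := by
  apply le_antisymm
  · rintro _ ⟨h, rfl⟩
    change ρ.hat h ∈ _
    induction h using SkewMonoidAlgebra.induction_on with
    | zero => rw [map_zero]; exact zero_mem _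
    | single π f => exact Submodule.subset_span ⟨f, π, ρ.hat_single _ _⟩
    | add a b ha hb => rw [map_add]; exact add_mem ha hb
  · rw [Submodule.span_le]
    rintro _ ⟨f, π, rfl⟩
    exact ⟨_, ρ.hat_single _ _⟩

theorem P_mono {m m' : ℕ} (h : m ≤ m') : ρ.P m ≤ ρ.P m' :=
  Submodule.span_mono fun _ ⟨α, hα, e⟩ => ⟨α, hα.trans_le h, e⟩

theorem P_zero : ρ.P 0 = ⊥ := by
  simp [P]

theorem filt_zero : ρ.filt 0 = ⊥ := by
  rw [filt, P_zero, Submodule.mul_bot]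

theorem filt_mono {m m' : ℕ} (h : m ≤ m') : ρ.filt m ≤ ρ.filt m' :=
  mul_le_mul' le_rfl (ρ.P_mono h)

theorem P_mul_P (a b : ℕ) : ρ.P a * ρ.P (b + 1) ≤ ρ.P (a + b) := by
  rw [P, P, Submodule.span_mul_span, Submodule.span_le]
  rintro _ ⟨_, ⟨α, hα, rfl⟩, _, ⟨β, hβ, rfl⟩, rfl⟩
  change ρ.xPow α * ρ.xPow β ∈ _
  rw [← xPow_add]
  refine ρ.xPow_mem_P ?_
  simp only [Pi.add_apply, Finset.sum_add_distrib]
  omega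

theorem hat_mul_xPow_mem (h) {α : Fin n → ℕ} {m : ℕ} (hα : ∑ i, α i < m) :
    ρ.hat h * ρ.xPow α ∈ ρ.filt m :=
  Submodule.mul_mem_mul (ρ.hat_mem_H h) (ρ.xPow_mem_P hα)

theorem xPow_mem_filt {α : Fin n → ℕ} {m : ℕ} (hα : ∑ i, α i < m) : ρ.xPow α ∈ ρ.filt m := by
  simpa using ρ.hat_mul_xPow_mem 1 hα

theorem H_le_filt (m : ℕ) : ρ.H ≤ ρ.filt (m + 1) := fun a ha => by
  rw [← mul_one a]; exact Submodule.mul_mem_mul ha (ρ.one_mem_P m)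

theorem P_le_filt (m : ℕ) : ρ.P m ≤ ρ.filt m := fun a ha => by
  rw [← one_mul a]; exact Submodule.mul_mem_mul ρ.one_mem_H ha

theorem H_mul_filt (m : ℕ) : ρ.H * ρ.filt m = ρ.filt m := by
  rw [filt, ← mul_assoc, H_mul_H]

theorem filt_mul_P (a b : ℕ) : ρ.filt a * ρ.P (b + 1) ≤ ρ.filt (a + b) := by
  rw [filt, mul_assoc]; exact mul_le_mul' le_rfl (ρ.P_mul_P a b)

theorem filt_induction {m : ℕ} {p : A → Prop} (zero : p 0) (add : ∀ a b, p a → p b → p (a + b))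
    (mon : ∀ h (α : Fin n → ℕ), ∑ i, α i < m → p (ρ.hat h * ρ.xPow α)) {a : A}
    (ha : a ∈ ρ.filt m) : p a := by
  refine Submodule.mul_induction_on ha (fun a ha b hb => ?_) add
  obtain ⟨h, rfl⟩ := ha
  change p (ρ.hat h * b)
  revert h
  refine Submodule.span_induction ?_ ?_ ?_ ?_ hb
  · rintro _ ⟨α, hα, rfl⟩ h; exact mon h α hα
  · intro h; rwa [mul_zero]
  · intro x y _ _ hx hy h; rw [mul_add]; exact add _ _ (hx h) (hy h)
  · intro r x _ hx h
    have := hx (r • h)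
    rwa [map_smul, smul_mul_assoc, ← mul_smul_comm] at this

/-- Only membership of the twist in the group generated by the `Ψ_i` is recorded: that suffices for
a trace invariant under the `Ψ_i`. -/
theorem tens_mul_xPow (α : Fin n → ℕ) : ∃ e ∈ Subgroup.closure (Set.range D.Ψ),
    ∀ f, ρ.xPow α * ρ.tens (e f) = ρ.tens f * ρ.xPow α := by
  induction α using exponent_induction with
  | zero => exact ⟨1, one_mem _, fun f => by simp [xPow_zero]⟩
  | add_single α i ih =>
    obtain ⟨e, he', he⟩ := ih
    refine ⟨D.Ψ i * e, mul_mem (Subgroup.subset_closure ⟨i, rfl⟩) he', fun f => ?_⟩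
    rw [xPow_add, xPow_single_one, AlgEquiv.mul_apply, mul_assoc, ← ρ.tens_x, ← mul_assoc, he,
      mul_assoc]

theorem x_mul_H (i : Fin n) {a : A} (ha : a ∈ ρ.H) : ρ.x i * a ∈ ρ.filt 2 := by
  rw [H_eq_span] at ha
  refine Submodule.span_induction ?_ ?_ ?_ ?_ ha
  · rintro _ ⟨f, π, rfl⟩
    have h1 : ρ.x i * ρ.tens f = ρ.tens ((D.Ψ i).symm f) * ρ.x i := by
      rw [ρ.tens_x, AlgEquiv.apply_symm_apply]
    have h2 := ρ.perm_x π (π⁻¹ i)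
    rw [← Perm.mul_apply, mul_inv_cancel, Perm.one_apply] at h2
    rw [← mul_assoc, h1, mul_assoc, ← sub_add_cancel (ρ.x i * ρ.perm π) (ρ.hat (D.dev i π)), ← h2,
      mul_add, ← mul_assoc]
    refine add_mem (Submodule.mul_mem_mul ?_ ?_) (ρ.H_le_filt 1 ?_)
    · rw [← ρ.hat_single]; exact ρ.hat_mem_H _
    · rw [← ρ.xPow_single_one]; exact ρ.xPow_mem_P (by simp)
    · rw [← ρ.H_mul_H]
      exact Submodule.mul_mem_mul (ρ.tens_mem_H _) (ρ.hat_mem_H _)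
  · rw [mul_zero]; exact zero_mem _
  · intro a b _ _ ha hb; rw [mul_add]; exact add_mem ha hb
  · intro r a _ ha; rw [mul_smul_comm]; exact Submodule.smul_mem _ _ ha

theorem xPow_mul_H (α : Fin n → ℕ) :
    ∀ a ∈ ρ.H, ρ.xPow α * a ∈ ρ.filt (∑ i, α i + 1) := by
  induction α using exponent_induction with
  | zero => intro a ha; rw [xPow_zero, one_mul]; exact ρ.H_le_filt _ ha
  | add_single α i ih =>
    intro a ha
    have h1 : ∑ j, (α + Pi.single i 1 : Fin n → ℕ) j + 1 = (∑ j, α j + 1) + 1 := by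
      simp [Finset.sum_add_distrib]
    rw [xPow_add, xPow_single_one, mul_assoc, h1]
    refine ρ.filt_induction (p := fun b => ρ.xPow α * b ∈ ρ.filt _) ?_ ?_ ?_ (ρ.x_mul_H i ha)
    · rw [mul_zero]; exact zero_mem _
    · intro a b ha hb; rw [mul_add]; exact add_mem ha hb
    · intro h β hβ
      rw [← mul_assoc]
      exact ρ.filt_mul_P _ 1 (Submodule.mul_mem_mul (ih _ (ρ.hat_mem_H h)) (ρ.xPow_mem_P hβ))

theorem P_mul_H (m : ℕ) : ρ.P m * ρ.H ≤ ρ.filt m := by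
  rw [Submodule.mul_le]
  intro a ha b hb
  refine Submodule.span_induction ?_ ?_ ?_ ?_ ha
  · rintro _ ⟨α, hα, rfl⟩; exact ρ.filt_mono hα (ρ.xPow_mul_H α b hb)
  · rw [zero_mul]; exact zero_mem _
  · intro a c _ _ ha hc; rw [add_mul]; exact add_mem ha hc
  · intro r a _ ha; rw [smul_mul_assoc]; exact Submodule.smul_mem _ _ ha

theorem filt_mul_H (m : ℕ) : ρ.filt m * ρ.H ≤ ρ.filt m :=
  calc ρ.filt m * ρ.H = ρ.H * (ρ.P m * ρ.H) := by rw [filt, mul_assoc]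
    _ ≤ ρ.H * ρ.filt m := mul_le_mul' le_rfl (ρ.P_mul_H m)
    _ = _ := ρ.H_mul_filt m

theorem filt_mul_filt (a b : ℕ) : ρ.filt a * ρ.filt (b + 1) ≤ ρ.filt (a + b) :=
  calc ρ.filt a * ρ.filt (b + 1) = ρ.filt a * ρ.H * ρ.P (b + 1) := by
        rw [filt, filt, mul_assoc, mul_assoc, mul_assoc]
    _ ≤ ρ.filt a * ρ.P (b + 1) := mul_le_mul' (ρ.filt_mul_H a) le_rfl
    _ ≤ _ := ρ.filt_mul_P a b

/-- Each exchange of `π` with one variable costs an element of `R ⋊ S_n` in place of that variable,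
hence a drop in degree. -/
theorem perm_mul_xPow (π : Perm (Fin n)) (α : Fin n → ℕ) :
    ρ.perm π * ρ.xPow (α ∘ π) - ρ.xPow α * ρ.perm π ∈ ρ.filt (∑ i, α i) := by
  induction α using exponent_induction with
  | zero => simp [xPow_zero, Pi.zero_comp]
  | add_single α i ih =>
    have e : (α + Pi.single i 1 : Fin n → ℕ) ∘ π = α ∘ π + Pi.single (π⁻¹ i) 1 := by
      funext j
      simp only [Function.comp_apply, Pi.add_apply, Pi.single_apply, Perm.eq_inv_iff_eq]
    have h1 : ∑ j, (α + Pi.single i 1 : Fin n → ℕ) j = ∑ j, α j + 1 := by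
      simp [Finset.sum_add_distrib]
    have h2 := ρ.perm_x π (π⁻¹ i)
    rw [← Perm.mul_apply, mul_inv_cancel, Perm.one_apply] at h2
    rw [e, h1, xPow_add, xPow_add, xPow_single_one, xPow_single_one]
    have h3 : ρ.perm π * (ρ.xPow (α ∘ π) * ρ.x (π⁻¹ i)) - ρ.xPow α * ρ.x i * ρ.perm π =
        (ρ.perm π * ρ.xPow (α ∘ π) - ρ.xPow α * ρ.perm π) * ρ.x (π⁻¹ i) -
          ρ.xPow α * ρ.hat (D.dev i π) := by
      rw [sub_mul, mul_assoc (ρ.perm π) (ρ.xPow _), ← mul_assoc (ρ.perm π),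
        mul_assoc (ρ.xPow α) (ρ.perm π), h2]
      noncomm_ring
    rw [h3]
    refine sub_mem (ρ.filt_mul_P _ 1 (Submodule.mul_mem_mul ih ?_))
      (ρ.xPow_mul_H _ _ (ρ.hat_mem_H _))
    rw [← xPow_single_one]
    exact ρ.xPow_mem_P (by simp)

/-- The filtration is also spanned with variables on the left: reordering changes a monomial only by
terms of lower degree, which are covered by induction. This is needed because the trace is specified
on monomials `x^α f π`. -/
theorem filt_le_P_mul_H (m : ℕ) : ρ.filt m ≤ ρ.P m * ρ.H := by
  induction m with
  | zero => rw [filt_zero]; exact bot_le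
  | succ m ih =>
    have hs : ρ.filt (m + 1) = Submodule.span k
        {a | ∃ f π, a = ρ.tens f * ρ.perm π} * ρ.P (m + 1) := by rw [← H_eq_span, filt]
    rw [hs, P, Submodule.span_mul_span, Submodule.span_le, ← P]
    rintro _ ⟨_, ⟨f, π, rfl⟩, _, ⟨α, hα, rfl⟩, rfl⟩
    change ρ.tens f * ρ.perm π * ρ.xPow α ∈ _
    -- The exponent is precomposed with `π⁻¹` so that the monomial to the right of `π` is `x^α`.
    have h1 := ρ.perm_mul_xPow π (α ∘ ⇑π⁻¹)
    have hs : ∑ i, (α ∘ ⇑π⁻¹) i = ∑ i, α i := Equiv.sum_comp π⁻¹ α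
    have e : (α ∘ ⇑π⁻¹) ∘ π = α := by funext i; simp
    rw [e, hs] at h1
    obtain ⟨e, -, he⟩ := ρ.tens_mul_xPow (α ∘ ⇑π⁻¹)
    rw [mul_assoc, ← sub_add_cancel (ρ.perm π * ρ.xPow α) (ρ.xPow (α ∘ ⇑π⁻¹) * ρ.perm π), mul_add,
      ← mul_assoc (ρ.tens f) (ρ.xPow _), ← he, mul_assoc (ρ.xPow _)]
    refine add_mem ?_ (Submodule.mul_mem_mul (ρ.xPow_mem_P (by rw [hs]; exact hα)) ?_)
    · refine mul_le_mul' (ρ.P_mono (Nat.le_succ m)) le_rfl (ih (ρ.filt_mono (Nat.lt_succ_iff.1 hα) ?_))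
      rw [← H_mul_filt]
      exact Submodule.mul_mem_mul (ρ.tens_mem_H f) h1
    · rw [← ρ.hat_single]; exact ρ.hat_mem_H _

theorem exists_coeff {m : ℕ} {a : A} (ha : a ∈ ρ.filt m) :
    ∃ r : (Fin n → ℕ) →₀ SkewMonoidAlgebra R (Perm (Fin n)),
      (∀ β ∈ r.support, ∑ i, β i < m) ∧ r.sum (fun β h => ρ.hat h * ρ.xPow β) = a := by
  refine ρ.filt_induction (p := fun a => ∃ r : (Fin n → ℕ) →₀ SkewMonoidAlgebra R (Perm (Fin n)),
      (∀ β ∈ r.support, ∑ i, β i < m) ∧ r.sum (fun β h => ρ.hat h * ρ.xPow β) = a) ?_ ?_ ?_ ha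
  · exact ⟨0, by simp⟩
  · rintro _ _ ⟨r, hr, rfl⟩ ⟨s, hs, rfl⟩
    classical
    refine ⟨r + s, fun β hβ => ?_, Finsupp.sum_add_index' (by simp) (by simp [add_mul])⟩
    rcases Finset.mem_union.1 (Finsupp.support_add hβ) with h | h
    exacts [hr _ h, hs _ h]
  · intro h α hα
    refine ⟨Finsupp.single α h, fun β hβ => ?_, by simp⟩
    have := Finsupp.support_single_subset hβ
    rw [Finset.mem_singleton] at this
    rwa [this]

theorem mem_filt_of_span (hgen : Algebra.adjoin k
    (Set.range ρ.tens ∪ Set.range ρ.perm ∪ Set.range ρ.x) = ⊤) (a : A) : ∃ m, a ∈ ρ.filt m := by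
  have : a ∈ Algebra.adjoin k (Set.range ρ.tens ∪ Set.range ρ.perm ∪ Set.range ρ.x) := by
    rw [hgen]; trivial
  induction this using Algebra.adjoin_induction with
  | mem x hx =>
    rcases hx with (⟨f, rfl⟩ | ⟨π, rfl⟩) | ⟨i, rfl⟩
    · exact ⟨1, ρ.H_le_filt 0 (ρ.tens_mem_H f)⟩
    · exact ⟨1, ρ.H_le_filt 0 (ρ.perm_mem_H π)⟩
    · refine ⟨2, ?_⟩
      rw [← xPow_single_one]
      exact ρ.xPow_mem_filt (by simp)
  | algebraMap r =>
    refine ⟨1, ρ.H_le_filt 0 ?_⟩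
    rw [← ρ.hat.commutes r]
    exact ρ.hat_mem_H _
  | add x y _ _ hx hy =>
    obtain ⟨a, ha⟩ := hx
    obtain ⟨b, hb⟩ := hy
    exact ⟨a + b, add_mem (ρ.filt_mono (by omega) ha) (ρ.filt_mono (by omega) hb)⟩
  | mul x y _ _ hx hy =>
    obtain ⟨a, ha⟩ := hx
    obtain ⟨b, hb⟩ := hy
    exact ⟨a + b, ρ.filt_mul_filt a b
      (Submodule.mul_mem_mul ha (ρ.filt_mono (Nat.le_succ b) hb))⟩

end AffineRep

end

/-! ### The ideal generated by a cyclotomic family, and reduction modulo it -/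

section

open SkewMonoidAlgebra Equiv

variable {k : Type u} {R : Type v} {n : ℕ} [CommRing k] [Ring R] [Algebra k R]
  [MulSemiringAction (Perm (Fin n)) R] [SMulCommClass (Perm (Fin n)) k R]

variable {D : WreathData k R n} {A : Type w} [Ring A] [Algebra k A]

/-- A family of elements `χ_i` that are monic of degree `d` in `x_i`, permuted by `S_n` and
commuting with `R` up to automorphisms, the first of which commutes with the variables. -/
structure CyclotomicFamily (ρ : AffineRep D A) (d : ℕ) where
  /-- The elements. -/
  χ : Fin n → A
  /-- The twists. -/
  φ : Fin n → R ≃ₐ[k] R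
  perm_χ : ∀ π i, ρ.perm π * χ i = χ (π i) * ρ.perm π
  tens_χ : ∀ f i, ρ.tens f * χ i = χ i * ρ.tens (φ i f)
  χ_x : ∀ i j : Fin n, (i : ℕ) = 0 → χ i * ρ.x j = ρ.x j * χ i
  χ_first_mem : ∀ i : Fin n, (i : ℕ) = 0 → χ i - ρ.x i ^ d ∈ ρ.filt d

namespace CyclotomicFamily

variable {ρ : AffineRep D A} {d : ℕ} (c : CyclotomicFamily ρ d)

/-- The span of the `χ_i`. -/
def S : Submodule k A := Submodule.span k (Set.range c.χ)

/-- The filtration of the ideal generated by the `χ_i`. -/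
def I (m : ℕ) : Submodule k A := ρ.H * c.S * ρ.P m

theorem χ_mem_S (i : Fin n) : c.χ i ∈ c.S := Submodule.subset_span ⟨i, rfl⟩

theorem exists_first (i : Fin n) : ∃ (j : Fin n) (π : Perm (Fin n)), (j : ℕ) = 0 ∧ π j = i :=
  ⟨⟨0, i.pos⟩, swap ⟨0, i.pos⟩ i, rfl, swap_apply_left _ _⟩

theorem perm_conj (π : Perm (Fin n)) : ρ.perm π * ρ.perm π⁻¹ = 1 := by
  rw [← map_mul, mul_inv_cancel, map_one]

theorem χ_eq (π : Perm (Fin n)) (i : Fin n) :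
    c.χ (π i) = ρ.perm π * c.χ i * ρ.perm π⁻¹ := by
  rw [c.perm_χ, mul_assoc, perm_conj, mul_one]

/-- Monicity is assumed only for the first index. Conjugation transports it, since `π x_j^d` equals
`x_{π j}^d π` up to lower degree. -/
theorem χ_mem (i : Fin n) : c.χ i - ρ.x i ^ d ∈ ρ.filt d := by
  obtain ⟨j, π, hj, rfl⟩ := exists_first i
  have h1 := ρ.perm_mul_xPow π (Pi.single (π j) d)
  have e : (Pi.single (π j) d : Fin n → ℕ) ∘ π = Pi.single j d := by
    funext l; simp [Pi.single_apply]
  rw [e, AffineRep.xPow_single, AffineRep.xPow_single] at h1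
  have h2 : c.χ (π j) - ρ.x (π j) ^ d =
      (ρ.perm π * (c.χ j - ρ.x j ^ d) + (ρ.perm π * ρ.x j ^ d - ρ.x (π j) ^ d * ρ.perm π)) *
        ρ.perm π⁻¹ := by
    rw [mul_sub, sub_add_sub_cancel, sub_mul, ← c.χ_eq, mul_assoc, perm_conj, mul_one]
  rw [h2]
  refine ρ.filt_mul_H d (Submodule.mul_mem_mul (add_mem ?_ (by simpa using h1)) (ρ.perm_mem_H _))
  rw [← ρ.H_mul_filt]
  exact Submodule.mul_mem_mul (ρ.perm_mem_H π) (c.χ_first_mem j hj)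

theorem S_mul_H : c.S * ρ.H ≤ ρ.H * c.S := by
  rw [ρ.H_eq_span, S, Submodule.span_mul_span, Submodule.span_le, ← ρ.H_eq_span]
  rintro _ ⟨_, ⟨i, rfl⟩, _, ⟨f, π, rfl⟩, rfl⟩
  change c.χ i * (ρ.tens f * ρ.perm π) ∈ _
  have h := c.perm_χ π (π⁻¹ i)
  rw [← Perm.mul_apply, mul_inv_cancel, Perm.one_apply] at h
  rw [← (c.φ i).apply_symm_apply f, ← mul_assoc, ← c.tens_χ, mul_assoc, ← h, ← mul_assoc,
    ← ρ.hat_single]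
  exact Submodule.mul_mem_mul (ρ.hat_mem_H _) (c.χ_mem_S _)

theorem P_mul_first (m : ℕ) (i : Fin n) (hi : (i : ℕ) = 0) {a : A} (ha : a ∈ ρ.P m) :
    a * c.χ i = c.χ i * a := by
  refine Submodule.span_induction ?_ ?_ ?_ ?_ ha
  · rintro _ ⟨α, -, rfl⟩
    induction α using exponent_induction with
    | zero => simp [ρ.xPow_zero]
    | add_single α j ih =>
      rw [ρ.xPow_add, ρ.xPow_single_one, mul_assoc, ← c.χ_x i j hi, ← mul_assoc, ih, mul_assoc]
  · simp
  · intro a b _ _ ha hb; rw [add_mul, ha, hb, mul_add]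
  · intro r a _ ha; rw [smul_mul_assoc, ha, mul_smul_comm]

theorem S_mul_filt (m : ℕ) : c.S * ρ.filt m ≤ c.I m := by
  rw [AffineRep.filt, ← mul_assoc]
  exact mul_le_mul' c.S_mul_H le_rfl

theorem H_mul_I (m : ℕ) : ρ.H * c.I m = c.I m := by
  rw [I, ← mul_assoc, ← mul_assoc, ρ.H_mul_H]

theorem filt_mul_first (m : ℕ) (i : Fin n) (hi : (i : ℕ) = 0) {a : A} (ha : a ∈ ρ.filt m) :
    a * c.χ i ∈ c.I m := by
  refine Submodule.mul_induction_on ha (fun a ha b hb => ?_) (fun a b ha hb => ?_)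
  · rw [mul_assoc, c.P_mul_first m i hi hb, ← mul_assoc]
    exact Submodule.mul_mem_mul (Submodule.mul_mem_mul ha (c.χ_mem_S i)) hb
  · rw [add_mul]; exact add_mem ha hb

theorem I_mul_filt (a b : ℕ) : c.I a * ρ.filt (b + 1) ≤ c.I (a + b) :=
  calc c.I a * ρ.filt (b + 1) = ρ.H * c.S * (ρ.P a * ρ.filt (b + 1)) := by rw [I, mul_assoc]
    _ ≤ ρ.H * c.S * ρ.filt (a + b) := mul_le_mul' le_rfl
        ((mul_le_mul' (ρ.P_le_filt a) le_rfl).trans (ρ.filt_mul_filt a b))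
    _ = ρ.H * (c.S * ρ.filt (a + b)) := mul_assoc _ _ _
    _ ≤ ρ.H * c.I (a + b) := mul_le_mul' le_rfl (c.S_mul_filt _)
    _ = _ := c.H_mul_I _

theorem I_mul_H (m : ℕ) : c.I m * ρ.H ≤ c.I m :=
  (mul_le_mul' le_rfl (ρ.H_le_filt 0)).trans (c.I_mul_filt m 0)

/-- Only the first `χ` is known to commute with the variables. Any other is conjugated to it, the
permutations being absorbed on both sides without raising the cofactor degree. -/
theorem filt_mul_S (m : ℕ) : ρ.filt m * c.S ≤ c.I m := by
  rw [Submodule.mul_le]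
  intro a ha b hb
  refine Submodule.span_induction ?_ ?_ ?_ ?_ hb
  · rintro _ ⟨i, rfl⟩
    obtain ⟨j, π, hj, rfl⟩ := exists_first i
    rw [c.χ_eq, ← mul_assoc, ← mul_assoc]
    refine c.I_mul_H m (Submodule.mul_mem_mul (c.filt_mul_first m j hj ?_) (ρ.perm_mem_H _))
    exact ρ.filt_mul_H m (Submodule.mul_mem_mul ha (ρ.perm_mem_H _))
  · rw [mul_zero]; exact zero_mem _
  · intro a b _ _ ha hb; rw [mul_add]; exact add_mem ha hb
  · intro r a _ ha; rw [mul_smul_comm]; exact Submodule.smul_mem _ _ ha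

theorem filt_mul_I (a b : ℕ) : ρ.filt a * c.I (b + 1) ≤ c.I (a + b) :=
  calc ρ.filt a * c.I (b + 1) = ρ.filt a * ρ.H * c.S * ρ.P (b + 1) := by
        rw [I, mul_assoc, mul_assoc, mul_assoc]
    _ ≤ ρ.filt a * c.S * ρ.P (b + 1) := mul_le_mul' (mul_le_mul' (ρ.filt_mul_H a) le_rfl) le_rfl
    _ ≤ c.I a * ρ.filt (b + 1) := mul_le_mul' (c.filt_mul_S a) (ρ.P_le_filt _)
    _ ≤ _ := c.I_mul_filt a b

/-- For the first index, `χ_i` commutes with the leading term `x_j^d` of `χ_j`, so only cofactors of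
degree less than `d` remain; conjugation gives the general case. -/
theorem commutator_mem (i j : Fin n) : c.χ i * c.χ j - c.χ j * c.χ i ∈ c.I d := by
  have key : ∀ i j : Fin n, (i : ℕ) = 0 → c.χ i * c.χ j - c.χ j * c.χ i ∈ c.I d := by
    intro i j hi
    have h1 : c.χ i * ρ.x j ^ d = ρ.x j ^ d * c.χ i :=
      (show Commute (c.χ i) (ρ.x j) from c.χ_x i j hi).pow_right d
    have h2 : c.χ i * c.χ j - c.χ j * c.χ i =
        c.χ i * (c.χ j - ρ.x j ^ d) - (c.χ j - ρ.x j ^ d) * c.χ i := by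
      rw [mul_sub, sub_mul, h1]; abel
    rw [h2]
    exact sub_mem (c.S_mul_filt d (Submodule.mul_mem_mul (c.χ_mem_S i) (c.χ_mem j)))
      (c.filt_mul_first d i hi (c.χ_mem j))
  obtain ⟨l, π, hl, rfl⟩ := exists_first i
  have h := key l (π⁻¹ j) hl
  have e : j = π (π⁻¹ j) := by simp
  have h3 : ρ.perm π⁻¹ * ρ.perm π = 1 := by rw [← map_mul, inv_mul_cancel, map_one]
  have h4 : ∀ a b : A, ρ.perm π * a * ρ.perm π⁻¹ * (ρ.perm π * b * ρ.perm π⁻¹) =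
      ρ.perm π * (a * b) * ρ.perm π⁻¹ := by
    intro a b
    calc _ = ρ.perm π * a * (ρ.perm π⁻¹ * ρ.perm π) * b * ρ.perm π⁻¹ := by noncomm_ring
      _ = _ := by rw [h3, mul_one, mul_assoc (ρ.perm π)]
  rw [e, c.χ_eq π, c.χ_eq π, h4, h4, ← sub_mul, ← mul_sub]
  refine c.I_mul_H d (Submodule.mul_mem_mul ?_ (ρ.perm_mem_H _))
  rw [← c.H_mul_I]
  exact Submodule.mul_mem_mul (ρ.perm_mem_H _) h

/-- The two ways of rewriting `x_i^d x_j^d` agree up to multiples of the `χ` with cofactors of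
degree less than `d`, one less than the visible degree: replace each leading power by its `χ` and
use the commutator bound. -/
theorem syzygy_mem (i j : Fin n) : c.χ i * ρ.x j ^ d - c.χ j * ρ.x i ^ d ∈ c.I d := by
  have h : c.χ i * ρ.x j ^ d - c.χ j * ρ.x i ^ d = (c.χ i * c.χ j - c.χ j * c.χ i) -
      c.χ i * (c.χ j - ρ.x j ^ d) + c.χ j * (c.χ i - ρ.x i ^ d) := by noncomm_ring
  rw [h]
  exact add_mem (sub_mem (c.commutator_mem i j)
    (c.S_mul_filt d (Submodule.mul_mem_mul (c.χ_mem_S i) (c.χ_mem j))))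
    (c.S_mul_filt d (Submodule.mul_mem_mul (c.χ_mem_S j) (c.χ_mem i)))

/-- The coefficients of `χ_i - x_i^d`. -/
def coeff (i : Fin n) : (Fin n → ℕ) →₀ SkewMonoidAlgebra R (Perm (Fin n)) :=
  (ρ.exists_coeff (c.χ_mem i)).choose

theorem sum_lt_of_mem_coeff (i : Fin n) {β : Fin n → ℕ} (hβ : β ∈ (c.coeff i).support) :
    ∑ i, β i < d :=
  (ρ.exists_coeff (c.χ_mem i)).choose_spec.1 β hβ

theorem sum_coeff (i : Fin n) :
    (c.coeff i).sum (fun β h => ρ.hat h * ρ.xPow β) = c.χ i - ρ.x i ^ d :=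
  (ρ.exists_coeff (c.χ_mem i)).choose_spec.2

theorem sub_single_add {α : Fin n → ℕ} {i : Fin n} {d : ℕ} (h : d ≤ α i) :
    α - Pi.single i d + Pi.single i d = α := by
  funext j
  rcases eq_or_ne j i with rfl | hj
  · simp; omega
  · simp [hj]

theorem sum_sub_single {α : Fin n → ℕ} {i : Fin n} {d : ℕ} (h : d ≤ α i) :
    ∑ j, (α - Pi.single i d : Fin n → ℕ) j + d = ∑ j, α j := by
  conv_rhs => rw [← sub_single_add h]
  simp only [Pi.add_apply, Finset.sum_add_distrib, Finset.sum_pi_single', Finset.mem_univ, if_true]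

variable {M : Type*} [AddCommGroup M] [Module k M]

open Classical in
/-- The values on monomials of the functional that vanishes on the ideal generated by the `χ_i`
and has the given values on monomials whose exponents are less than `d`. -/
def value (w : (Fin n → ℕ) → SkewMonoidAlgebra R (Perm (Fin n)) →ₗ[k] M) (α : Fin n → ℕ) :
    SkewMonoidAlgebra R (Perm (Fin n)) →ₗ[k] M :=
  -- The variable to reduce is chosen arbitrarily; that the choice is immaterial is the content of
  -- the syzygy argument in `exists_reduced_functional`.
  if h : ∃ i, d ≤ α i then
    - ∑ β ∈ (c.coeff h.choose).support.attach,
      value w (α - Pi.single h.choose d + β.1) ∘ₗ LinearMap.mulRight k (c.coeff h.choose β.1)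
  else w α
termination_by ∑ i, α i
decreasing_by
  have h1 := c.sum_lt_of_mem_coeff _ β.2
  have h2 := sum_sub_single h.choose_spec
  simp only [Pi.add_apply, Finset.sum_add_distrib]
  omega

theorem value_of_lt (w : (Fin n → ℕ) → SkewMonoidAlgebra R (Perm (Fin n)) →ₗ[k] M)
    {α : Fin n → ℕ} (h : ∀ i, α i < d) : c.value w α = w α := by
  rw [value, dif_neg]
  rintro ⟨i, hi⟩
  exact absurd (h i) (not_lt.2 hi)

/-- The functional with prescribed values on monomials with exponents less than `d` that vanishes
on the ideal generated by the `χ_i`. -/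
theorem exists_reduced_functional (Φ : A →ₐ[k] Module.End k (WreathData.PBW R n))
    (hΦ : ρ.comp Φ = D.pbwRep)
    (w : (Fin n → ℕ) → SkewMonoidAlgebra R (Perm (Fin n)) →ₗ[k] M) :
    ∃ E : A →ₗ[k] M, (∀ h α, (∀ i, α i < d) → E (ρ.hat h * ρ.xPow α) = w α h) ∧
      ∀ m, ∀ a ∈ c.I m, E a = 0 := by
  obtain ⟨E, hE⟩ := ρ.exists_functional Φ hΦ (c.value w)
  refine ⟨E, fun h α hα => by rw [hE, c.value_of_lt w hα], ?_⟩
  -- The recursion defining `value` yields the vanishing for the one chosen index only.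
  have hstep : ∀ α : Fin n → ℕ, (∃ i, d ≤ α i) → ∃ i, d ≤ α i ∧
      ∀ h, E (ρ.hat h * c.χ i * ρ.xPow (α - Pi.single i d)) = 0 := by
    intro α hα
    refine ⟨hα.choose, hα.choose_spec, fun h => ?_⟩
    have h1 : ρ.hat h * c.χ hα.choose * ρ.xPow (α - Pi.single hα.choose d) =
        ρ.hat h * ρ.xPow α + (c.coeff hα.choose).sum (fun β g =>
          ρ.hat (h * g) * ρ.xPow (α - Pi.single hα.choose d + β)) := by
      have e : c.χ hα.choose = ρ.x hα.choose ^ d +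
        (c.coeff hα.choose).sum (fun β h => ρ.hat h * ρ.xPow β) := by rw [sum_coeff]; abel
      rw [e, mul_add, add_mul]
      congr 1
      · rw [mul_assoc, ← ρ.xPow_single, ← ρ.xPow_add, add_comm, sub_single_add hα.choose_spec]
      · rw [Finsupp.mul_sum, Finsupp.sum_mul]
        refine Finset.sum_congr rfl fun β _ => ?_
        dsimp only
        rw [map_mul, ← mul_assoc, mul_assoc, ← ρ.xPow_add, add_comm]
    rw [h1, map_add, hE, value, dif_pos hα, LinearMap.neg_apply, LinearMap.sum_apply, map_finsuppSum,
      Finsupp.sum, ← Finset.sum_attach (c.coeff hα.choose).support]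
    simp only [hE]
    exact neg_add_cancel _
  have key : ∀ m, ∀ a ∈ c.I m, E a = 0 := by
    intro m
    induction m with
    | zero =>
      intro a ha
      rw [I, ρ.P_zero, Submodule.mul_bot] at ha
      rw [(Submodule.mem_bot k).1 ha, map_zero]
    | succ m ih =>
      have hI : c.I (m + 1) = ρ.H * Submodule.span k
          {b | ∃ i, ∃ γ : Fin n → ℕ, ∑ i, γ i < m + 1 ∧ b = c.χ i * ρ.xPow γ} := by
        rw [I, mul_assoc, S, AffineRep.P, Submodule.span_mul_span]
        congr 2
        ext b
        constructor
        · rintro ⟨_, ⟨i, rfl⟩, _, ⟨γ, hγ, rfl⟩, rfl⟩; exact ⟨i, γ, hγ, rfl⟩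
        · rintro ⟨i, γ, hγ, rfl⟩; exact ⟨_, ⟨i, rfl⟩, _, ⟨γ, hγ, rfl⟩, rfl⟩
      suffices ∀ h i (γ : Fin n → ℕ), ∑ i, γ i < m + 1 →
          E (ρ.hat h * (c.χ i * ρ.xPow γ)) = 0 by
        intro a ha
        rw [hI] at ha
        refine Submodule.mul_induction_on ha (fun a ha b hb => ?_) (fun a b ha hb => ?_)
        · obtain ⟨h, rfl⟩ := ha
          refine Submodule.span_induction ?_ ?_ ?_ ?_ hb
          · rintro _ ⟨i, γ, hγ, rfl⟩; exact this h i γ hγ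
          · simp
          · intro x y _ _ hx hy; rw [mul_add, map_add, hx, hy, add_zero]
          · intro r x _ hx; rw [mul_smul_comm, map_smul, hx, smul_zero]
        · rw [map_add, ha, hb, add_zero]
      intro h i γ hγ
      rcases Nat.lt_succ_iff_lt_or_eq.1 hγ with hlt | heq
      · refine ih _ ?_
        rw [I, ← mul_assoc]
        exact Submodule.mul_mem_mul (Submodule.mul_mem_mul (ρ.hat_mem_H h) (c.χ_mem_S i))
          (ρ.xPow_mem_P hlt)
      -- The recursion may have reduced the exponent through another index `j`. Then `γ j` is itself
      -- at least `d`, and the syzygy trades `χ_i x_j^d` for `χ_j x_i^d` at the cost of an element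
      -- with smaller cofactor degree, where the induction hypothesis applies.
      obtain ⟨j, hj, hrec⟩ := hstep (γ + Pi.single i d) ⟨i, by simp⟩
      rcases eq_or_ne j i with rfl | hji
      · have := hrec h
        rwa [add_tsub_cancel_right, mul_assoc] at this
      have hj' : d ≤ γ j := by simpa [hji] using hj
      have e1 : γ = γ - Pi.single j d + Pi.single j d := (sub_single_add hj').symm
      have e2 : γ + Pi.single i d - Pi.single j d = γ - Pi.single j d + Pi.single i d := by
        funext l
        rcases eq_or_ne l j with rfl | hl
        · simp [hji]
        · simp [hl]
      have h1 : ρ.hat h * (c.χ i * ρ.xPow γ) =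
          ρ.hat h * ((c.χ i * ρ.x j ^ d - c.χ j * ρ.x i ^ d) * ρ.xPow (γ - Pi.single j d)) +
            ρ.hat h * c.χ j * ρ.xPow (γ + Pi.single i d - Pi.single j d) := by
        rw [e2]
        conv_lhs => rw [e1]
        have e3 : ∀ (a : Fin n → ℕ) l, ρ.xPow (a + Pi.single l d) = ρ.x l ^ d * ρ.xPow a := by
          intro a l; rw [add_comm, ρ.xPow_add, ρ.xPow_single]
        rw [e3, e3]
        noncomm_ring
      rw [h1, map_add, hrec, add_zero]
      refine ih _ ?_
      have hsum := sum_sub_single hj'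
      rw [heq] at hsum
      rw [← c.H_mul_I]
      refine Submodule.mul_mem_mul (ρ.hat_mem_H h) ?_
      rw [← hsum, add_comm]
      exact c.I_mul_filt _ _ (Submodule.mul_mem_mul (c.syzygy_mem i j)
        (ρ.xPow_mem_filt (Nat.lt_succ_self _)))
  exact key

/-- The union of the filtered pieces is a two-sided ideal by `filt_mul_I` and `I_mul_filt`, and it
contains the generator. -/
theorem exists_mem_I (hgen : Algebra.adjoin k
    (Set.range ρ.tens ∪ Set.range ρ.perm ∪ Set.range ρ.x) = ⊤) {a : A}
    (ha : a ∈ TwoSidedIdeal.span {a | ∃ i : Fin n, (i : ℕ) = 0 ∧ a = c.χ i}) :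
    ∃ m, a ∈ c.I m := by
  have mono : ∀ {m m'}, m ≤ m' → c.I m ≤ c.I m' := fun h => mul_le_mul' le_rfl (ρ.P_mono h)
  let K : TwoSidedIdeal A := .mk' {a | ∃ m, a ∈ c.I m} ⟨0, zero_mem _⟩
    (fun {x y} ⟨m, hx⟩ ⟨m', hy⟩ => ⟨m + m', add_mem (mono (by omega) hx) (mono (by omega) hy)⟩)
    (fun {x} ⟨m, hx⟩ => ⟨m, neg_mem hx⟩)
    (fun {x y} ⟨m, hy⟩ => by
      obtain ⟨l, hl⟩ := ρ.mem_filt_of_span hgen x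
      exact ⟨l + m, c.filt_mul_I l m (Submodule.mul_mem_mul hl (mono (Nat.le_succ m) hy))⟩)
    (fun {x y} ⟨m, hx⟩ => by
      obtain ⟨l, hl⟩ := ρ.mem_filt_of_span hgen y
      exact ⟨m + l, c.I_mul_filt m l
        (Submodule.mul_mem_mul hx (ρ.filt_mono (Nat.le_succ l) hl))⟩)
  have hK : TwoSidedIdeal.span {a | ∃ i : Fin n, (i : ℕ) = 0 ∧ a = c.χ i} ≤ K := by
    rw [TwoSidedIdeal.span_le]
    rintro _ ⟨i, -, rfl⟩
    rw [SetLike.mem_coe, TwoSidedIdeal.mem_mk']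
    refine ⟨1, ?_⟩
    rw [← one_mul (c.χ i)]
    exact c.filt_mul_S 1 (Submodule.mul_mem_mul (ρ.H_le_filt 0 ρ.one_mem_H) (c.χ_mem_S i))
  have := hK ha
  rwa [TwoSidedIdeal.mem_mk'] at this

section Span

variable {A' : Type*} [Ring A'] [Algebra k A'] (Q : A →ₐ[k] A') (hQ : ∀ i, Q (c.χ i) = 0)

theorem map_x_pow (hQ : ∀ i, Q (c.χ i) = 0) (i : Fin n) :
    Q (ρ.x i ^ d) = - Q (c.χ i - ρ.x i ^ d) := by
  rw [map_sub, hQ, zero_sub, neg_neg]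

/-- In the quotient `x_i^d` becomes an element of lower degree, so induction on the degree leaves
only exponents less than `d`. -/
theorem map_filt_le (hQ : ∀ i, Q (c.χ i) = 0) (m : ℕ) :
    (ρ.filt m).map Q.toLinearMap ≤ Submodule.span k
      {a | ∃ h α, (∀ i, α i < d) ∧ a = Q (ρ.hat h * ρ.xPow α)} := by
  induction m with
  | zero => rw [ρ.filt_zero, Submodule.map_bot]; exact bot_le
  | succ m ih =>
    generalize hN : Submodule.span k
      {a | ∃ h α, (∀ i, α i < d) ∧ a = Q (ρ.hat h * ρ.xPow α)} = N at ih ⊢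
    rintro _ ⟨a, ha, rfl⟩
    refine ρ.filt_induction (p := fun a => Q a ∈ N) ?_ ?_ ?_ ha
    · rw [map_zero]; exact N.zero_mem
    · intro a b ha hb; rw [map_add]; exact N.add_mem ha hb
    · intro h α hα
      by_cases hd : ∃ i, d ≤ α i
      · obtain ⟨i, hi⟩ := hd
        have hs := sum_sub_single hi
        have e : Q (ρ.hat h * ρ.xPow α) =
            - Q (ρ.hat h * ((c.χ i - ρ.x i ^ d) * ρ.xPow (α - Pi.single i d))) := by
          conv_lhs => rw [← sub_single_add hi, add_comm, ρ.xPow_add, ρ.xPow_single]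
          rw [map_mul, map_mul, c.map_x_pow Q hQ, map_mul, map_mul, neg_mul, mul_neg]
        rw [e]
        refine N.neg_mem (ih ⟨_, ρ.filt_mono (m := d + ∑ j, (α - Pi.single i d : Fin n → ℕ) j)
          (by omega) ?_, rfl⟩)
        rw [← ρ.H_mul_filt]
        exact Submodule.mul_mem_mul (ρ.hat_mem_H h) (ρ.filt_mul_P _ _ (Submodule.mul_mem_mul
          (c.χ_mem i) (ρ.xPow_mem_P (Nat.lt_succ_self _))))
      · push Not at hd
        rw [← hN]
        exact Submodule.subset_span ⟨h, α, hd, rfl⟩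

theorem map_filt_le' (hQ : ∀ i, Q (c.χ i) = 0) (m : ℕ) :
    (ρ.filt m).map Q.toLinearMap ≤ Submodule.span k
      {a | ∃ α f π, (∀ i, α i < d) ∧ a = Q (ρ.xPow α * ρ.tens f * ρ.perm π)} := by
  induction m with
  | zero => rw [ρ.filt_zero, Submodule.map_bot]; exact bot_le
  | succ m ih =>
    refine (Submodule.map_mono (ρ.filt_le_P_mul_H _)).trans ?_
    rw [ρ.H_eq_span, AffineRep.P, Submodule.span_mul_span, Submodule.map_span_le]
    rintro _ ⟨_, ⟨α, hα, rfl⟩, _, ⟨f, π, rfl⟩, rfl⟩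
    change Q (ρ.xPow α * (ρ.tens f * ρ.perm π)) ∈ _
    by_cases hd : ∃ i, d ≤ α i
    · obtain ⟨i, hi⟩ := hd
      have hs := sum_sub_single hi
      rw [← sub_single_add hi, add_comm, ρ.xPow_add, ρ.xPow_single, mul_assoc]
      have e : Q (ρ.x i ^ d * (ρ.xPow (α - Pi.single i d) * (ρ.tens f * ρ.perm π))) =
          - Q ((c.χ i - ρ.x i ^ d) * (ρ.xPow (α - Pi.single i d) * (ρ.tens f * ρ.perm π))) := by
        rw [map_mul Q (ρ.x i ^ d), c.map_x_pow Q hQ, map_mul Q (_ - _), neg_mul]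
      rw [e]
      refine neg_mem (ih ⟨_, ρ.filt_mono (m := d + ∑ j, (α - Pi.single i d : Fin n → ℕ) j)
        (by omega) ?_, rfl⟩)
      rw [← ρ.hat_single]
      exact ρ.filt_mul_filt _ _ (Submodule.mul_mem_mul (c.χ_mem i)
        (ρ.xPow_mul_H _ _ (ρ.hat_mem_H _)))
    · push Not at hd
      exact Submodule.subset_span ⟨α, f, π, hd, by rw [mul_assoc]⟩

end Span

end CyclotomicFamily

end

/-! ### The reduced monomial basis of the quotient, and traces on the wreath product -/

section

open SkewMonoidAlgebra Equiv

variable {k : Type u} {R : Type v} {n : ℕ} [CommRing k] [Ring R] [Algebra k R]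
  [MulSemiringAction (Perm (Fin n)) R] [SMulCommClass (Perm (Fin n)) k R]

variable {D : WreathData k R n} {A : Type w} [Ring A] [Algebra k A]

/-- Modulo lower degree, a monomial crosses `f π` by permuting its exponents and twisting `f`; the
twist depends on `α` alone. -/
theorem AffineRep.exists_twist (ρ : AffineRep D A) (α : Fin n → ℕ) :
    ∃ e ∈ Subgroup.closure (Set.range D.Ψ), ∀ f π,
      ρ.xPow α * (ρ.tens (e f) * ρ.perm π) - ρ.tens f * ρ.perm π * ρ.xPow (α ∘ π) ∈
        ρ.filt (∑ i, α i) := by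
  obtain ⟨e, he, h⟩ := ρ.tens_mul_xPow α
  refine ⟨e, he, fun f π => ?_⟩
  have : ρ.xPow α * (ρ.tens (e f) * ρ.perm π) - ρ.tens f * ρ.perm π * ρ.xPow (α ∘ π) =
      ρ.tens f * -(ρ.perm π * ρ.xPow (α ∘ π) - ρ.xPow α * ρ.perm π) := by
    rw [← mul_assoc, h]; noncomm_ring
  rw [this, ← ρ.H_mul_filt]
  exact Submodule.mul_mem_mul (ρ.tens_mem_H f) (neg_mem (ρ.perm_mul_xPow π α))

theorem AffineRep.hat_mul_mem_filt (ρ : AffineRep D A) {m : ℕ} (h) {a : A} (ha : a ∈ ρ.filt m) :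
    ρ.hat h * a ∈ ρ.filt m := by
  rw [← ρ.H_mul_filt]
  exact Submodule.mul_mem_mul (ρ.hat_mem_H h) ha

/-- A quotient of `A` by the ideal generated by a cyclotomic family, where `A` has a basis of
monomials. -/
structure CyclotomicQuotient {ρ : AffineRep D A} {d : ℕ} (c : CyclotomicFamily ρ d)
    (A' : Type*) [Ring A'] [Algebra k A'] where
  /-- The quotient map. -/
  Q : A →ₐ[k] A'
  surjective : Function.Surjective Q
  map_χ : ∀ i, Q (c.χ i) = 0
  exists_mem_I : ∀ a, Q a = 0 → ∃ m, a ∈ c.I m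
  exists_mem_filt : ∀ a, ∃ m, a ∈ ρ.filt m
  /-- The action on the free module spanned by monomials. -/
  Φ : A →ₐ[k] Module.End k (WreathData.PBW R n)
  comp_Φ : ρ.comp Φ = D.pbwRep

namespace CyclotomicQuotient

variable {ρ : AffineRep D A} {d : ℕ} {c : CyclotomicFamily ρ d} {A' : Type*} [Ring A']
  [Algebra k A'] (q : CyclotomicQuotient c A')

theorem exists_functional {M : Type*} [AddCommGroup M] [Module k M]
    (w : (Fin n → ℕ) → SkewMonoidAlgebra R (Perm (Fin n)) →ₗ[k] M) :
    ∃ E : A' →ₗ[k] M, ∀ h α, (∀ i, α i < d) → E (q.Q (ρ.hat h * ρ.xPow α)) = w α h := by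
  obtain ⟨E, hE, hI⟩ := c.exists_reduced_functional q.Φ q.comp_Φ w
  have hker : LinearMap.ker q.Q.toLinearMap ≤ LinearMap.ker E := by
    intro a ha
    obtain ⟨m, hm⟩ := q.exists_mem_I a ha
    exact hI m a hm
  refine ⟨(Submodule.liftQ _ E hker) ∘ₗ
    (q.Q.toLinearMap.quotKerEquivOfSurjective q.surjective).symm.toLinearMap, fun h α hα => ?_⟩
  rw [← hE h α hα]
  have : (q.Q.toLinearMap.quotKerEquivOfSurjective q.surjective).symm
      (q.Q.toLinearMap (ρ.hat h * ρ.xPow α)) = Submodule.Quotient.mk (ρ.hat h * ρ.xPow α) := by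
    rw [LinearEquiv.symm_apply_eq]; rfl
  change (Submodule.liftQ _ E hker) ((q.Q.toLinearMap.quotKerEquivOfSurjective q.surjective).symm
    (q.Q.toLinearMap (ρ.hat h * ρ.xPow α))) = _
  rw [this, Submodule.liftQ_apply]

theorem span_hat : Submodule.span k
    {a | ∃ h α, (∀ i, α i < d) ∧ a = q.Q (ρ.hat h * ρ.xPow α)} = ⊤ := by
  refine eq_top_iff.2 fun a _ => ?_
  obtain ⟨a, rfl⟩ := q.surjective a
  obtain ⟨m, hm⟩ := q.exists_mem_filt a
  exact c.map_filt_le q.Q q.map_χ m ⟨a, hm, rfl⟩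

theorem span_tens_perm : Submodule.span k
    {a | ∃ α f π, (∀ i, α i < d) ∧ a = q.Q (ρ.xPow α * ρ.tens f * ρ.perm π)} = ⊤ := by
  refine eq_top_iff.2 fun a _ => ?_
  obtain ⟨a, rfl⟩ := q.surjective a
  obtain ⟨m, hm⟩ := q.exists_mem_filt a
  exact c.map_filt_le' q.Q q.map_χ m ⟨a, hm, rfl⟩

theorem ext_hat {M : Type*} [AddCommGroup M] [Module k M] {f g : A' →ₗ[k] M}
    (h : ∀ h α, (∀ i, α i < d) →
      f (q.Q (ρ.hat h * ρ.xPow α)) = g (q.Q (ρ.hat h * ρ.xPow α))) : f = g := by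
  refine LinearMap.ext_on q.span_hat ?_
  rintro _ ⟨x, α, hα, rfl⟩
  exact h x α hα

/-- The linear map sending a family of elements of the wreath product to the corresponding
combination of monomials. -/
def combination : ((Fin n → Fin d) → SkewMonoidAlgebra R (Perm (Fin n))) →ₗ[k] A' :=
  LinearMap.lsum k _ k fun α =>
    q.Q.toLinearMap ∘ₗ LinearMap.mulRight k (ρ.xPow fun i => α i) ∘ₗ ρ.hat.toLinearMap

theorem combination_apply (h : (Fin n → Fin d) → SkewMonoidAlgebra R (Perm (Fin n))) :
    q.combination h = ∑ α, q.Q (ρ.hat (h α) * ρ.xPow fun i => α i) := by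
  simp [combination]

/-- Injectivity tests against coefficient functionals that vanish on the ideal; surjectivity is the
spanning by reduced monomials. -/
theorem combination_bijective : Function.Bijective q.combination := by
  constructor
  · rw [injective_iff_map_eq_zero]
    intro h hh
    funext α
    obtain ⟨E, hE⟩ := q.exists_functional
      (fun β => if β = fun i => (α i : ℕ) then LinearMap.id else 0)
    have := congrArg E hh
    rw [map_zero, combination_apply, _root_.map_sum, Finset.sum_eq_single α] at this
    · rwa [hE _ _ fun i => (α i).2, if_pos rfl] at this
    · intro β _ hβ
      rw [hE _ _ fun i => (β i).2, if_neg]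
      · rfl
      · intro hc
        exact hβ (funext fun i => Fin.ext (congrFun hc i))
    · simp
  · rw [← LinearMap.range_eq_top, eq_top_iff, ← q.span_hat, Submodule.span_le]
    rintro _ ⟨h, α, hα, rfl⟩
    refine ⟨Pi.single (fun i => ⟨α i, hα i⟩) h, ?_⟩
    rw [combination_apply, Finset.sum_eq_single (fun i => ⟨α i, hα i⟩)]
    · simp
    · intro β _ hβ; simp [hβ]
    · simp

theorem finite_free (q : CyclotomicQuotient c A') [Module.Finite k R] [Module.Free k R] :
    Module.Finite k A' ∧ Module.Free k A' := by
  have e1 : SkewMonoidAlgebra R (Perm (Fin n)) ≃ₗ[k] (Perm (Fin n) →₀ R) := coeffLinearEquiv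
  have : Module.Finite k (SkewMonoidAlgebra R (Perm (Fin n))) := Module.Finite.equiv e1.symm
  have : Module.Free k (SkewMonoidAlgebra R (Perm (Fin n))) := Module.Free.of_equiv e1.symm
  have e2 := LinearEquiv.ofBijective _ q.combination_bijective
  exact ⟨Module.Finite.equiv e2, Module.Free.of_equiv e2⟩

end CyclotomicQuotient

/-- A nondegenerate trace on `R` that is invariant under the symmetric group and the twists. -/
structure WreathTrace (D : WreathData k R n) where
  /-- The trace. -/
  tr : R →ₗ[k] k
  tr_Ψ : ∀ i f, tr (D.Ψ i f) = tr f
  tr_smul : ∀ (π : Perm (Fin n)) f, tr (π • f) = tr f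
  exists_mul : ∀ φ : R →ₗ[k] k, ∃ b, ∀ f, φ f = tr (f * b)

namespace WreathTrace

variable (t : WreathTrace D)

theorem tr_closure {e : R ≃ₐ[k] R} (he : e ∈ Subgroup.closure (Set.range D.Ψ)) (f : R) :
    t.tr (e f) = t.tr f := by
  induction he using Subgroup.closure_induction generalizing f with
  | mem e he => obtain ⟨i, rfl⟩ := he; exact t.tr_Ψ i f
  | one => rfl
  | mul a b _ _ ha hb => rw [AlgEquiv.mul_apply, ha, hb]
  | inv a _ ha => rw [← ha (a⁻¹ f), ← AlgEquiv.mul_apply, mul_inv_cancel, AlgEquiv.one_apply]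

/-- The trace on the wreath product: the trace of the coefficient of the identity. -/
def wreath : SkewMonoidAlgebra R (Perm (Fin n)) →ₗ[k] k :=
  t.tr ∘ₗ Finsupp.lapply 1 ∘ₗ
    (coeffLinearEquiv (S := k) : SkewMonoidAlgebra R (Perm (Fin n)) ≃ₗ[k] _).toLinearMap

theorem wreath_single (π : Perm (Fin n)) (f : R) :
    t.wreath (single π f) = if π = 1 then t.tr f else 0 := by
  change t.tr ((single π f).coeff 1) = _
  rw [coeff_single_apply]
  split_ifs <;> simp

theorem wreath_ext {M : Type*} [AddCommGroup M] [Module k M]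
    {f g : SkewMonoidAlgebra R (Perm (Fin n)) →ₗ[k] M}
    (h : ∀ π r, f (single π r) = g (single π r)) (x) : f x = g x :=
  LinearMap.congr_fun (SkewMonoidAlgebra.lhom_ext (φ := f) (ψ := g) h) x

theorem wreath_exists_mul (φ : SkewMonoidAlgebra R (Perm (Fin n)) →ₗ[k] k) :
    ∃ b, ∀ h, φ h = t.wreath (h * b) := by
  choose r hr using fun π => t.exists_mul (φ ∘ₗ lsingle k π)
  -- Multiplying `single π f` by the summand for `σ` reaches the identity permutation only for `σ =
  -- π`, and the action on the coefficient is then undone, leaving `f * r π`.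
  refine ⟨∑ σ, single σ⁻¹ (σ⁻¹ • r σ), wreath_ext (g := t.wreath ∘ₗ LinearMap.mulRight k _) ?_⟩
  intro π f
  have h := hr π f
  rw [LinearMap.comp_apply] at h
  refine h.trans ?_
  rw [LinearMap.comp_apply, LinearMap.mulRight_apply, Finset.mul_sum, _root_.map_sum,
    Finset.sum_eq_single π]
  · rw [single_mul_single, wreath_single, if_pos (mul_inv_cancel π), smul_inv_smul]
  · intro σ _ hσ
    rw [single_mul_single, wreath_single, if_neg]
    rw [mul_inv_eq_one]
    exact hσ.symm
  · simp

theorem wreath_perm_mul (π : Perm (Fin n)) (h : SkewMonoidAlgebra R (Perm (Fin n))) :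
    t.wreath (single π 1 * h) = t.wreath (h * single π 1) := by
  refine wreath_ext (f := t.wreath ∘ₗ LinearMap.mulLeft k _)
    (g := t.wreath ∘ₗ LinearMap.mulRight k _) (fun σ r => ?_) h
  rw [LinearMap.comp_apply, LinearMap.comp_apply, LinearMap.mulRight_apply,
    LinearMap.mulLeft_apply, single_mul_single, single_mul_single, wreath_single, wreath_single,
    one_mul, smul_one, mul_one, t.tr_smul]
  exact if_congr mul_eq_one_comm rfl rfl

end WreathTrace

end

/-! ### The trace map, its nondegeneracy, and its commutation with permutations and scalars -/

section

open SkewMonoidAlgebra Equiv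

variable {k : Type u} {R : Type v} {n : ℕ} [CommRing k] [Ring R] [Algebra k R]
  [MulSemiringAction (Perm (Fin n)) R] [SMulCommClass (Perm (Fin n)) k R]

variable {D : WreathData k R n} {A : Type w} [Ring A] [Algebra k A]

theorem sum_exponent {α : Fin n → ℕ} {d : ℕ} (hα : ∀ i, α i + 1 = d) :
    ∑ i, α i = n * (d - 1) := by
  rw [Finset.sum_congr rfl fun i _ => show α i = d - 1 by have := hα i; omega]
  simp

theorem sum_exponent_le {α : Fin n → ℕ} {d : ℕ} (hα : ∀ i, α i < d) :
    ∑ i, α i ≤ n * (d - 1) := by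
  refine (Finset.sum_le_sum fun i _ => show α i ≤ d - 1 by have := hα i; omega).trans ?_
  simp

theorem exponent_top_of_sum {α : Fin n → ℕ} {d : ℕ} (hα : ∀ i, α i < d)
    (h : n * (d - 1) ≤ ∑ i, α i) (i : Fin n) : α i + 1 = d := by
  by_contra hi
  have h1 : ∑ i, α i < ∑ _i : Fin n, (d - 1) :=
    Finset.sum_lt_sum (fun i _ => by have := hα i; omega)
      ⟨i, Finset.mem_univ _, by have := hα i; omega⟩
  simp at h1
  omega

namespace CyclotomicQuotient

variable {ρ : AffineRep D A} {d : ℕ} {c : CyclotomicFamily ρ d} {A' : Type*} [Ring A']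
  [Algebra k A'] (q : CyclotomicQuotient c A') (t : WreathTrace D)

/-- Rewriting one power `x_i^d` by means of `χ_i` strictly lowers the total degree. -/
theorem exists_reduce {α : Fin n → ℕ} {i : Fin n} (hi : d ≤ α i) (h) :
    ∃ a ∈ ρ.filt (∑ j, α j), q.Q (ρ.hat h * ρ.xPow α) = q.Q a := by
  have hs := CyclotomicFamily.sum_sub_single hi
  refine ⟨- (ρ.hat h * ((c.χ i - ρ.x i ^ d) * ρ.xPow (α - Pi.single i d))), ?_, ?_⟩
  · refine neg_mem (ρ.hat_mul_mem_filt h ?_)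
    rw [← hs, add_comm]
    exact ρ.filt_mul_P _ _ (Submodule.mul_mem_mul (c.χ_mem i)
      (ρ.xPow_mem_P (Nat.lt_succ_self _)))
  · conv_lhs => rw [← CyclotomicFamily.sub_single_add hi, add_comm, ρ.xPow_add, ρ.xPow_single]
    rw [map_mul, map_mul, c.map_x_pow q.Q q.map_χ, map_neg, map_mul, map_mul, neg_mul, mul_neg]

open Classical in
theorem exists_traceMap : ∃ T : A' →ₗ[k] k, ∀ h α, (∀ i, α i < d) →
    T (q.Q (ρ.hat h * ρ.xPow α)) = if ∀ i, α i + 1 = d then t.wreath h else 0 := by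
  obtain ⟨T, hT⟩ := q.exists_functional
    (fun α => if ∀ i, α i + 1 = d then t.wreath else 0)
  refine ⟨T, fun h α hα => ?_⟩
  rw [hT h α hα]
  split_ifs <;> rfl

/-- The trace map of the quotient. -/
def traceMap : A' →ₗ[k] k := (q.exists_traceMap t).choose

open Classical in
theorem traceMap_of_lt (h) {α : Fin n → ℕ} (hα : ∀ i, α i < d) :
    q.traceMap t (q.Q (ρ.hat h * ρ.xPow α)) = if ∀ i, α i + 1 = d then t.wreath h else 0 :=
  (q.exists_traceMap t).choose_spec h α hα

/-- Membership in `filt m` means degree less than `m`, so the bound covers all degrees below the top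
degree `n * (d - 1)`. Reduction only lowers the degree, so the top monomial never appears. -/
theorem traceMap_filt {m : ℕ} (hm : m ≤ n * (d - 1)) {a : A} (ha : a ∈ ρ.filt m) :
    q.traceMap t (q.Q a) = 0 := by
  induction m generalizing a with
  | zero => rw [ρ.filt_zero, Submodule.mem_bot] at ha; rw [ha, map_zero, map_zero]
  | succ m ih =>
    refine ρ.filt_induction (p := fun a => q.traceMap t (q.Q a) = 0) (by simp) ?_ ?_ ha
    · intro a b ha hb; rw [map_add, map_add, ha, hb, add_zero]
    · intro h α hα
      by_cases hd : ∃ i, d ≤ α i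
      · obtain ⟨i, hi⟩ := hd
        obtain ⟨a, ha, e⟩ := q.exists_reduce hi h
        rw [e]
        exact ih (by omega) (ρ.filt_mono (Nat.lt_succ_iff.1 hα) ha)
      · push Not at hd
        rw [q.traceMap_of_lt t h hd, if_neg]
        intro htop
        have := sum_exponent htop
        omega

-- In the top degree a monomial with some exponent at least `d` drops below it when reduced. The
-- formula therefore needs only a bound on the total degree, not on each exponent.
open Classical in
theorem traceMap_mon (h) {α : Fin n → ℕ} (hα : ∑ i, α i ≤ n * (d - 1)) :
    q.traceMap t (q.Q (ρ.hat h * ρ.xPow α)) = if ∀ i, α i + 1 = d then t.wreath h else 0 := by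
  by_cases hd : ∃ i, d ≤ α i
  · obtain ⟨i, hi⟩ := hd
    obtain ⟨a, ha, e⟩ := q.exists_reduce hi h
    rw [e, q.traceMap_filt t hα ha, if_neg]
    intro htop
    have := htop i
    omega
  · push Not at hd
    exact q.traceMap_of_lt t h hd

theorem traceMap_congr {a b : A} (h : a - b ∈ ρ.filt (n * (d - 1))) :
    q.traceMap t (q.Q a) = q.traceMap t (q.Q b) := by
  rw [← sub_eq_zero, ← map_sub, ← map_sub]
  exact q.traceMap_filt t le_rfl h

theorem top_comp {α : Fin n → ℕ} (π : Perm (Fin n)) :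
    (∀ i, (α ∘ π) i + 1 = d) ↔ ∀ i, α i + 1 = d :=
  ⟨fun h i => by simpa using h (π⁻¹ i), fun h i => h (π i)⟩

/-- In degrees up to the top one the error in moving `f π` across `x^α` has degree below the top and
is invisible to the trace. -/
theorem exists_traceMap_mul (α : Fin n → ℕ) : ∃ e ∈ Subgroup.closure (Set.range D.Ψ),
    ∀ h f π, ∑ i, α i ≤ n * (d - 1) →
      q.traceMap t (q.Q (ρ.hat h * ρ.xPow α * (ρ.tens (e f) * ρ.perm π))) =
        q.traceMap t (q.Q (ρ.hat (h * single π f) * ρ.xPow (α ∘ π))) := by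
  obtain ⟨e, he, hm⟩ := ρ.exists_twist α
  refine ⟨e, he, fun h f π hα => q.traceMap_congr t ?_⟩
  have := ρ.hat_mul_mem_filt h (ρ.filt_mono hα (hm f π))
  rwa [mul_sub, ← mul_assoc (ρ.hat h) (ρ.xPow α), ← ρ.hat_single π f, ← mul_assoc (ρ.hat h) (ρ.hat _),
    ← map_mul] at this

theorem traceMap_mul_eq_zero {α : Fin n → ℕ} (hα : ∑ i, α i ≤ n * (d - 1))
    (hne : ¬ ∀ i, α i + 1 = d) (h h') :
    q.traceMap t (q.Q (ρ.hat h * ρ.xPow α * ρ.hat h')) = 0 := by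
  obtain ⟨e, -, hm⟩ := q.exists_traceMap_mul t α
  refine WreathTrace.wreath_ext (f := q.traceMap t ∘ₗ q.Q.toLinearMap ∘ₗ
    LinearMap.mulLeft k (ρ.hat h * ρ.xPow α) ∘ₗ ρ.hat.toLinearMap) (g := 0) (fun π f => ?_) h'
  have := hm h (e.symm f) π hα
  rw [AlgEquiv.apply_symm_apply] at this
  change q.traceMap t (q.Q (ρ.hat h * ρ.xPow α * ρ.hat (single π f))) = 0
  rw [ρ.hat_single, this, q.traceMap_mon, if_neg]
  · rwa [top_comp]
  · rwa [show ∑ i, (α ∘ π) i = ∑ i, α i from Equiv.sum_comp π α]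

theorem exists_traceMap_top {α : Fin n → ℕ} (hα : ∀ i, α i + 1 = d) (h') :
    ∃ b, ∀ h, q.traceMap t (q.Q (ρ.hat h * ρ.xPow α * ρ.hat b)) = t.wreath (h * h') := by
  obtain ⟨e, -, hm⟩ := q.exists_traceMap_mul t α
  induction h' using SkewMonoidAlgebra.induction_on with
  | zero => exact ⟨0, by simp⟩
  | single π f =>
    refine ⟨single π (e f), fun h => ?_⟩
    rw [ρ.hat_single, hm _ _ _ (sum_exponent hα).le, q.traceMap_mon, if_pos]
    · rwa [top_comp]
    · rw [show ∑ i, (α ∘ π) i = ∑ i, α i from Equiv.sum_comp π α, sum_exponent hα]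
  | add a b ha hb =>
    obtain ⟨a', ha⟩ := ha
    obtain ⟨b', hb⟩ := hb
    refine ⟨a' + b', fun h => ?_⟩
    rw [map_add, mul_add, map_add, map_add, ha, hb, mul_add, map_add]

/-- Moving `f π` to the left of the monomial twists `f` by an automorphism in the group generated by
the `Ψ_i`, which preserves the trace of `R`. -/
theorem traceMap_tens_perm {α : Fin n → ℕ} (hα : ∀ i, α i < d) (f : R) (π : Perm (Fin n)) :
    q.traceMap t (q.Q (ρ.xPow α * ρ.tens f * ρ.perm π)) =
      if (∀ i, α i + 1 = d) ∧ π = 1 then t.tr f else 0 := by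
  classical
  obtain ⟨e, he, hm⟩ := q.exists_traceMap_mul t α
  have := hm 1 (e.symm f) π (sum_exponent_le hα)
  rw [AlgEquiv.apply_symm_apply, map_one, one_mul, one_mul, ← mul_assoc] at this
  rw [this, q.traceMap_of_lt t _ (α := α ∘ π) (fun i => hα (π i)), t.wreath_single, ite_and]
  refine if_congr (top_comp π) (if_congr Iff.rfl ?_ rfl) rfl
  rw [← t.tr_closure he, AlgEquiv.apply_symm_apply]

theorem eq_traceMap {T : A' →ₗ[k] k} (hT : ∀ (α : Fin n → ℕ) f (π : Perm (Fin n)), (∀ i, α i < d) →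
    T (q.Q (ρ.xPow α * ρ.tens f * ρ.perm π)) =
      if (∀ i, α i + 1 = d) ∧ π = 1 then t.tr f else 0) : T = q.traceMap t := by
  refine LinearMap.ext_on q.span_tens_perm ?_
  rintro _ ⟨α, f, π, hα, rfl⟩
  rw [hT α f π hα, q.traceMap_tens_perm t hα]

/-- One step of the triangular argument: a functional vanishing in degrees below `m` is matched in
degree `m` by pairing with monomials complementary to those of degree `m`. The coefficients exist
because the trace on `R ⋊ S_n` is nondegenerate. -/
theorem exists_sub_vanish (m : ℕ) (φ : A' →ₗ[k] k) (hφ : ∀ a ∈ ρ.filt m, φ (q.Q a) = 0) :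
    ∃ b, ∀ a ∈ ρ.filt (m + 1), φ (q.Q a) = q.traceMap t (q.Q a * b) := by
  classical
  choose b₀ hb₀ using fun β : Fin n → Fin d => t.wreath_exists_mul
    (φ ∘ₗ q.Q.toLinearMap ∘ₗ LinearMap.mulRight k (ρ.xPow fun i => β i) ∘ₗ ρ.hat.toLinearMap)
  choose b hb using fun β : Fin n → Fin d => q.exists_traceMap_top t (α := fun _ => d - 1)
    (fun i => by have := (β i).pos; omega) (b₀ β)
  have hsum : ∀ β : Fin n → Fin d,
      ∑ i, (β i : ℕ) + ∑ i, (d - 1 - (β i : ℕ)) = n * (d - 1) := by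
    intro β
    rw [← Finset.sum_add_distrib,
      Finset.sum_congr rfl fun i _ => Nat.add_sub_cancel' (Nat.le_sub_one_of_lt (β i).2)]
    simp
  -- The product of `x^α` and the complement of `x^β`, with `α` and `β` of the same degree, is the
  -- top monomial only if `α = β`; otherwise it has top degree and trace zero.
  let r : A' := ∑ β : Fin n → Fin d with ∑ i, (β i : ℕ) = m,
    q.Q (ρ.xPow (fun i => d - 1 - (β i : ℕ)) * ρ.hat (b β))
  -- The correction is orthogonal to lower degrees, so it does not disturb what was already matched
  -- there.
  have low : ∀ a ∈ ρ.filt m, q.traceMap t (q.Q a * r) = 0 := by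
    intro a ha
    rw [Finset.mul_sum, _root_.map_sum]
    refine Finset.sum_eq_zero fun β hβ => ?_
    rw [← map_mul, ← mul_assoc]
    refine q.traceMap_filt t (hsum β).le (ρ.filt_mul_H _ (Submodule.mul_mem_mul ?_
      (ρ.hat_mem_H _)))
    rw [(Finset.mem_filter.1 hβ).2]
    exact ρ.filt_mul_P _ _ (Submodule.mul_mem_mul ha (ρ.xPow_mem_P (Nat.lt_succ_self _)))
  refine ⟨r, fun a ha => ?_⟩
  refine ρ.filt_induction (p := fun a => φ (q.Q a) = q.traceMap t (q.Q a * r)) (by simp) ?_ ?_ ha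
  · intro a b ha hb; rw [map_add, map_add, ha, hb, add_mul, map_add]
  intro h α hα
  have hα := Nat.lt_succ_iff.1 hα
  by_cases hd : ∃ i, d ≤ α i
  · obtain ⟨i, hi⟩ := hd
    obtain ⟨a, ha, e⟩ := q.exists_reduce hi h
    have ha := ρ.filt_mono hα ha
    rw [e, hφ a ha, low a ha]
  push Not at hd
  rcases hα.lt_or_eq with hlt | heq
  · have ha := ρ.hat_mul_xPow_mem h hlt
    rw [hφ _ ha, low _ ha]
  have hmul : ∀ β : Fin n → Fin d, q.Q (ρ.hat h * ρ.xPow α) *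
      q.Q (ρ.xPow (fun i => d - 1 - (β i : ℕ)) * ρ.hat (b β)) =
        q.Q (ρ.hat h * ρ.xPow (α + fun i => d - 1 - (β i : ℕ)) * ρ.hat (b β)) := by
    intro β; rw [← map_mul, ρ.xPow_add]; simp only [mul_assoc]
  rw [Finset.mul_sum, _root_.map_sum, Finset.sum_eq_single (fun i => ⟨α i, hd i⟩)]
  · rw [hmul]
    have e : (α + fun i => d - 1 - α i) = fun _ => d - 1 := by
      funext i; have := hd i; simp only [Pi.add_apply]; omega
    dsimp only
    rw [e, hb, ← hb₀]
    rfl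
  · intro β hβ hne
    rw [hmul]
    refine q.traceMap_mul_eq_zero t ?_ ?_ _ _
    · simp only [Pi.add_apply, Finset.sum_add_distrib]
      rw [heq, ← (Finset.mem_filter.1 hβ).2, hsum]
    · intro htop
      refine hne (funext fun i => Fin.ext ?_)
      have h1 := htop i
      have h2 := (β i).2
      simp only [Pi.add_apply] at h1
      change (β i : ℕ) = α i
      omega
  · intro hn
    exact absurd (by simpa using heq) hn

theorem traceMap_surjective (φ : A' →ₗ[k] k) : ∃ b, ∀ a, φ a = q.traceMap t (a * b) := by
  have key : ∀ m, ∃ b, ∀ a ∈ ρ.filt m, φ (q.Q a) = q.traceMap t (q.Q a * b) := by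
    intro m
    induction m with
    | zero =>
      refine ⟨0, fun a ha => ?_⟩
      rw [ρ.filt_zero, Submodule.mem_bot] at ha
      simp [ha]
    | succ m ih =>
      obtain ⟨b, hb⟩ := ih
      obtain ⟨b', hb'⟩ := q.exists_sub_vanish t m
        (φ - q.traceMap t ∘ₗ LinearMap.mulRight k b) (fun a ha => by simp [hb a ha])
      refine ⟨b + b', fun a ha => ?_⟩
      have := hb' a ha
      rw [LinearMap.sub_apply, sub_eq_iff_eq_add'] at this
      rw [this, mul_add, map_add]
      rfl
  obtain ⟨b, hb⟩ := key (n * (d - 1) + 1)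
  refine ⟨b, LinearMap.congr_fun (q.ext_hat (g := q.traceMap t ∘ₗ LinearMap.mulRight k b) ?_)⟩
  intro h α hα
  exact hb _ (ρ.hat_mul_xPow_mem h (Nat.lt_succ_iff.2 (sum_exponent_le hα)))

/-- Composed with an isomorphism of the dual with the finite free module itself, the surjective form
is a surjective endomorphism of a finitely generated module, hence injective. -/
theorem traceMap_bijective [Module.Finite k R] [Module.Free k R] :
    Function.Bijective ((LinearMap.mul k A').compr₂ (q.traceMap t)).flip := by
  obtain ⟨h1, h2⟩ := q.finite_free
  have hs : Function.Surjective ((LinearMap.mul k A').compr₂ (q.traceMap t)).flip := by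
    intro φ
    obtain ⟨b, hb⟩ := q.traceMap_surjective t φ
    exact ⟨b, LinearMap.ext fun a => (hb a).symm⟩
  refine ⟨?_, hs⟩
  let e : Module.Dual k A' ≃ₗ[k] A' := (Module.Free.chooseBasis k A').toDualEquiv.symm
  have := OrzechProperty.injective_of_surjective_endomorphism
    (e.toLinearMap ∘ₗ ((LinearMap.mul k A').compr₂ (q.traceMap t)).flip)
    (e.surjective.comp hs)
  exact Function.Injective.of_comp (f := e) this

theorem traceMap_perm (π : Perm (Fin n)) (a : A') :
    q.traceMap t (q.Q (ρ.perm π) * a) = q.traceMap t (a * q.Q (ρ.perm π)) := by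
  classical
  refine LinearMap.congr_fun (q.ext_hat (f := q.traceMap t ∘ₗ LinearMap.mulLeft k _)
    (g := q.traceMap t ∘ₗ LinearMap.mulRight k _) ?_) a
  intro h α hα
  rw [LinearMap.comp_apply, LinearMap.comp_apply, LinearMap.mulLeft_apply, LinearMap.mulRight_apply,
    ← map_mul, ← map_mul, ← mul_assoc, ← ρ.hat_perm, ← map_mul, q.traceMap_of_lt t _ hα]
  split_ifs with htop
  · obtain ⟨e, he, hm⟩ := q.exists_traceMap_mul t α
    have := hm h 1 π (sum_exponent_le hα)
    rw [map_one, map_one, one_mul, ← ρ.hat_perm] at this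
    rw [this, q.traceMap_of_lt t _ (α := α ∘ π) (fun i => hα (π i)), if_pos ((top_comp π).2 htop),
      t.wreath_perm_mul]
  · rw [q.traceMap_mul_eq_zero t (sum_exponent_le hα) htop]

/-- The two sources of the Nakayama automorphism on scalars: `ν` from the trace of `R`, and `e` from
crossing the top monomial. -/
theorem traceMap_tens {ν e : R → R} (hν : ∀ f g, t.tr (f * g) = t.tr (g * ν f))
    (he : ∀ (α : Fin n → ℕ), (∀ i, α i + 1 = d) → ∀ f, ρ.tens f * ρ.xPow α = ρ.xPow α * ρ.tens (e f))
    (f : R) (a : A') :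
    q.traceMap t (q.Q (ρ.tens f) * a) = q.traceMap t (a * q.Q (ρ.tens (e (ν f)))) := by
  classical
  refine LinearMap.congr_fun (q.ext_hat (f := q.traceMap t ∘ₗ LinearMap.mulLeft k _)
    (g := q.traceMap t ∘ₗ LinearMap.mulRight k _) ?_) a
  intro h α hα
  rw [LinearMap.comp_apply, LinearMap.comp_apply, LinearMap.mulLeft_apply, LinearMap.mulRight_apply,
    ← map_mul, ← map_mul, ← mul_assoc, ← ρ.hat_C, ← map_mul, q.traceMap_of_lt t _ hα]
  split_ifs with htop
  · rw [mul_assoc, ← he α htop, ← mul_assoc, ← ρ.hat_C, ← map_mul,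
      q.traceMap_of_lt t _ hα, if_pos htop]
    refine WreathTrace.wreath_ext (f := t.wreath ∘ₗ LinearMap.mulLeft k _)
      (g := t.wreath ∘ₗ LinearMap.mulRight k _) (fun σ r => ?_) h
    rw [LinearMap.comp_apply, LinearMap.comp_apply, LinearMap.mulRight_apply,
      LinearMap.mulLeft_apply, single_mul_single, single_mul_single, t.wreath_single,
      t.wreath_single, one_mul, mul_one, one_smul]
    split_ifs with hσ
    · rw [hσ, one_smul, hν]
    · rfl
  · rw [← ρ.hat_C, q.traceMap_mul_eq_zero t (sum_exponent_le hα) htop]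

end CyclotomicQuotient

end

/-! ### The trace commutes with the variables -/

section

open SkewMonoidAlgebra Equiv

variable {k : Type u} {R : Type v} {n : ℕ} [CommRing k] [Ring R] [Algebra k R]
  [MulSemiringAction (Perm (Fin n)) R] [SMulCommClass (Perm (Fin n)) k R]

variable {D : WreathData k R n} {A : Type w} [Ring A] [Algebra k A]

theorem WreathData.J_first (D : WreathData k R n) {o : Fin n} (ho : (o : ℕ) = 0) : D.J o = 0 := by
  rw [WreathData.J, Finset.filter_false_of_mem, Finset.sum_empty]
  intro j _ hj
  rw [Fin.lt_def, ho] at hj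
  exact absurd hj (Nat.not_lt_zero _)

namespace AffineRep

variable (ρ : AffineRep D A)

/-- The conjugates of the first variable. -/
theorem perm_x_first {o : Fin n} (ho : (o : ℕ) = 0) (π : Perm (Fin n)) :
    ρ.perm π * ρ.x o * ρ.perm π⁻¹ = ρ.x (π o) - ρ.hat (D.J (π o)) := by
  rw [ρ.perm_x, WreathData.dev, ← Perm.mul_apply, inv_mul_cancel, Perm.one_apply, D.J_first ho,
    mul_zero, sub_zero, map_mul, ρ.hat_perm, ← sub_mul, mul_assoc, CyclotomicFamily.perm_conj,
    mul_one]

theorem x_first_mul_hat {o : Fin n} (ho : (o : ℕ) = 0) (π : Perm (Fin n)) (f : R) :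
    ρ.x o * ρ.hat (single π f) = ρ.hat (single π ((D.Ψ o).symm f)) *
      (ρ.x (π⁻¹ o) - ρ.hat (D.J (π⁻¹ o))) := by
  have h1 := ρ.perm_x_first ho π⁻¹
  have h2 : ρ.x o * ρ.tens f = ρ.tens ((D.Ψ o).symm f) * ρ.x o := by
    rw [ρ.tens_x, AlgEquiv.apply_symm_apply]
  have h3 := CyclotomicFamily.perm_conj (ρ := ρ) π
  rw [inv_inv] at h1
  rw [← h1, ρ.hat_single, ρ.hat_single, ← mul_assoc, h2]
  simp only [mul_assoc]
  rw [← mul_assoc (ρ.perm π) (ρ.perm π⁻¹), h3, one_mul]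

theorem sub_hat_pow (l : Fin n) (h) (a : ℕ) :
    (ρ.x l - ρ.hat h) ^ a - ρ.x l ^ a ∈ ρ.filt a := by
  induction a with
  | zero => simp
  | succ a ih =>
    have e : (ρ.x l - ρ.hat h) ^ (a + 1) - ρ.x l ^ (a + 1) =
        ((ρ.x l - ρ.hat h) ^ a - ρ.x l ^ a) * (ρ.x l - ρ.hat h) - ρ.x l ^ a * ρ.hat h := by
      rw [pow_succ, pow_succ]; noncomm_ring
    rw [e]
    have h1 := ρ.xPow_mul_H (Pi.single l a) _ (ρ.hat_mem_H h)
    rw [ρ.xPow_single, Finset.sum_pi_single', if_pos (Finset.mem_univ _)] at h1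
    refine sub_mem (ρ.filt_mul_filt a 1 (Submodule.mul_mem_mul ih (sub_mem ?_ ?_))) h1
    · rw [← ρ.xPow_single_one]; exact ρ.xPow_mem_filt (by simp)
    · exact ρ.H_le_filt _ (ρ.hat_mem_H h)

end AffineRep

namespace CyclotomicQuotient

variable {ρ : AffineRep D A} {d : ℕ} {c : CyclotomicFamily ρ d} {A' : Type*} [Ring A']
  [Algebra k A'] (q : CyclotomicQuotient c A') (t : WreathTrace D)

/-- For `a > 0`, moving `x_l^a` past a summand `τ j l` of `J_l` turns it into `x_j^a`. The exponent
of `x_j` then exceeds `d - 1`, while the degree is the top one, so the trace vanishes; only `a = 0`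
contributes. -/
theorem traceMap_pow_mul_J {l : Fin n} {γ : Fin n → ℕ} {m : ℕ} (hd : d = m + 1)
    (hγ : γ + Pi.single l m = fun _ => m) (a b : ℕ) (hab : a + b = m) (h) :
    q.traceMap t (q.Q (ρ.hat h * (ρ.x l - ρ.hat (D.J l)) ^ a * ρ.hat (D.J l) *
      (ρ.x l ^ b * ρ.xPow γ))) = if a = 0 then t.wreath (h * D.J l) else 0 := by
  classical
  have hsum : m + ∑ i, γ i = n * (d - 1) := by
    have := congrArg (fun α : Fin n → ℕ => ∑ i, α i) hγ
    simp only [Pi.add_apply, Finset.sum_add_distrib, Finset.sum_pi_single', Finset.mem_univ,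
      if_true, Finset.sum_const, Finset.card_univ, Fintype.card_fin, smul_eq_mul] at this
    rw [hd, Nat.add_sub_cancel]; omega
  have hxb : ρ.x l ^ b * ρ.xPow γ = ρ.xPow (Pi.single l b + γ) := by
    rw [ρ.xPow_add, ρ.xPow_single]
  have hP : ρ.xPow (Pi.single l b + γ) ∈ ρ.P (b + ∑ i, γ i + 1) :=
    ρ.xPow_mem_P (by simp [Finset.sum_add_distrib])
  have e1 : q.traceMap t (q.Q (ρ.hat h * (ρ.x l - ρ.hat (D.J l)) ^ a * ρ.hat (D.J l) *
      (ρ.x l ^ b * ρ.xPow γ))) =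
      q.traceMap t (q.Q (ρ.hat h * (ρ.x l ^ a * ρ.hat (D.J l)) * ρ.xPow (Pi.single l b + γ))) := by
    refine q.traceMap_congr t ?_
    rw [hxb, ← mul_assoc (ρ.hat h), ← sub_mul, ← sub_mul, ← mul_sub, ← hsum, ← hab, add_assoc]
    exact ρ.filt_mul_P _ _ (Submodule.mul_mem_mul (ρ.filt_mul_H _ (Submodule.mul_mem_mul
      (ρ.hat_mul_mem_filt h (ρ.sub_hat_pow l _ a)) (ρ.hat_mem_H _))) hP)
  rw [e1]
  split_ifs with ha
  · subst ha
    obtain rfl : b = m := by omega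
    rw [pow_zero, one_mul, ← map_mul, add_comm, hγ, q.traceMap_mon, if_pos]
    · intro i; omega
    · simp [hd]
  · rw [WreathData.J, _root_.map_sum, Finset.mul_sum, Finset.mul_sum, Finset.sum_mul, _root_.map_sum, _root_.map_sum]
    refine Finset.sum_eq_zero fun j hj => ?_
    have hjl : j ≠ l := ne_of_lt (Finset.mem_filter.1 hj).2
    obtain ⟨e, -, he⟩ := ρ.exists_twist (Pi.single l a)
    have h1 := he (e.symm (D.t j l)) (swap j l)
    have e2 : (Pi.single l a : Fin n → ℕ) ∘ swap j l = Pi.single j a := by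
      funext i
      simp only [Function.comp_apply, Pi.single_apply, swap_apply_def]
      split_ifs <;> simp_all
    rw [AlgEquiv.apply_symm_apply, ρ.xPow_single, Finset.sum_pi_single',
      if_pos (Finset.mem_univ _), e2, ← ρ.hat_single, ← ρ.hat_single] at h1
    rw [WreathData.τ]
    have e3 : q.traceMap t (q.Q (ρ.hat h * (ρ.x l ^ a * ρ.hat (single (swap j l) (D.t j l))) *
        ρ.xPow (Pi.single l b + γ))) =
        q.traceMap t (q.Q (ρ.hat (h * single (swap j l) (e.symm (D.t j l))) *
          ρ.xPow (Pi.single j a + (Pi.single l b + γ)))) := by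
      refine q.traceMap_congr t ?_
      rw [map_mul, ρ.xPow_add (Pi.single j a), mul_assoc (ρ.hat h) (ρ.hat _),
        ← mul_assoc (ρ.hat (single _ _)), ← mul_assoc (ρ.hat h) (_ * _) (ρ.xPow _), ← sub_mul, 
        ← mul_sub, ← hsum, ← hab, add_assoc]
      exact ρ.filt_mul_P _ _ (Submodule.mul_mem_mul (ρ.hat_mul_mem_filt h h1) hP)
    rw [e3, q.traceMap_mon, if_neg]
    · intro htop
      have h2 := htop j
      have h3 := congrFun hγ j
      simp [hjl] at h2 h3
      omega
    · simp only [Pi.add_apply, Finset.sum_add_distrib, Finset.sum_pi_single', Finset.mem_univ,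
        if_true]
      omega

/-- With `y = x_l - J_l` one has `x_l^{a+1} - y^{a+1} = (x_l^a - y^a) x_l + y^a J_l`. In the
resulting telescoping sum a single term has nonzero trace. -/
theorem traceMap_pow_sub_pow {l : Fin n} {γ : Fin n → ℕ} {m : ℕ} (hd : d = m + 1)
    (hγ : γ + Pi.single l m = fun _ => m) (h) (a b : ℕ) (hab : a + b = m + 1) :
    q.traceMap t (q.Q (ρ.hat h * (ρ.x l ^ a - (ρ.x l - ρ.hat (D.J l)) ^ a) *
      (ρ.x l ^ b * ρ.xPow γ))) = if a = 0 then 0 else t.wreath (h * D.J l) := by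
  induction a generalizing b with
  | zero => simp
  | succ a ih =>
    have e : ρ.hat h * (ρ.x l ^ (a + 1) - (ρ.x l - ρ.hat (D.J l)) ^ (a + 1)) *
        (ρ.x l ^ b * ρ.xPow γ) =
        ρ.hat h * (ρ.x l ^ a - (ρ.x l - ρ.hat (D.J l)) ^ a) * (ρ.x l ^ (b + 1) * ρ.xPow γ) +
        ρ.hat h * (ρ.x l - ρ.hat (D.J l)) ^ a * ρ.hat (D.J l) * (ρ.x l ^ b * ρ.xPow γ) := by
      rw [pow_succ, pow_succ, pow_succ']; noncomm_ring
    rw [e, map_add, map_add, ih (b + 1) (by omega), q.traceMap_pow_mul_J t hd hγ a b (by omega)]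
    split_ifs <;> simp_all

/-- One degree above the top, `x_l^d` is replaced by `x_l^d - χ_l`. Conjugating the expansion of
`χ_o` gives leading terms of `χ_l` in `y = x_l - J_l`: the difference `x_l^d - y^d` contributes
`J_l`, and the subleading term contributes `π • c₀`. -/
theorem traceMap_top_succ {c₀ : R} {o : Fin n} (ho : (o : ℕ) = 0)
    (hχ : c.χ o - ρ.x o ^ d + ρ.tens c₀ * ρ.x o ^ (d - 1) ∈ ρ.filt (d - 1))
    {α : Fin n → ℕ} (hα : ∀ i, α i + 1 = d) (π : Perm (Fin n)) (h) :
    q.traceMap t (q.Q (ρ.hat h * ρ.xPow (α + Pi.single (π o) 1))) =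
      t.wreath (h * (D.J (π o) + single 1 (π • c₀))) := by
  classical
  obtain ⟨m, hm⟩ : ∃ m, d = m + 1 := ⟨d - 1, by have := hα o; omega⟩
  have hαm : α = fun _ => m := funext fun i => by have := hα i; omega
  have hm' : d - 1 = m := by omega
  rw [hm'] at hχ
  set l := π o with hl
  have hγ : (α - Pi.single l m) + Pi.single l m = fun _ => m := by
    rw [← hαm]; exact CyclotomicFamily.sub_single_add (by rw [hαm])
  set γ := α - Pi.single l m with hγdef
  have hsum : m + ∑ i, γ i = n * (d - 1) := by
    have := congrArg (fun α : Fin n → ℕ => ∑ i, α i) hγ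
    simp only [Pi.add_apply, Finset.sum_add_distrib, Finset.sum_pi_single', Finset.mem_univ,
      if_true, Finset.sum_const, Finset.card_univ, Fintype.card_fin, smul_eq_mul] at this
    rw [hm, Nat.add_sub_cancel]; omega
  set y := ρ.x l - ρ.hat (D.J l) with hy
  have hconj : ∀ a, ρ.perm π * ρ.x o ^ a * ρ.perm π⁻¹ = y ^ a := by
    intro a
    induction a with
    | zero => rw [pow_zero, pow_zero, mul_one, CyclotomicFamily.perm_conj]
    | succ a ih =>
      have h3 : ρ.perm π⁻¹ * ρ.perm π = 1 := by rw [← map_mul, inv_mul_cancel, map_one]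
      rw [pow_succ, pow_succ, ← ih, hy, hl, ← ρ.perm_x_first ho π]
      calc _ = ρ.perm π * ρ.x o ^ a * 1 * ρ.x o * ρ.perm π⁻¹ := by noncomm_ring
        _ = _ := by rw [← h3]; noncomm_ring
  have hr : c.χ l - y ^ d + ρ.tens (π • c₀) * y ^ m ∈ ρ.filt m := by
    have e : c.χ l - y ^ d + ρ.tens (π • c₀) * y ^ m =
        ρ.perm π * (c.χ o - ρ.x o ^ d + ρ.tens c₀ * ρ.x o ^ m) * ρ.perm π⁻¹ := by
      rw [← hconj, ← hconj, hl, c.χ_eq, mul_add, mul_sub, add_mul, sub_mul, ← mul_assoc,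
        ← mul_assoc, ← mul_assoc, ρ.perm_tens]
    rw [e, ← ρ.hat_perm]
    exact ρ.filt_mul_H _ (Submodule.mul_mem_mul (ρ.hat_mul_mem_filt _ hχ) (ρ.perm_mem_H _))
  have hP : ρ.xPow γ ∈ ρ.P (∑ i, γ i + 1) := ρ.xPow_mem_P (Nat.lt_succ_self _)
  have e0 : ρ.xPow (α + Pi.single l 1) = ρ.x l ^ d * ρ.xPow γ := by
    rw [← ρ.xPow_single, ← ρ.xPow_add, hαm, ← hγ, add_assoc, ← Pi.single_add, ← hm, add_comm]
  have e1 : q.Q (ρ.hat h * ρ.xPow (α + Pi.single l 1)) =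
      q.Q (ρ.hat h * (ρ.x l ^ d - c.χ l) * ρ.xPow γ) := by
    rw [e0, mul_sub, sub_mul, map_sub, map_mul q.Q (ρ.hat h * c.χ l), map_mul q.Q _ (c.χ l),
      q.map_χ, mul_zero, zero_mul, sub_zero, mul_assoc]
  have e2 : q.traceMap t (q.Q (ρ.hat h * (ρ.x l ^ d - c.χ l) * ρ.xPow γ)) =
      q.traceMap t (q.Q (ρ.hat h * (ρ.x l ^ d - y ^ d) * ρ.xPow γ)) +
        q.traceMap t (q.Q (ρ.hat h * (ρ.tens (π • c₀) * ρ.x l ^ m) * ρ.xPow γ)) := by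
    rw [← map_add, ← map_add]
    refine q.traceMap_congr t ?_
    have : ρ.hat h * (ρ.x l ^ d - c.χ l) * ρ.xPow γ -
        (ρ.hat h * (ρ.x l ^ d - y ^ d) * ρ.xPow γ +
          ρ.hat h * (ρ.tens (π • c₀) * ρ.x l ^ m) * ρ.xPow γ) =
        ρ.hat h * (ρ.tens (π • c₀) * (y ^ m - ρ.x l ^ m) -
          (c.χ l - y ^ d + ρ.tens (π • c₀) * y ^ m)) * ρ.xPow γ := by noncomm_ring
    rw [this, ← hsum]
    refine ρ.filt_mul_P _ _ (Submodule.mul_mem_mul (ρ.hat_mul_mem_filt h (sub_mem ?_ hr)) hP)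
    rw [← ρ.hat_C]
    exact ρ.hat_mul_mem_filt _ (ρ.sub_hat_pow _ _ _)
  have e3 : ρ.hat h * (ρ.tens (π • c₀) * ρ.x l ^ m) * ρ.xPow γ =
      ρ.hat (h * single 1 (π • c₀)) * ρ.xPow α := by
    rw [map_mul, ρ.hat_C, hαm, ← hγ, add_comm, ρ.xPow_add, ρ.xPow_single]; simp only [mul_assoc]
  have e4 := q.traceMap_pow_sub_pow t hm hγ h (m + 1) 0 rfl
  rw [pow_zero, one_mul, ← hm, ← hy, if_neg (by omega)] at e4
  rw [e1, e2, e3, e4, q.traceMap_mon t _ (sum_exponent hα).le, if_pos hα, mul_add, map_add]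

/-- Moving `x_o` right past `π` produces a Jucys-Murphy term that cancels the one found in
`traceMap_top_succ`. What remains on the two sides is a trace involving `c₀`, equal because both
`c₀` and the trace are fixed by `Ψ_o`. Below the top exponent no such correction enters. -/
theorem traceMap_x_first {c₀ : R} {o : Fin n} (ho : (o : ℕ) = 0)
    (hχ : c.χ o - ρ.x o ^ d + ρ.tens c₀ * ρ.x o ^ (d - 1) ∈ ρ.filt (d - 1))
    (hc₀ : D.Ψ o c₀ = c₀) (a : A') :
    q.traceMap t (q.Q (ρ.x o) * a) = q.traceMap t (a * q.Q (ρ.x o)) := by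
  classical
  refine LinearMap.congr_fun (q.ext_hat (f := q.traceMap t ∘ₗ LinearMap.mulLeft k _)
    (g := q.traceMap t ∘ₗ LinearMap.mulRight k _) ?_) a
  intro h α hα
  refine WreathTrace.wreath_ext (f := (q.traceMap t ∘ₗ LinearMap.mulLeft k (q.Q (ρ.x o))) ∘ₗ
    q.Q.toLinearMap ∘ₗ LinearMap.mulRight k (ρ.xPow α) ∘ₗ ρ.hat.toLinearMap)
    (g := (q.traceMap t ∘ₗ LinearMap.mulRight k (q.Q (ρ.x o))) ∘ₗ
    q.Q.toLinearMap ∘ₗ LinearMap.mulRight k (ρ.xPow α) ∘ₗ ρ.hat.toLinearMap) (fun π f => ?_) h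
  change q.traceMap t (q.Q (ρ.x o) * q.Q (ρ.hat (single π f) * ρ.xPow α)) =
    q.traceMap t (q.Q (ρ.hat (single π f) * ρ.xPow α) * q.Q (ρ.x o))
  have e1 : ρ.x o * (ρ.hat (single π f) * ρ.xPow α) =
      ρ.hat (single π ((D.Ψ o).symm f)) * ρ.xPow (α + Pi.single (π⁻¹ o) 1) -
        ρ.hat (single π ((D.Ψ o).symm f) * D.J (π⁻¹ o)) * ρ.xPow α := by
    rw [← mul_assoc, ρ.x_first_mul_hat ho, add_comm, ρ.xPow_add, ρ.xPow_single_one, map_mul]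
    noncomm_ring
  have e2 : ρ.hat (single π f) * ρ.xPow α * ρ.x o =
      ρ.hat (single π f) * ρ.xPow (α + Pi.single o 1) := by
    rw [ρ.xPow_add, ρ.xPow_single_one, mul_assoc]
  have htr : ∀ g, t.tr ((D.Ψ o).symm g) = t.tr g := fun g => by
    rw [← t.tr_Ψ o, AlgEquiv.apply_symm_apply]
  rw [← map_mul, ← map_mul, e1, e2, map_sub, map_sub]
  by_cases htop : ∀ i, α i + 1 = d
  · have h1 := q.traceMap_top_succ t ho hχ htop (swap o (π⁻¹ o)) (single π ((D.Ψ o).symm f))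
    have h2 := q.traceMap_top_succ t ho hχ htop 1 (single π f)
    rw [swap_apply_left] at h1
    rw [Perm.one_apply, D.J_first ho, zero_add, one_smul] at h2
    rw [h1, h2, q.traceMap_of_lt t _ hα, if_pos htop, mul_add, map_add, add_sub_cancel_left,
      single_mul_single, single_mul_single, t.wreath_single, t.wreath_single]
    simp only [mul_one]
    split_ifs with hπ
    · subst hπ
      have hs : swap o ((1 : Perm (Fin n))⁻¹ o) = 1 := swap_self o
      rw [hs]
      simp only [one_smul]
      rw [← t.tr_Ψ o, map_mul, AlgEquiv.apply_symm_apply, hc₀]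
    · rfl
  · have hlt : ∑ i, α i < n * (d - 1) := by
      by_contra hge
      exact htop (exponent_top_of_sum hα (not_lt.1 hge))
    have hs : ∀ i, ∑ j, (α + Pi.single i 1 : Fin n → ℕ) j ≤ n * (d - 1) := fun i => by
      simp only [Pi.add_apply, Finset.sum_add_distrib, Finset.sum_pi_single', Finset.mem_univ,
        if_true]
      omega
    rw [q.traceMap_mon t _ (hs _), q.traceMap_mon t _ (hs _), q.traceMap_of_lt t _ hα, if_neg htop,
      sub_zero, t.wreath_single, t.wreath_single, htr]
    by_cases hπ : π = 1
    · subst hπ; simp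
    · simp [hπ]

/-- Elements commuting with everything under the trace are closed under products and sums, and `x_{π
o}` is built from `x_o`, permutations and teleporters. -/
theorem traceMap_x {c₀ : Fin n → R}
    (hχ : ∀ o : Fin n, (o : ℕ) = 0 →
      c.χ o - ρ.x o ^ d + ρ.tens (c₀ o) * ρ.x o ^ (d - 1) ∈ ρ.filt (d - 1))
    (hc₀ : ∀ o : Fin n, (o : ℕ) = 0 → D.Ψ o (c₀ o) = c₀ o)
    (ht : ∀ i j a, i ≠ j → q.traceMap t (q.Q (ρ.tens (D.t i j)) * a) =
      q.traceMap t (a * q.Q (ρ.tens (D.t i j)))) (i : Fin n) (a : A') :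
    q.traceMap t (q.Q (ρ.x i) * a) = q.traceMap t (a * q.Q (ρ.x i)) := by
  have hmul : ∀ u v : A', (∀ a, q.traceMap t (u * a) = q.traceMap t (a * u)) →
      (∀ a, q.traceMap t (v * a) = q.traceMap t (a * v)) →
      ∀ a, q.traceMap t (u * v * a) = q.traceMap t (a * (u * v)) := by
    intro u v hu hv a
    rw [mul_assoc, hu, mul_assoc, hv, mul_assoc]
  obtain ⟨o, π, ho, rfl⟩ := CyclotomicFamily.exists_first i
  have hJ : ∀ a, q.traceMap t (q.Q (ρ.hat (D.J (π o))) * a) =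
      q.traceMap t (a * q.Q (ρ.hat (D.J (π o)))) := by
    intro a
    rw [WreathData.J, _root_.map_sum, _root_.map_sum, Finset.sum_mul, Finset.mul_sum, _root_.map_sum,
      _root_.map_sum]
    refine Finset.sum_congr rfl fun j hj => ?_
    have hne : j ≠ π o := ne_of_lt (Finset.mem_filter.1 hj).2
    rw [WreathData.τ, ρ.hat_single, map_mul q.Q]
    exact hmul _ _ (fun a => ht _ _ a hne) (q.traceMap_perm t _) a
  have e : ρ.x (π o) = ρ.perm π * ρ.x o * ρ.perm π⁻¹ + ρ.hat (D.J (π o)) := by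
    rw [ρ.perm_x_first ho, sub_add_cancel]
  rw [e, map_add, add_mul, mul_add, map_add, map_add, hJ, map_mul q.Q, map_mul q.Q,
    hmul _ _ (hmul _ _ (q.traceMap_perm t _) (q.traceMap_x_first t ho (hχ o ho) (hc₀ o ho)))
      (q.traceMap_perm t _)]

end CyclotomicQuotient

end

/-! ### Super tensor powers: Koszul signs and superpermutations -/

section

open Equiv

variable {k : Type u} {A : Type v} [CommRing k] [Ring A] [Algebra k A]

theorem paritySign_mul_self (a : ZMod 2) : paritySign a * paritySign a = 1 := by
  revert a; decide

section Parity

variable (𝒜 : ℕ × ZMod 2 → Submodule k A) [GradedAlgebra 𝒜]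

/-- The element `a` is homogeneous of parity `ε`. -/
def IsPar (ε : ZMod 2) (a : A) : Prop := parityProj 𝒜 ε a = a

variable {𝒜}

theorem isPar_proj (ε : ZMod 2) (a : A) : IsPar 𝒜 ε (parityProj 𝒜 ε a) := by
  rw [IsPar, parityProj_parityProj, if_pos rfl]

theorem IsPar.mul {ε η : ZMod 2} {a b : A} (ha : IsPar 𝒜 ε a) (hb : IsPar 𝒜 η b) :
    IsPar 𝒜 (ε + η) (a * b) := by
  have := parityProj_mul (𝒜 := 𝒜) ε η (ε + η) a b
  rwa [if_pos rfl, ha, hb] at this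

theorem isPar_one : IsPar 𝒜 0 (1 : A) := by
  rw [IsPar, parityProj_one, if_pos rfl]

theorem isPar_of_mem {p : ℕ × ZMod 2} {a : A} (ha : a ∈ 𝒜 p) : IsPar 𝒜 p.2 a := by
  rw [IsPar, parityProj_of_mem _ ha, if_pos rfl]

theorem IsPar.proj {ε : ZMod 2} {a : A} (ha : IsPar 𝒜 ε a) (η : ZMod 2) :
    parityProj 𝒜 η a = if η = ε then a else 0 := by
  rw [← ha, parityProj_parityProj, ha]

theorem IsPar.parityInv {ε : ZMod 2} {a : A} (ha : IsPar 𝒜 ε a) :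
    parityInv 𝒜 a = paritySign ε • a := by
  rw [← ha, parityInv_parityProj, ha]

end Parity

namespace SuperTensorPower

variable {𝒜 : ℕ × ZMod 2 → Submodule k A} [GradedAlgebra 𝒜] {n : ℕ}

theorem ext_par {M : Type w} [AddCommGroup M] [Module k M] {p q : SuperTensorPower 𝒜 n →ₗ[k] M}
    (h : ∀ (ε : Fin n → ZMod 2) f, (∀ i, IsPar 𝒜 (ε i) (f i)) →
      p (pure 𝒜 n f) = q (pure 𝒜 n f)) : p = q := by
  refine hom_ext fun f => ?_
  rw [← sum_proj (pure 𝒜 n f), map_sum, map_sum]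
  refine Finset.sum_congr rfl fun ε _ => ?_
  rw [proj_pure]
  exact h ε _ fun i => isPar_proj _ _

theorem proj_pure_par {ε : Fin n → ZMod 2} {f : Fin n → A} (hf : ∀ i, IsPar 𝒜 (ε i) (f i)) :
    proj 𝒜 n ε (pure 𝒜 n f) = pure 𝒜 n f := by
  rw [proj_pure]
  exact congrArg _ (funext fun i => hf i)

theorem mul_def (a b : SuperTensorPower 𝒜 n) : a * b = superMul 𝒜 n a b := rfl

theorem one_eq : (1 : SuperTensorPower 𝒜 n) = pure 𝒜 n 1 := rfl

theorem pure_mul_pure {ε η : Fin n → ZMod 2} {f g : Fin n → A} (hf : ∀ i, IsPar 𝒜 (ε i) (f i))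
    (hg : ∀ i, IsPar 𝒜 (η i) (g i)) :
    pure 𝒜 n f * pure 𝒜 n g = mulSign ε η • pure 𝒜 n (f * g) := by
  rw [mul_def, ← proj_pure_par hf, ← proj_pure_par hg, superMul_proj_proj, proj_pure_par hf,
    proj_pure_par hg, rawMul_pure]

theorem perm_pure (π : Perm (Fin n)) {ε : Fin n → ZMod 2} {f : Fin n → A}
    (hf : ∀ i, IsPar 𝒜 (ε i) (f i)) :
    perm 𝒜 n π (pure 𝒜 n f) = permSign π ε • pure 𝒜 n fun i => f (π.symm i) := by
  rw [perm, LinearMap.sum_apply, Finset.sum_eq_single ε]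
  · rw [LinearMap.smul_apply, LinearMap.comp_apply, proj_pure_par hf, rawPerm_pure]
  · intro η _ hη
    rw [LinearMap.smul_apply, LinearMap.comp_apply, ← proj_pure_par hf, proj_proj, if_neg hη,
      map_zero, smul_zero]
  · simp

/-- The sign of multiplying before and after permuting differs exactly at the pairs inverted by `π`.
Those pairs are the mixed terms in the expansion of `permSign π (ε + η)`, doubled contributions
vanishing modulo 2. -/
theorem permSign_mul (π : Perm (Fin n)) (ε η : Fin n → ZMod 2) :
    mulSign ε η * permSign π (ε + η) = permSign π ε * permSign π η *
      mulSign (fun i => ε (π.symm i)) (fun i => η (π.symm i)) := by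
  rw [mulSign, mulSign, permSign, permSign, permSign, ← paritySign_add, ← paritySign_add,
    ← paritySign_add]
  congr 1
  have h1 : ∑ i, ∑ j, (if i < j ∧ π j < π i then (ε + η) i * (ε + η) j else 0) =
      ∑ i, ∑ j, (if i < j ∧ π j < π i then ε i * ε j else 0) +
      ∑ i, ∑ j, (if i < j ∧ π j < π i then η i * η j else 0) +
      (∑ i, ∑ j, (if i < j ∧ π j < π i then ε i * η j else 0) +
      ∑ i, ∑ j, (if j < i ∧ π i < π j then ε i * η j else 0)) := by
    rw [Finset.sum_comm (f := fun i j => if j < i ∧ π i < π j then ε i * η j else 0)]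
    simp_rw [← Finset.sum_add_distrib]
    refine Finset.sum_congr rfl fun i _ => Finset.sum_congr rfl fun j _ => ?_
    split_ifs
    · simp only [Pi.add_apply]; ring
    · simp
  have h2 : ∑ i, ∑ j, (if j < i then ε (π.symm i) * η (π.symm j) else 0) =
      ∑ i, ∑ j, (if π j < π i then ε i * η j else 0) := by
    rw [← Equiv.sum_comp π]
    refine Finset.sum_congr rfl fun i _ => ?_
    rw [← Equiv.sum_comp π]
    simp
  have h3 : ∑ i, ∑ j, (if j < i then ε i * η j else 0) +
      (∑ i, ∑ j, (if i < j ∧ π j < π i then ε i * η j else 0) +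
      ∑ i, ∑ j, (if j < i ∧ π i < π j then ε i * η j else 0)) =
      ∑ i, ∑ j, (if π j < π i then ε i * η j else 0) := by
    simp_rw [← Finset.sum_add_distrib]
    refine Finset.sum_congr rfl fun i _ => Finset.sum_congr rfl fun j _ => ?_
    rcases lt_trichotomy i j with h | h | h
    · simp [h, h.asymm]
    · subst h; simp
    · have hne : π i ≠ π j := fun e => h.ne' (π.injective e)
      rcases hne.lt_or_gt with h' | h'
      · simp [h, h.asymm, h', h'.asymm, CharTwo.add_self_eq_zero]
      · simp [h, h.asymm, h', h'.asymm]
  rw [h1, h2, ← h3]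
  ring

theorem perm_mul (π : Perm (Fin n)) (a b : SuperTensorPower 𝒜 n) :
    perm 𝒜 n π (a * b) = perm 𝒜 n π a * perm 𝒜 n π b := by
  have : (superMul 𝒜 n).compr₂ (perm 𝒜 n π) =
      (superMul 𝒜 n).compl₁₂ (perm 𝒜 n π) (perm 𝒜 n π) := by
    refine ext_par fun ε f hf => ext_par fun η g hg => ?_
    change perm 𝒜 n π (pure 𝒜 n f * pure 𝒜 n g) =
      perm 𝒜 n π (pure 𝒜 n f) * perm 𝒜 n π (pure 𝒜 n g)
    rw [pure_mul_pure hf hg, map_zsmul, perm_pure (f := f * g) π fun i => (hf i).mul (hg i),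
      perm_pure π hf, perm_pure π hg, smul_mul_smul_comm,
      pure_mul_pure (fun i => hf (π.symm i)) (fun i => hg (π.symm i)), smul_smul, smul_smul]
    congr 1
    exact permSign_mul π ε η
  exact LinearMap.congr_fun (LinearMap.congr_fun this a) b

theorem isPar_update_one (i : Fin n) {ε : ZMod 2} {f : A} (hf : IsPar 𝒜 ε f) (j : Fin n) :
    IsPar 𝒜 ((Pi.single i ε : Fin n → ZMod 2) j) (Function.update (1 : Fin n → A) i f j) := by
  rcases eq_or_ne j i with rfl | h
  · simpa using hf
  · simpa [h] using isPar_one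

theorem permSign_single (π : Perm (Fin n)) (i : Fin n) (ε : ZMod 2) :
    permSign π (Pi.single i ε) = 1 := by
  rw [permSign, Finset.sum_eq_zero, paritySign_zero]
  intro a _
  refine Finset.sum_eq_zero fun b _ => ?_
  split_ifs with h
  · by_cases ha : a = i
    · have hb : b ≠ i := by rintro rfl; exact h.1.ne ha
      rw [Pi.single_eq_of_ne hb, mul_zero]
    · rw [Pi.single_eq_of_ne ha, zero_mul]
  · rfl

theorem mulSign_single (i j : Fin n) (ε η : ZMod 2) :
    mulSign (Pi.single i ε) (Pi.single j η) = paritySign (if j < i then ε * η else 0) := by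
  rw [mulSign, Finset.sum_eq_single i, Finset.sum_eq_single j]
  · simp
  · intro b _ hb; simp [hb]
  · simp
  · intro b _ hb; simp [hb]
  · simp

theorem single_add (i : Fin n) (f g : A) :
    single 𝒜 n i (f + g) = single 𝒜 n i f + single 𝒜 n i g :=
  (pure 𝒜 n).map_update_add _ _ _ _

theorem single_smul (i : Fin n) (r : k) (f : A) :
    single 𝒜 n i (r • f) = r • single 𝒜 n i f :=
  (pure 𝒜 n).map_update_smul _ _ _ _

/-- The linear map `f ↦ f_i`. -/
def singleLin (i : Fin n) : A →ₗ[k] SuperTensorPower 𝒜 n where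
  toFun := single 𝒜 n i
  map_add' := single_add i
  map_smul' := single_smul i

variable (𝒜) in
theorem bilin_ext_par {M : Type w} [AddCommGroup M] [Module k M] {p q : A →ₗ[k] A →ₗ[k] M}
    (h : ∀ ε η f g, IsPar 𝒜 ε f → IsPar 𝒜 η g → p f g = q f g) : p = q := by
  ext f g
  rw [← sum_parityProj (𝒜 := 𝒜) f, ← sum_parityProj (𝒜 := 𝒜) g]
  simp only [map_sum, LinearMap.sum_apply]
  exact Finset.sum_congr rfl fun η _ => Finset.sum_congr rfl fun ε _ =>
    h _ _ _ _ (isPar_proj _ _) (isPar_proj _ _)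

theorem single_mul_single_of_par {i j : Fin n} {ε η : ZMod 2} {f g : A} (hf : IsPar 𝒜 ε f)
    (hg : IsPar 𝒜 η g) : single 𝒜 n i f * single 𝒜 n j g =
      paritySign (if j < i then ε * η else 0) •
        pure 𝒜 n (Function.update (1 : Fin n → A) i f * Function.update (1 : Fin n → A) j g) := by
  rw [single, single, pure_mul_pure (isPar_update_one i hf) (isPar_update_one j hg),
    mulSign_single]

theorem single_mul (i : Fin n) (f g : A) :
    single 𝒜 n i (f * g) = single 𝒜 n i f * single 𝒜 n i g := by
  have : (LinearMap.mul k A).compr₂ (singleLin (𝒜 := 𝒜) i) =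
      (superMul 𝒜 n).compl₁₂ (singleLin i) (singleLin i) := by
    refine bilin_ext_par 𝒜 fun ε η f g hf hg => ?_
    change single 𝒜 n i (f * g) = single 𝒜 n i f * single 𝒜 n i g
    rw [single_mul_single_of_par hf hg, if_neg (lt_irrefl _), paritySign_zero, one_smul, single]
    congr 1
    funext j
    rcases eq_or_ne j i with rfl | h <;> simp_all
  exact LinearMap.congr_fun (LinearMap.congr_fun this f) g

theorem single_commute {i j : Fin n} (hij : i ≠ j) {ε η : ZMod 2} {f g : A} (hf : IsPar 𝒜 ε f)
    (hg : IsPar 𝒜 η g) : single 𝒜 n i f * single 𝒜 n j g =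
      paritySign (ε * η) • (single 𝒜 n j g * single 𝒜 n i f) := by
  rw [single_mul_single_of_par hf hg, single_mul_single_of_par hg hf, smul_smul]
  have h1 : Function.update (1 : Fin n → A) i f * Function.update (1 : Fin n → A) j g =
      Function.update (1 : Fin n → A) j g * Function.update (1 : Fin n → A) i f := by
    funext l
    rcases eq_or_ne l i with rfl | h
    · simp [hij]
    · simp [h]
  rw [h1]
  congr 1
  rcases hij.lt_or_gt with h | h
  · rw [if_neg h.asymm, if_pos h, paritySign_zero, mul_comm η, paritySign_mul_self]
  · rw [if_neg h.asymm, if_pos h, paritySign_zero, mul_one]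

theorem perm_single (π : Perm (Fin n)) (i : Fin n) (f : A) :
    perm 𝒜 n π (single 𝒜 n i f) = single 𝒜 n (π i) f := by
  have : perm 𝒜 n π ∘ₗ singleLin i = singleLin (𝒜 := 𝒜) (π i) := by
    ext f
    rw [← sum_parityProj (𝒜 := 𝒜) f, map_sum, map_sum]
    refine Finset.sum_congr rfl fun ε _ => ?_
    change perm 𝒜 n π (single 𝒜 n i _) = single 𝒜 n (π i) _
    rw [single, perm_pure π (isPar_update_one i (isPar_proj ε f)), permSign_single, one_smul, single]
    congr 1
    funext j
    by_cases h : j = π i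
    · subst h; simp
    · rw [Function.update_of_ne h, Function.update_of_ne]
      · rfl
      · rintro rfl; simp at h
  exact LinearMap.congr_fun this f

/-- A pure tensor with factors of definite parity is, up to sign, a product of its factors placed
one position at a time, and such tensors span. -/
theorem adjoin_single : Algebra.adjoin k
    {a : SuperTensorPower 𝒜 n | ∃ i f, a = single 𝒜 n i f} = ⊤ := by
  set S := Algebra.adjoin k {a : SuperTensorPower 𝒜 n | ∃ i f, a = single 𝒜 n i f} with hS
  have key : ∀ (ε : Fin n → ZMod 2) f, (∀ i, IsPar 𝒜 (ε i) (f i)) → ∀ s : Finset (Fin n),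
      pure 𝒜 n (s.piecewise f 1) ∈ S := by
    intro ε f hf s
    induction s using Finset.induction_on with
    | empty => rw [Finset.piecewise_empty]; exact one_mem S
    | insert i s hi ih =>
      have h1 : ∀ j, IsPar 𝒜 (s.piecewise ε 0 j) (s.piecewise f 1 j) := by
        intro j
        by_cases hj : j ∈ s
        · simpa [hj] using hf j
        · simpa [hj] using isPar_one
      have h2 := pure_mul_pure h1 (isPar_update_one i (hf i))
      have h3 : s.piecewise f 1 * Function.update (1 : Fin n → A) i (f i) =
          (insert i s).piecewise f 1 := by
        funext j
        rcases eq_or_ne j i with rfl | h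
        · simp [hi]
        · simp [h, Finset.piecewise]
      rw [h3] at h2
      have h4 : pure 𝒜 n ((insert i s).piecewise f 1) =
          mulSign (s.piecewise ε 0) (Pi.single i (ε i)) •
            (pure 𝒜 n (s.piecewise f 1) * single 𝒜 n i (f i)) := by
        rw [single, h2, smul_smul, mulSign, paritySign_mul_self, one_smul]
      rw [h4]
      exact zsmul_mem (mul_mem ih (Algebra.subset_adjoin ⟨i, f i, rfl⟩)) _
  rw [eq_top_iff]
  intro a _
  have h : (Subalgebra.toSubmodule S).mkQ = 0 := by
    refine ext_par fun ε f hf => ?_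
    rw [LinearMap.zero_apply, Submodule.mkQ_apply, Submodule.Quotient.mk_eq_zero]
    have := key ε f hf Finset.univ
    rwa [Finset.piecewise_univ] at this
  have := LinearMap.congr_fun h a
  rwa [LinearMap.zero_apply, Submodule.mkQ_apply, Submodule.Quotient.mk_eq_zero] at this

theorem single_induction {p : SuperTensorPower 𝒜 n → Prop} (smul_one : ∀ r : k, p (r • 1))
    (single : ∀ i ε f, IsPar 𝒜 ε f → p (single 𝒜 n i f)) (add : ∀ a b, p a → p b → p (a + b))
    (mul : ∀ a b, p a → p b → p (a * b)) (a : SuperTensorPower 𝒜 n) : p a := by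
  have ha : a ∈ Algebra.adjoin k {a : SuperTensorPower 𝒜 n | ∃ i f, a = .single 𝒜 n i f} := by
    rw [adjoin_single]; trivial
  induction ha using Algebra.adjoin_induction with
  | mem a ha =>
    obtain ⟨i, f, rfl⟩ := ha
    have h0 : p 0 := by simpa using smul_one 0
    rw [← sum_parityProj (𝒜 := 𝒜) f]
    change p (singleLin i (∑ ε, parityProj 𝒜 ε f))
    rw [map_sum]
    exact Finset.sum_induction _ p add h0 fun ε _ => single i ε _ (isPar_proj ε f)
  | algebraMap r => rw [Algebra.algebraMap_eq_smul_one]; exact smul_one r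
  | add a b _ _ ha hb => exact add a b ha hb
  | mul a b _ _ ha hb => exact mul a b ha hb

theorem algHom_ext {M : Type w} [Ring M] [Algebra k M] {p q : SuperTensorPower 𝒜 n →ₐ[k] M}
    (h : ∀ i f, p (single 𝒜 n i f) = q (single 𝒜 n i f)) : p = q := by
  refine AlgHom.ext_of_adjoin_eq_top adjoin_single ?_
  rintro _ ⟨i, f, rfl⟩
  exact h i f

theorem perm_one' (π : Perm (Fin n)) : perm 𝒜 n π 1 = 1 := by
  rw [one_eq, perm_pure (ε := 0) (f := 1) π fun _ => isPar_one, permSign]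
  simp only [Pi.zero_apply, mul_zero, ite_self, Finset.sum_const_zero, paritySign_zero, one_smul]
  rfl

/-- Superpermutation as an algebra endomorphism. -/
def permHom (π : Perm (Fin n)) : SuperTensorPower 𝒜 n →ₐ[k] SuperTensorPower 𝒜 n :=
  AlgHom.ofLinearMap (perm 𝒜 n π) (perm_one' π) (perm_mul π)

/-- Both sides are algebra homomorphisms agreeing on the elements `f_i`, which superpermutation
moves without sign. No cocycle identity for `permSign` is needed. -/
theorem perm_perm (π σ : Perm (Fin n)) (a : SuperTensorPower 𝒜 n) :
    perm 𝒜 n (π * σ) a = perm 𝒜 n π (perm 𝒜 n σ a) := by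
  have : permHom (𝒜 := 𝒜) (π * σ) = (permHom π).comp (permHom σ) := by
    refine algHom_ext fun i f => ?_
    change perm 𝒜 n (π * σ) _ = perm 𝒜 n π (perm 𝒜 n σ _)
    rw [perm_single, perm_single, perm_single, Perm.mul_apply]
  exact DFunLike.congr_fun this a

theorem perm_id (a : SuperTensorPower 𝒜 n) : perm 𝒜 n 1 a = a := by
  have : permHom (𝒜 := 𝒜) (1 : Perm (Fin n)) = AlgHom.id k _ := by
    refine algHom_ext fun i f => ?_
    change perm 𝒜 n 1 _ = _
    rw [perm_single]; rfl
  exact DFunLike.congr_fun this a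

instance : MulSemiringAction (Perm (Fin n)) (SuperTensorPower 𝒜 n) where
  smul π a := perm 𝒜 n π a
  one_smul := perm_id
  mul_smul := perm_perm
  smul_zero π := map_zero (perm 𝒜 n π)
  smul_add π := map_add (perm 𝒜 n π)
  smul_one := perm_one'
  smul_mul := perm_mul

instance : SMulCommClass (Perm (Fin n)) k (SuperTensorPower 𝒜 n) where
  smul_comm π r a := map_smul (perm 𝒜 n π) r a

end SuperTensorPower

end

/-! ### Twists of tensor powers, and the Nakayama automorphism and dual bases of the Frobenius
algebra -/

section

open Equiv

variable {k : Type u} {A : Type v} [CommRing k] [Ring A] [Algebra k A]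

namespace SuperTensorPower

variable {𝒜 : ℕ × ZMod 2 → Submodule k A} [GradedAlgebra 𝒜] {n : ℕ}

/-- Tensor products of parity-preserving algebra automorphisms. -/
def mapEquiv (g : Fin n → A ≃ₐ[k] A)
    (hg : ∀ i ε a, IsPar 𝒜 ε a → IsPar 𝒜 ε (g i a)) :
    SuperTensorPower 𝒜 n ≃ₐ[k] SuperTensorPower 𝒜 n :=
  AlgEquiv.ofLinearEquiv
    (LinearEquiv.ofLinearMap (map 𝒜 n fun i => (g i).toLinearMap)
      (map 𝒜 n fun i => (g i).symm.toLinearMap)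
      (hom_ext fun f => by simp) (hom_ext fun f => by simp))
    (by
      change map 𝒜 n _ (pure 𝒜 n 1) = pure 𝒜 n 1
      rw [map_pure]
      congr 1
      funext i
      simp)
    (by
      intro a b
      change map 𝒜 n (fun i => (g i).toLinearMap) (a * b) =
        map 𝒜 n (fun i => (g i).toLinearMap) a * map 𝒜 n (fun i => (g i).toLinearMap) b
      have : (superMul 𝒜 n).compr₂ (map 𝒜 n fun i => (g i).toLinearMap) =
          (superMul 𝒜 n).compl₁₂ (map 𝒜 n fun i => (g i).toLinearMap)
            (map 𝒜 n fun i => (g i).toLinearMap) := by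
        refine ext_par fun ε f hf => ext_par fun η h hh => ?_
        change map 𝒜 n (fun i => (g i).toLinearMap) (pure 𝒜 n f * pure 𝒜 n h) =
          map 𝒜 n (fun i => (g i).toLinearMap) (pure 𝒜 n f) *
            map 𝒜 n (fun i => (g i).toLinearMap) (pure 𝒜 n h)
        rw [pure_mul_pure hf hh, map_zsmul, map_pure, map_pure, map_pure]
        refine Eq.trans ?_ (pure_mul_pure (fun i => hg i _ _ (hf i))
          (fun i => hg i _ _ (hh i))).symm
        congr 2
        funext i
        simp
      exact LinearMap.congr_fun (LinearMap.congr_fun this a) b)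

theorem mapEquiv_apply (g : Fin n → A ≃ₐ[k] A) (hg) (a : SuperTensorPower 𝒜 n) :
    mapEquiv g hg a = map 𝒜 n (fun i => (g i).toLinearMap) a := rfl

theorem mapEquiv_pure (g : Fin n → A ≃ₐ[k] A) (hg) (f : Fin n → A) :
    mapEquiv (𝒜 := 𝒜) g hg (pure 𝒜 n f) = pure 𝒜 n fun i => g i (f i) := by
  rw [mapEquiv_apply, map_pure]; rfl

theorem map_single {g : Fin n → A →ₗ[k] A} (hg : ∀ i, g i 1 = 1) (i : Fin n) (f : A) :
    map 𝒜 n g (single 𝒜 n i f) = single 𝒜 n i (g i f) := by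
  rw [single, map_pure, single]
  congr 1
  funext j
  rcases eq_or_ne j i with rfl | h
  · simp
  · simp [h, hg]

theorem mapAt_single (i : Fin n) {ψ : A →ₗ[k] A} (hψ : ψ 1 = 1) (j : Fin n) (f : A) :
    mapAt 𝒜 n i ψ (single 𝒜 n j f) = single 𝒜 n j (if j = i then ψ f else f) := by
  rw [mapAt, map_single]
  · congr 1
    rcases eq_or_ne j i with rfl | h
    · simp
    · simp [h]
  · intro l
    rcases eq_or_ne l i with rfl | h
    · simpa using hψ
    · simp [h]

end SuperTensorPower

section Frobenius

variable {𝒜 : ℕ × ZMod 2 → Submodule k A} [GradedAlgebra 𝒜] {δ : ℕ} {tr : A →ₗ[k] k}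
  (hF : IsFrobenius 𝒜 δ tr)

include hF in
theorem IsFrobenius.tr_eq_zero {ε : ZMod 2} {a : A} (ha : IsPar 𝒜 ε a) (hε : ε ≠ 0) : tr a = 0 := by
  rw [← ha, hF.tr_proj, if_neg hε]

include hF in
theorem IsFrobenius.tr_mul_eq_zero {ε η : ZMod 2} {a b : A} (ha : IsPar 𝒜 ε a)
    (hb : IsPar 𝒜 η b) (h : ε ≠ η) : tr (a * b) = 0 := by
  rw [← ha, ← hb, hF.tr_mul_proj, if_neg h]

theorem tr_mul_nakayama {ε η : ZMod 2} {a b : A} (ha : IsPar 𝒜 ε a) (hb : IsPar 𝒜 η b) :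
    tr (a * b) = paritySign (ε * η) • tr (b * nakayama hF a) := by
  rw [isNakayama_nakayama hF a b, signed_nakayama, Finset.sum_eq_single ε,
    Finset.sum_eq_single η, ha, hb]
  · intro x _ hx; rw [hb.proj, if_neg hx, zero_mul, map_zero, smul_zero]
  · simp
  · intro x _ hx
    refine Finset.sum_eq_zero fun y _ => ?_
    rw [ha.proj, if_neg hx, map_zero, mul_zero, map_zero, smul_zero]
  · simp

theorem tr_nakayama (a : A) : tr (nakayama hF a) = tr a := by
  rw [← sum_parityProj (𝒜 := 𝒜) a, map_sum, map_sum, map_sum]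
  refine Finset.sum_congr rfl fun ε _ => ?_
  have := tr_mul_nakayama hF (isPar_proj (𝒜 := 𝒜) ε a) isPar_one
  rwa [mul_one, mul_zero, paritySign_zero, one_smul, one_mul, eq_comm] at this

/-- A component of `ψ(a)` in a wrong degree can pair nontrivially only with elements `b` of the
complementary degree, where its pairing is that of `ψ(a)` itself, namely `± tr (a b)`. This is zero
by degree, and the trace form is nondegenerate. -/
theorem nakayama_mem {p : ℕ × ZMod 2} {a : A} (ha : a ∈ 𝒜 p) : nakayama hF a ∈ 𝒜 p := by
  classical
  have key : ∀ q, q ≠ p → (DirectSum.decompose 𝒜 (nakayama hF a) q : A) = 0 := by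
    intro q hq
    refine hF.eq_of_tr_mul fun c => ?_
    rw [mul_zero, map_zero]
    induction c using DirectSum.Decomposition.inductionOn 𝒜 with
    | zero => simp
    | @homogeneous r b =>
      obtain ⟨b, hb⟩ := b
      change tr (b * _) = 0
      by_cases hr : r + q = (δ, 0)
      · have h1 : tr (b * nakayama hF a) = 0 := by
          have h2 := tr_mul_nakayama hF (isPar_of_mem ha) (isPar_of_mem hb)
          have h3 : tr (a * b) = 0 := by
            refine hF.homogeneous (p + r) ?_ _ (SetLike.mul_mem_graded ha hb)
            intro h; rw [add_comm, ← hr] at h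
            exact hq (add_left_cancel h).symm
          rw [h3] at h2
          have h4 := congrArg (fun z => paritySign (p.2 * r.2) • z) h2
          simp only [smul_zero, smul_smul, paritySign_mul_self, one_smul] at h4
          exact h4.symm
        rw [← DirectSum.sum_support_decompose 𝒜 (nakayama hF a), Finset.mul_sum, map_sum] at h1
        by_cases hq' : q ∈ (DirectSum.decompose 𝒜 (nakayama hF a)).support
        · rwa [Finset.sum_eq_single_of_mem q hq'] at h1
          intro s _ hs
          refine hF.homogeneous (r + s) ?_ _ (SetLike.mul_mem_graded hb (SetLike.coe_mem _))
          intro h; rw [← hr] at h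
          exact hs (add_left_cancel h)
        · rw [DFinsupp.notMem_support_iff.1 hq']; simp
      · exact hF.homogeneous _ hr _ (SetLike.mul_mem_graded hb (SetLike.coe_mem _))
    | add a b ha hb => rw [add_mul, map_add, ha, hb, add_zero]
  rw [← DirectSum.sum_support_decompose 𝒜 (nakayama hF a)]
  refine Submodule.sum_mem _ fun q _ => ?_
  by_cases hq : q = p
  · rw [hq]; exact SetLike.coe_mem _
  · rw [key q hq]; exact zero_mem _

theorem parityProj_nakayama (ε : ZMod 2) (a : A) :
    parityProj 𝒜 ε (nakayama hF a) = nakayama hF (parityProj 𝒜 ε a) := by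
  induction a using DirectSum.Decomposition.inductionOn 𝒜 with
  | zero => simp
  | @homogeneous p m =>
    rw [parityProj_of_mem _ m.2, parityProj_of_mem _ (nakayama_mem hF m.2)]
    split_ifs <;> simp
  | add a b ha hb => simp only [map_add, ha, hb]

theorem IsPar.nakayama {ε : ZMod 2} {a : A} (ha : IsPar 𝒜 ε a) :
    IsPar 𝒜 ε (nakayama hF a) := by
  rw [IsPar, parityProj_nakayama, ha]

theorem IsPar.nakayama_symm {ε : ZMod 2} {a : A} (ha : IsPar 𝒜 ε a) :
    IsPar 𝒜 ε ((AffineWreath.nakayama hF).symm a) := by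
  apply (AffineWreath.nakayama hF).injective
  rw [← parityProj_nakayama, AlgEquiv.apply_symm_apply, ha]

theorem IsPar.nakayama_pow {ε : ZMod 2} {a : A} (ha : IsPar 𝒜 ε a) (m : ℕ) :
    IsPar 𝒜 ε ((AffineWreath.nakayama hF ^ m) a) := by
  induction m with
  | zero => simpa using ha
  | succ m ih => rw [pow_succ', AlgEquiv.mul_apply]; exact ih.nakayama hF

variable {ι : Type w} [Fintype ι] (B : Module.Basis ι k A)

theorem tr_leftDual_mul_apply (b : ι) (x : A) : tr (leftDual hF B b * x) = B.repr x b :=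
  LinearMap.congr_fun ((LinearEquiv.ofBijective _ hF.bijective_mul).apply_symm_apply (B.coord b)) x

theorem sum_leftDual_left (x : A) : ∑ b, tr (leftDual hF B b * x) • B b = x := by
  simp_rw [tr_leftDual_mul_apply]
  exact B.sum_repr x

theorem sum_leftDual_right (x : A) : ∑ b, tr (x * B b) • leftDual hF B b = x := by
  apply hF.bijective_mul.1
  refine B.ext fun c => ?_
  classical
  rw [map_sum, LinearMap.sum_apply, Finset.sum_eq_single c]
  · rw [map_smul, LinearMap.smul_apply]
    change _ • tr (leftDual hF B c * B c) = tr (x * B c)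
    rw [tr_leftDual_mul, if_pos rfl, smul_eq_mul, mul_one]
  · intro b _ hb
    rw [map_smul, LinearMap.smul_apply]
    change _ • tr (leftDual hF B b * B c) = 0
    rw [tr_leftDual_mul, if_neg hb, smul_zero]
  · simp

include hF in
theorem IsFrobenius.tr_decompose_mul {q r : ℕ × ZMod 2} (h : q + r = (δ, 0)) (a : A) {c : A}
    (hc : c ∈ 𝒜 r) : tr ((DirectSum.decompose 𝒜 a q : A) * c) = tr (a * c) := by
  classical
  conv_rhs => rw [← DirectSum.sum_support_decompose 𝒜 a, Finset.sum_mul, map_sum]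
  have key : ∀ s, s ≠ q → tr ((DirectSum.decompose 𝒜 a s : A) * c) = 0 := by
    intro s hs
    refine hF.homogeneous (s + r) ?_ _ (SetLike.mul_mem_graded (SetLike.coe_mem _) hc)
    intro h'; rw [← h] at h'
    exact hs (add_right_cancel h')
  by_cases hq : q ∈ (DirectSum.decompose 𝒜 a).support
  · rw [Finset.sum_eq_single_of_mem q hq fun s _ hs => key s hs]
  · rw [Finset.sum_eq_zero fun s hs => key s (by rintro rfl; exact hq hs),
      DFinsupp.notMem_support_iff.1 hq]
    simp

/-- Each component pairs to zero with every basis element: unless degrees are complementary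
homogeneity applies, and otherwise duality allows only `b` itself, whose degree is excluded. -/
theorem leftDual_decompose (hB : ∀ b, ∃ p, B b ∈ 𝒜 p) {b : ι} {p : ℕ × ZMod 2} (hb : B b ∈ 𝒜 p)
    {q : ℕ × ZMod 2} (hq : q + p ≠ (δ, 0)) :
    (DirectSum.decompose 𝒜 (leftDual hF B b) q : A) = 0 := by
  classical
  apply hF.bijective_mul.1
  refine B.ext fun c => ?_
  change tr (_ * B c) = tr (0 * B c)
  rw [zero_mul, map_zero]
  obtain ⟨r, hr⟩ := hB c
  by_cases h : q + r = (δ, 0)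
  · rw [hF.tr_decompose_mul h _ hr, tr_leftDual_mul]
    split_ifs with hbc
    · subst hbc
      by_cases h0 : B b = 0
      · have := tr_leftDual_mul hF B b b
        rwa [h0, mul_zero, map_zero, if_pos rfl, eq_comm] at this
      · exact absurd (by rw [DirectSum.degree_eq_of_mem_mem 𝒜 hb hr h0]; exact h) hq
    · rfl
  · exact hF.homogeneous _ h _ (SetLike.mul_mem_graded (SetLike.coe_mem _) hr)

theorem isPar_leftDual (hB : ∀ b, ∃ p, B b ∈ 𝒜 p) {b : ι} {p : ℕ × ZMod 2} (hb : B b ∈ 𝒜 p) :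
    IsPar 𝒜 p.2 (leftDual hF B b) := by
  classical
  rw [IsPar, ← DirectSum.sum_support_decompose 𝒜 (leftDual hF B b), map_sum]
  refine Finset.sum_congr rfl fun q _ => ?_
  by_cases hq : q + p = (δ, 0)
  · have h2 : p.2 = q.2 := by
      have h3 : q.2 + p.2 = 0 := congrArg Prod.snd hq
      generalize p.2 = x at *
      generalize q.2 = y at *
      revert x y; decide
    rw [h2]
    exact isPar_of_mem (SetLike.coe_mem _)
  · rw [leftDual_decompose hF B hB hb hq, map_zero]

variable {M : Type*} [AddCommGroup M] [Module k M] (φ : A →ₗ[k] A →ₗ[k] M)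

/-- The Casimir property of `∑ b ⊗ b^∨`: expanding each side in the basis or its dual gives the same
matrix of `a`. -/
theorem sum_dual_mul_left (a : A) :
    ∑ b, φ (a * B b) (leftDual hF B b) = ∑ b, φ (B b) (leftDual hF B b * a) := by
  have h1 : ∀ b, φ (a * B b) (leftDual hF B b) =
      ∑ c, tr (leftDual hF B c * a * B b) • φ (B c) (leftDual hF B b) := fun b => by
    conv_lhs => rw [← sum_leftDual_left hF B (a * B b)]
    simp only [map_sum, LinearMap.sum_apply, map_smul, LinearMap.smul_apply, mul_assoc]
  have h2 : ∀ c, φ (B c) (leftDual hF B c * a) =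
      ∑ b, tr (leftDual hF B c * a * B b) • φ (B c) (leftDual hF B b) := fun c => by
    conv_lhs => rw [← sum_leftDual_right hF B (leftDual hF B c * a)]
    simp only [map_sum, map_smul]
  simp_rw [h1, h2]
  exact Finset.sum_comm

variable {par : ι → ZMod 2} (hpar : ∀ b, IsPar 𝒜 (par b) (B b))
  (hpar' : ∀ b, IsPar 𝒜 (par b) (leftDual hF B b))

-- Expanding each `b` in the dual basis and moving the trace around with `ψ` exchanges the roles of
-- the basis and its dual. This is the source of `Ψ_j t_{i,j} = t_{j,i}`.
include hpar in
theorem sum_dual_nakayama :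
    ∑ b, φ (B b) (nakayama hF (leftDual hF B b)) =
      ∑ b, paritySign (par b) • φ (leftDual hF B b) (B b) := by
  have h1 : ∀ b, φ (B b) (nakayama hF (leftDual hF B b)) =
      ∑ c, tr (B b * B c) • φ (leftDual hF B c) (nakayama hF (leftDual hF B b)) := fun b => by
    conv_lhs => rw [← sum_leftDual_right hF B (B b)]
    simp only [map_sum, LinearMap.sum_apply, map_smul, LinearMap.smul_apply]
  have h2 : ∀ c, ∑ b, tr (B b * B c) • nakayama hF (leftDual hF B b) =
      paritySign (par c) • B c := fun c => by
    have h3 : ∀ b, tr (B b * B c) =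
        paritySign (par c) • tr ((nakayama hF).symm (B c) * B b) := fun b => by
      by_cases hbc : par b = par c
      · rw [tr_mul_nakayama hF ((hpar c).nakayama_symm hF) (hpar b), AlgEquiv.apply_symm_apply,
          hbc, smul_smul, show par c * par c = par c by generalize par c = x; revert x; decide,
          paritySign_mul_self, one_smul]
      · rw [hF.tr_mul_eq_zero (hpar b) (hpar c) hbc,
          hF.tr_mul_eq_zero ((hpar c).nakayama_symm hF) (hpar b) (Ne.symm hbc), smul_zero]
    simp_rw [h3, smul_assoc, ← Finset.smul_sum, ← map_smul (nakayama hF), ← map_sum (nakayama hF)]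
    rw [sum_leftDual_right, AlgEquiv.apply_symm_apply]
  simp_rw [h1]
  rw [Finset.sum_comm]
  refine Finset.sum_congr rfl fun c _ => ?_
  rw [← map_zsmul, ← h2 c, map_sum]
  simp_rw [map_smul]

-- Here `a` enters on the left of the dual, so closing up the trace moves it cyclically and leaves a
-- Nakayama twist and a sign. The signs `α * par b` on both sides are those of the supercommutation
-- used in `single_mul_teleporter_right`.
include hpar hpar' in
theorem sum_dual_mul_right {α : ZMod 2} {a : A} (ha : IsPar 𝒜 α a) :
    ∑ b, paritySign (α * par b) • φ (B b) (a * leftDual hF B b) =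
      ∑ b, paritySign (α * par b) • φ (B b * nakayama hF a) (leftDual hF B b) := by
  have h1 : ∀ b, φ (B b) (a * leftDual hF B b) =
      ∑ c, tr (a * leftDual hF B b * B c) • φ (B b) (leftDual hF B c) := fun b => by
    conv_lhs => rw [← sum_leftDual_right hF B (a * leftDual hF B b)]
    simp only [map_sum, map_smul]
  have h2 : ∀ c, φ (B c * nakayama hF a) (leftDual hF B c) =
      ∑ b, tr (leftDual hF B b * (B c * nakayama hF a)) • φ (B b) (leftDual hF B c) := fun c => by
    conv_lhs => rw [← sum_leftDual_left hF B (B c * nakayama hF a)]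
    simp only [map_sum, LinearMap.sum_apply, map_smul, LinearMap.smul_apply]
  simp_rw [h1, h2, Finset.smul_sum]
  rw [Finset.sum_comm]
  refine Finset.sum_congr rfl fun c _ => Finset.sum_congr rfl fun b _ => ?_
  rw [mul_assoc, tr_mul_nakayama hF ha ((hpar' b).mul (hpar c)), ← mul_assoc, smul_assoc, smul_smul,
    ← paritySign_add]
  congr 2
  generalize par b = x
  generalize par c = y
  revert α x y
  intro α _ x y; clear * -
  revert α x y; decide

end Frobenius

end

/-! ### The super tensor power as wreath data, and the symmetry of its trace -/

section

open Equiv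

variable {k : Type u} {A : Type v} [CommRing k] [Ring A] [Algebra k A]

section Frobenius

variable {𝒜 : ℕ × ZMod 2 → Submodule k A} [GradedAlgebra 𝒜] {δ : ℕ} {tr : A →ₗ[k] k}
  (hF : IsFrobenius 𝒜 δ tr) {ι : Type w} [Fintype ι] (B : Module.Basis ι k A)
  (hB : ∀ b, ∃ p, B b ∈ 𝒜 p) (n : ℕ)

namespace SuperTensorPower

/-- The Nakayama automorphism in the `i`-th factor. -/
def twist (i : Fin n) : SuperTensorPower 𝒜 n ≃ₐ[k] SuperTensorPower 𝒜 n :=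
  mapEquiv (Function.update 1 i (nakayama hF)) fun j ε a ha => by
    rcases eq_or_ne j i with rfl | h
    · simpa using ha.nakayama hF
    · simpa [h] using ha

variable {n}

theorem twist_eq_mapAt (i : Fin n) (f : SuperTensorPower 𝒜 n) :
    twist hF n i f = mapAt 𝒜 n i (nakayama hF).toLinearMap f := by
  rw [twist, mapEquiv_apply, mapAt]
  congr 2
  funext j
  rcases eq_or_ne j i with rfl | h
  · simp
  · simp [h]; rfl

theorem twist_single (i j : Fin n) (f : A) :
    twist hF n i (single 𝒜 n j f) = single 𝒜 n j (if j = i then nakayama hF f else f) := by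
  rw [twist_eq_mapAt, mapAt_single _ (map_one (nakayama hF))]
  rfl

/-- The bilinear map `(f, g) ↦ f_i g_j`. -/
def singleMul (i j : Fin n) : A →ₗ[k] A →ₗ[k] SuperTensorPower 𝒜 n :=
  (superMul 𝒜 n).compl₁₂ (singleLin i) (singleLin j)

theorem singleMul_apply (i j : Fin n) (f g : A) :
    singleMul (𝒜 := 𝒜) i j f g = single 𝒜 n i f * single 𝒜 n j g := rfl

theorem perm_teleporter (π : Perm (Fin n)) (i j : Fin n) :
    perm 𝒜 n π (teleporter hF B n i j) = teleporter hF B n (π i) (π j) := by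
  simp only [teleporter, map_sum, perm_mul, perm_single]

theorem single_mul_teleporter_left (i j : Fin n) (a : A) :
    single 𝒜 n i a * teleporter hF B n i j = teleporter hF B n i j * single 𝒜 n j a := by
  have := sum_dual_mul_left hF B (singleMul (𝒜 := 𝒜) i j) a
  simp only [singleMul_apply, single_mul] at this
  rw [teleporter, Finset.mul_sum, Finset.sum_mul]
  simpa only [mul_assoc] using this

section

variable {par : ι → ZMod 2} (hpar : ∀ b, IsPar 𝒜 (par b) (B b))
  (hpar' : ∀ b, IsPar 𝒜 (par b) (leftDual hF B b))

include hpar hpar'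

theorem single_mul_teleporter_right {i j : Fin n} (hij : i ≠ j) {α : ZMod 2} {a : A}
    (ha : IsPar 𝒜 α a) : single 𝒜 n j a * teleporter hF B n i j =
      teleporter hF B n i j * single 𝒜 n i (nakayama hF a) := by
  have := sum_dual_mul_right hF B (singleMul (𝒜 := 𝒜) i j) hpar hpar' ha
  rw [teleporter, Finset.mul_sum, Finset.sum_mul]
  convert this using 2 with b _ b _
  · rw [← mul_assoc, single_commute hij.symm ha (hpar b), smul_mul_assoc, singleMul_apply,
      single_mul, mul_assoc]
  · rw [mul_assoc, single_commute hij.symm (hpar' b) (ha.nakayama hF), mul_smul_comm,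
      singleMul_apply, single_mul, mul_assoc, mul_comm α]

theorem single_mul_teleporter_of_ne {i j l : Fin n} (hi : l ≠ i) (hj : l ≠ j) {α : ZMod 2} {a : A}
    (ha : IsPar 𝒜 α a) :
    single 𝒜 n l a * teleporter hF B n i j = teleporter hF B n i j * single 𝒜 n l a := by
  rw [teleporter, Finset.mul_sum, Finset.sum_mul]
  refine Finset.sum_congr rfl fun b _ => ?_
  rw [← mul_assoc, single_commute hi ha (hpar b), smul_mul_assoc, mul_assoc,
    single_commute hj ha (hpar' b), mul_smul_comm, smul_smul, paritySign_mul_self, one_smul,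
    mul_assoc]

theorem twist_teleporter {i j : Fin n} (hij : i ≠ j) :
    twist hF n j (teleporter hF B n i j) = teleporter hF B n j i := by
  have := sum_dual_nakayama hF B (singleMul (𝒜 := 𝒜) i j) hpar
  rw [teleporter, map_sum, teleporter]
  simp only [map_mul, twist_single, if_neg hij, if_true]
  refine this.trans (Finset.sum_congr rfl fun b _ => ?_)
  rw [singleMul_apply, single_commute hij (hpar' b) (hpar b), smul_smul,
    show par b * par b = par b by generalize par b = x; revert x; decide, paritySign_mul_self,
    one_smul]

end

theorem twist_teleporter_of_ne {l i j : Fin n} (hi : l ≠ i) (hj : l ≠ j) :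
    twist hF n l (teleporter hF B n i j) = teleporter hF B n i j := by
  simp only [teleporter, map_sum, map_mul, twist_single, if_neg hi.symm, if_neg hj.symm]

include hB in
theorem exists_parity : ∃ par : ι → ZMod 2, (∀ b, IsPar 𝒜 (par b) (B b)) ∧
    ∀ b, IsPar 𝒜 (par b) (leftDual hF B b) := by
  choose p hp using hB
  exact ⟨fun b => (p b).2, fun b => isPar_of_mem (hp b),
    fun b => isPar_leftDual hF B (fun b => ⟨p b, hp b⟩) (hp b)⟩

end SuperTensorPower

open SuperTensorPower

/-- The super tensor powers satisfy the axioms on which the affine wreath product is built. -/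
def wreathData : WreathData k (SuperTensorPower 𝒜 n) n where
  Ψ := twist hF n
  t := teleporter hF B n
  Ψ_comm i j f := by
    have : (twist hF n i).toAlgHom.comp (twist hF n j).toAlgHom =
        (twist hF n j).toAlgHom.comp (twist hF n i).toAlgHom := by
      refine SuperTensorPower.algHom_ext fun l f => ?_
      change twist hF n i (twist hF n j _) = twist hF n j (twist hF n i _)
      simp only [twist_single]
      split_ifs <;> rfl
    exact DFunLike.congr_fun this f
  smul_Ψ π i f := by
    have : (permHom π).comp (twist hF n i).toAlgHom =
        (twist hF n (π i)).toAlgHom.comp (permHom π) := by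
      refine SuperTensorPower.algHom_ext fun l f => ?_
      change perm 𝒜 n π (twist hF n i _) = twist hF n (π i) (perm 𝒜 n π _)
      simp only [twist_single, perm_single, π.injective.eq_iff]
    exact DFunLike.congr_fun this f
  smul_t := perm_teleporter hF B
  mul_t i j f hij := by
    obtain ⟨par, hpar, hpar'⟩ := exists_parity hF B hB
    change f * _ = _ * twist hF n i (perm 𝒜 n (swap i j) f)
    -- The identity is multiplicative in `f`, so it is enough to treat a single factor: in position
    -- `i`, in position `j`, or elsewhere.
    induction f using single_induction with
    | smul_one r => rw [map_smul, map_smul, perm_one', map_one, smul_one_mul, mul_smul_one]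
    | single l ε a ha =>
      rw [perm_single, twist_single]
      by_cases hi : l = i
      · subst hi
        rw [swap_apply_left, if_neg hij.symm, single_mul_teleporter_left]
      by_cases hj : l = j
      · subst hj
        rw [swap_apply_right, if_pos rfl, single_mul_teleporter_right hF B hpar hpar' hij ha]
      · rw [swap_apply_of_ne_of_ne hi hj, if_neg hi,
          single_mul_teleporter_of_ne hF B hpar hpar' hi hj ha]
    | add a b ha hb => rw [add_mul, ha, hb, map_add, map_add, mul_add]
    | mul a b ha hb => rw [mul_assoc, hb, ← mul_assoc, ha, perm_mul, map_mul, mul_assoc]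
  Ψ_t i j hij := by
    obtain ⟨par, hpar, hpar'⟩ := exists_parity hF B hB
    exact twist_teleporter hF B hpar hpar' hij
  Ψ_t_of_ne l i j hi hj := twist_teleporter_of_ne hF B hi hj

namespace SuperTensorPower

variable {n}

include hF in
theorem trace_pure_eq_zero {ε : Fin n → ZMod 2} {f : Fin n → A}
    (hf : ∀ i, IsPar 𝒜 (ε i) (f i)) (hε : ε ≠ 0) : trace 𝒜 n tr (pure 𝒜 n f) = 0 := by
  obtain ⟨i, hi⟩ := Function.ne_iff.1 hε
  rw [trace_pure, Finset.prod_eq_zero (Finset.mem_univ i)]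
  exact hF.tr_eq_zero (hf i) hi

include hF in
theorem trace_perm (π : Perm (Fin n)) (f : SuperTensorPower 𝒜 n) :
    trace 𝒜 n tr (perm 𝒜 n π f) = trace 𝒜 n tr f := by
  have : trace 𝒜 n tr ∘ₗ perm 𝒜 n π = trace 𝒜 n tr := by
    refine ext_par fun ε f hf => ?_
    rw [LinearMap.comp_apply, perm_pure π hf, map_zsmul]
    by_cases hε : ε = 0
    · subst hε
      have : permSign π (0 : Fin n → ZMod 2) = 1 := by simp [permSign, paritySign_zero]
      rw [this, one_smul, trace_pure, trace_pure]
      exact Equiv.prod_comp π.symm fun i => tr (f i)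
    · rw [trace_pure_eq_zero hF hf hε, trace_pure_eq_zero hF (fun i => hf (π.symm i)), smul_zero]
      intro h
      exact hε (funext fun i => by simpa using congrFun h (π i))
  exact LinearMap.congr_fun this f

theorem trace_map {g : Fin n → A →ₗ[k] A} (hg : ∀ i a, tr (g i a) = tr a)
    (f : SuperTensorPower 𝒜 n) : trace 𝒜 n tr (map 𝒜 n g f) = trace 𝒜 n tr f := by
  have : trace 𝒜 n tr ∘ₗ map 𝒜 n g = trace 𝒜 n tr := by
    refine hom_ext fun f => ?_
    rw [LinearMap.comp_apply, map_pure, trace_pure, trace_pure]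
    exact Finset.prod_congr rfl fun i _ => hg i _
  exact LinearMap.congr_fun this f

theorem trace_twist (i : Fin n) (f : SuperTensorPower 𝒜 n) :
    trace 𝒜 n tr (twist hF n i f) = trace 𝒜 n tr f := by
  rw [twist, mapEquiv_apply]
  refine trace_map (fun j a => ?_) f
  rcases eq_or_ne j i with rfl | h
  · simpa using tr_nakayama hF a
  · simp [h]

include hF in
theorem trace_pure_mul_pure {ε η : Fin n → ZMod 2} {f g : Fin n → A}
    (hf : ∀ i, IsPar 𝒜 (ε i) (f i)) (hg : ∀ i, IsPar 𝒜 (η i) (g i)) :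
    trace 𝒜 n tr (pure 𝒜 n f * pure 𝒜 n g) = mulSign η η • ∏ i, tr (f i * g i) := by
  rw [pure_mul_pure hf hg, map_zsmul, trace_pure]
  by_cases h : ε = η
  · rw [h]; rfl
  · obtain ⟨i, hi⟩ := Function.ne_iff.1 h
    have h0 : tr (f i * g i) = 0 := hF.tr_mul_eq_zero (hf i) (hg i) hi
    rw [Finset.prod_eq_zero (Finset.mem_univ i) h0,
      Finset.prod_eq_zero (f := fun i => tr (f i * g i)) (Finset.mem_univ i) h0, smul_zero, smul_zero]

/-- The parity involution of the tensor power. -/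
def inv (n : ℕ) (𝒜 : ℕ × ZMod 2 → Submodule k A) [GradedAlgebra 𝒜] :
    SuperTensorPower 𝒜 n →ₗ[k] SuperTensorPower 𝒜 n :=
  map 𝒜 n fun _ => parityInv 𝒜

/-- An unsigned form of the Nakayama property. The trace of a product of parity-homogeneous pure
tensors vanishes unless the parities agree in every factor; then the reordering sign of the two
products is the same, and the sign in each factor is its own parity, which the involution absorbs.
-/
theorem trace_mul_comm (f g : SuperTensorPower 𝒜 n) : trace 𝒜 n tr (f * g) =
    trace 𝒜 n tr (g * inv n 𝒜 (map 𝒜 n (fun _ => (nakayama hF).toLinearMap) f)) := by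
  have : (superMul 𝒜 n).compr₂ (trace 𝒜 n tr) =
      (((superMul 𝒜 n).compr₂ (trace 𝒜 n tr)).compl₂
        (inv n 𝒜 ∘ₗ map 𝒜 n (fun _ => (nakayama hF).toLinearMap))).flip := by
    refine ext_par fun ε f hf => ext_par fun η g hg => ?_
    change trace 𝒜 n tr (pure 𝒜 n f * pure 𝒜 n g) = trace 𝒜 n tr (pure 𝒜 n g * inv n 𝒜
      (map 𝒜 n (fun _ => (nakayama hF).toLinearMap) (pure 𝒜 n f)))
    have hpar : ∀ i, IsPar 𝒜 (ε i) (parityInv 𝒜 (nakayama hF (f i))) := fun i => by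
      rw [((hf i).nakayama hF).parityInv, IsPar, map_zsmul, (hf i).nakayama hF]
    rw [map_pure, inv, map_pure, trace_pure_mul_pure hF hf hg]
    refine Eq.trans ?_ (trace_pure_mul_pure hF hg hpar).symm
    have h1 : ∀ i, tr (g i * parityInv 𝒜 (nakayama hF (f i))) = tr (f i * g i) := fun i => by
      rw [((hf i).nakayama hF).parityInv, mul_smul_comm, map_zsmul]
      by_cases h : ε i = η i
      · rw [tr_mul_nakayama hF (hf i) (hg i), ← h]
        congr 2
        generalize ε i = x; revert x; decide
      · rw [hF.tr_mul_eq_zero (hf i) (hg i) h,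
          hF.tr_mul_eq_zero (hg i) ((hf i).nakayama hF) (Ne.symm h), smul_zero]
    simp_rw [h1]
    by_cases h : ε = η
    · rw [h]
    · obtain ⟨i, hi⟩ := Function.ne_iff.1 h
      rw [Finset.prod_eq_zero (Finset.mem_univ i) (hF.tr_mul_eq_zero (hf i) (hg i) hi), smul_zero,
        smul_zero]
  exact LinearMap.congr_fun (LinearMap.congr_fun this f) g

end SuperTensorPower

end Frobenius

end

/-! ### Nondegeneracy of the tensor trace, and commutation with the cyclotomic coefficients -/

section

open Equiv

variable {k : Type u} {A : Type v} [CommRing k] [Ring A] [Algebra k A]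

section Frobenius

variable {𝒜 : ℕ × ZMod 2 → Submodule k A} [GradedAlgebra 𝒜] {δ : ℕ} {tr : A →ₗ[k] k}
  (hF : IsFrobenius 𝒜 δ tr) {ι : Type w} [Fintype ι] (B : Module.Basis ι k A)
  (hB : ∀ b, ∃ p, B b ∈ 𝒜 p) (n : ℕ)

namespace SuperTensorPower

/-- The basis of pure tensors of basis elements. -/
def basis : Module.Basis (Fin n → ι) k (SuperTensorPower 𝒜 n) :=
  Basis.piTensorProduct fun _ => B

variable {n}

theorem basis_apply (s : Fin n → ι) : basis (𝒜 := 𝒜) B n s = pure 𝒜 n fun i => B (s i) :=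
  Basis.piTensorProduct_apply _ _

theorem basis_repr (f : Fin n → A) (s : Fin n → ι) :
    (basis (𝒜 := 𝒜) B n).repr (pure 𝒜 n f) s = ∏ i, B.repr (f i) (s i) :=
  Basis.piTensorProduct_repr_tprod_apply _ _ _

-- The tensors of the elements `ψ(b^∨)` are dual, up to signs, to the basis of pure tensors: `ψ`
-- moves the dual element to the right of the basis element under the trace.
include hF hB in
theorem trace_exists_mul (φ : SuperTensorPower 𝒜 n →ₗ[k] k) :
    ∃ b, ∀ f, φ f = trace 𝒜 n tr (f * b) := by
  classical
  obtain ⟨par, hpar, hpar'⟩ := exists_parity hF B hB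
  let u : (Fin n → ι) → SuperTensorPower 𝒜 n := fun s =>
    pure 𝒜 n fun i => nakayama hF (leftDual hF B (s i))
  have hu : ∀ s s' : Fin n → ι, trace 𝒜 n tr (basis B n s' * u s) =
      if s' = s then mulSign (fun i => par (s i)) (fun i => par (s i)) *
        ∏ i, (paritySign (par (s i)) : k) else 0 := by
    intro s s'
    have h1 : ∀ i, tr (B (s' i) * nakayama hF (leftDual hF B (s i))) =
        if s' i = s i then (paritySign (par (s i)) : k) else 0 := by
      intro i
      have h2 := tr_mul_nakayama hF (hpar' (s i)) (hpar (s' i))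
      rw [tr_leftDual_mul] at h2
      have h3 := congrArg (fun z => paritySign (par (s i) * par (s' i)) • z) h2
      simp only [smul_smul, paritySign_mul_self, one_smul] at h3
      rw [← h3]
      by_cases h : s i = s' i
      · rw [if_pos h, if_pos h.symm, ← h, zsmul_eq_mul, mul_one]
        congr 2
        generalize par (s i) = x; revert x; decide
      · rw [if_neg h, if_neg (Ne.symm h), smul_zero]
    rw [basis_apply, trace_pure_mul_pure hF (fun i => hpar (s' i)) fun i => (hpar' (s i)).nakayama hF]
    simp_rw [h1]
    split_ifs with h
    · subst h; simp [zsmul_eq_mul]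
    · obtain ⟨i, hi⟩ := Function.ne_iff.1 h
      rw [Finset.prod_eq_zero (Finset.mem_univ i) (if_neg hi), smul_zero]
  have hsq : ∀ x : ZMod 2, (paritySign x : k) * paritySign x = 1 := fun x => by
    rw [← Int.cast_mul, paritySign_mul_self, Int.cast_one]
  refine ⟨∑ s, ((mulSign (fun i => par (s i)) (fun i => par (s i)) *
    ∏ i, (paritySign (par (s i)) : k)) * φ (basis B n s)) • u s, LinearMap.congr_fun
      ((basis B n).ext (f₂ := trace 𝒜 n tr ∘ₗ (superMul 𝒜 n).flip _) fun s => ?_)⟩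
  change _ = trace 𝒜 n tr (basis B n s * _)
  rw [Finset.mul_sum, map_sum, Finset.sum_eq_single s]
  · rw [mul_smul_comm, map_smul, hu, if_pos rfl, smul_eq_mul, mul_right_comm]
    rw [mul_mul_mul_comm, ← Finset.prod_mul_distrib]
    simp only [hsq, Finset.prod_const_one, mul_one, mulSign, one_mul]
  · intro s' _ hs
    rw [mul_smul_comm, map_smul, hu, if_neg hs.symm, smul_zero]
  · simp

theorem prod_paritySign (s : Finset (Fin n)) (f : Fin n → ZMod 2) :
    ∏ i ∈ s, paritySign (f i) = paritySign (∑ i ∈ s, f i) := by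
  induction s using Finset.induction_on with
  | empty => simp [paritySign_zero]
  | insert i s hi ih => rw [Finset.prod_insert hi, Finset.sum_insert hi, paritySign_add, ih]

theorem pure_paritySign (η ε : Fin n → ZMod 2) (f : Fin n → A) :
    pure 𝒜 n (fun i => paritySign (η i * ε i) • f i) =
      paritySign (∑ i, η i * ε i) • pure 𝒜 n f := by
  have := (pure 𝒜 n).map_smul_univ (fun i => ((paritySign (η i * ε i) : ℤ) : k)) f
  simp only [Int.cast_smul_eq_zsmul] at this
  rw [this, ← Int.cast_prod, prod_paritySign, Int.cast_smul_eq_zsmul]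

/-- `Γ ^ η` where `Γ` is the parity involution. -/
def twistInv (𝒜 : ℕ × ZMod 2 → Submodule k A) [GradedAlgebra 𝒜] (η : ZMod 2) : A →ₗ[k] A :=
  ∑ ε, paritySign (η * ε) • parityProj 𝒜 ε

theorem IsPar.twistInv {ε : ZMod 2} {a : A} (ha : IsPar 𝒜 ε a) (η : ZMod 2) :
    twistInv 𝒜 η a = paritySign (η * ε) • a := by
  rw [SuperTensorPower.twistInv, LinearMap.sum_apply, Finset.sum_eq_single ε]
  · rw [LinearMap.smul_apply, ha]
  · intro x _ hx; rw [LinearMap.smul_apply, ha.proj, if_neg hx, smul_zero]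
  · simp

/-- The Koszul signs are expressed as powers of the parity involution on the factors that are
crossed, so that the factors of the pure tensor need no definite parity. -/
theorem single_mul_pure (l : Fin n) {η : ZMod 2} {g : A} (hg : IsPar 𝒜 η g) (f : Fin n → A) :
    single 𝒜 n l g * pure 𝒜 n f =
      pure 𝒜 n fun i => if i < l then twistInv 𝒜 η (f i) else if i = l then g * f i else f i := by
  have : superMul 𝒜 n (single 𝒜 n l g) = map 𝒜 n fun i => if i < l then twistInv 𝒜 η else
      if i = l then LinearMap.mulLeft k g else LinearMap.id := by
    refine ext_par fun ε f hf => ?_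
    change single 𝒜 n l g * pure 𝒜 n f = _
    rw [single, pure_mul_pure (isPar_update_one l hg) hf, map_pure, mulSign]
    have h1 : ∑ i, ∑ j, (if j < i then (Pi.single l η : Fin n → ZMod 2) i * ε j else 0) =
        ∑ i, (if i < l then η else 0) * ε i := by
      rw [Finset.sum_eq_single l]
      · simp
      · intro i _ hi; simp [hi]
      · simp
    rw [h1, ← pure_paritySign]
    congr 1
    funext i
    rcases lt_trichotomy i l with h | h | h
    · simp [h, h.ne, IsPar.twistInv (hf i)]
    · subst h; simp [paritySign_zero]
    · simp [h.asymm, h.ne', paritySign_zero]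
  refine (LinearMap.congr_fun this (pure 𝒜 n f)).trans ?_
  rw [map_pure]
  congr 1
  funext i
  split_ifs <;> rfl

theorem pure_mul_single (l : Fin n) {η : ZMod 2} {g : A} (hg : IsPar 𝒜 η g) (f : Fin n → A) :
    pure 𝒜 n f * single 𝒜 n l g =
      pure 𝒜 n fun i => if l < i then twistInv 𝒜 η (f i) else if i = l then f i * g else f i := by
  have : (superMul 𝒜 n).flip (single 𝒜 n l g) = map 𝒜 n fun i => if l < i then twistInv 𝒜 η else
      if i = l then LinearMap.mulRight k g else LinearMap.id := by
    refine ext_par fun ε f hf => ?_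
    change pure 𝒜 n f * single 𝒜 n l g = _
    rw [single, pure_mul_pure hf (isPar_update_one l hg), map_pure, mulSign]
    have h1 : ∑ i, ∑ j, (if j < i then ε i * (Pi.single l η : Fin n → ZMod 2) j else 0) =
        ∑ i, (if l < i then η else 0) * ε i := by
      refine Finset.sum_congr rfl fun i _ => ?_
      rw [Finset.sum_eq_single l]
      · simp [mul_comm]
      · intro i _ hi; simp [hi]
      · simp
    rw [h1, ← pure_paritySign]
    congr 1
    funext i
    rcases lt_trichotomy i l with h | h | h
    · simp [h.asymm, h.ne, paritySign_zero]
    · subst h; simp [paritySign_zero]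
    · simp [h, h.ne', IsPar.twistInv (hf i)]
  refine (LinearMap.congr_fun this (pure 𝒜 n f)).trans ?_
  rw [map_pure]
  congr 1
  funext i
  split_ifs <;> rfl

theorem twistInv_twistInv (η : ZMod 2) (a : A) : twistInv 𝒜 η (twistInv 𝒜 η a) = a := by
  conv_rhs => rw [← sum_parityProj (𝒜 := 𝒜) a]
  conv_lhs => rw [← sum_parityProj (𝒜 := 𝒜) a]
  rw [map_sum, map_sum]
  refine Finset.sum_congr rfl fun ε _ => ?_
  rw [IsPar.twistInv (isPar_proj ε a), map_zsmul, IsPar.twistInv (isPar_proj ε a), smul_smul,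
    paritySign_mul_self, one_smul]

theorem mul_twistedCenter {m : ℤ} {f : A} (hf : f ∈ twistedCenter hF m) {η : ZMod 2} {g : A}
    (hg : IsPar 𝒜 η g) : g * f = twistInv 𝒜 η f * (nakayama hF ^ m) g := by
  rw [hf.2 g, signed_apply, twistInv, LinearMap.sum_apply, Finset.sum_mul]
  refine Finset.sum_congr rfl fun ε _ => ?_
  rw [Finset.sum_eq_single η]
  · rw [hg, LinearMap.smul_apply, smul_mul_assoc, mul_comm η]; rfl
  · intro x _ hx; rw [hg.proj, if_neg hx, map_zero, smul_zero]
  · simp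

theorem single_mul_pure_twisted {m : Fin n → ℤ} {f : Fin n → A}
    (hf : ∀ j, f j ∈ twistedCenter hF (m j)) (l : Fin n) {η : ZMod 2} {g : A}
    (hg : IsPar 𝒜 η g) (hg' : IsPar 𝒜 η ((nakayama hF ^ m l) g)) :
    single 𝒜 n l g * pure 𝒜 n f =
      map 𝒜 n (fun _ => twistInv 𝒜 η) (pure 𝒜 n f) * single 𝒜 n l ((nakayama hF ^ m l) g) := by
  rw [single_mul_pure l hg, map_pure, pure_mul_single l hg']
  congr 1
  funext i
  rcases lt_trichotomy i l with h | h | h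
  · simp [h, h.asymm, h.ne]
  · subst h; simp [mul_twistedCenter hF (hf i) hg]
  · simp [h, h.asymm, h.ne', twistInv_twistInv]

/-- The factorwise involution acts by a sign depending on the total parity, which is even. -/
theorem map_twistInv_of_mem {d : ℕ} {u : SuperTensorPower 𝒜 n} (hu : u ∈ grading 𝒜 n (d, 0))
    (η : ZMod 2) : map 𝒜 n (fun _ => twistInv 𝒜 η) u = u := by
  refine Submodule.span_induction (p := fun u _ => map 𝒜 n (fun _ => twistInv 𝒜 η) u = u)
    ?_ ?_ ?_ ?_ hu
  · rintro _ ⟨q, f, hf, hq, rfl⟩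
    have h1 : ∀ i, twistInv 𝒜 η (f i) = paritySign (η * (q i).2) • f i :=
      fun i => IsPar.twistInv (isPar_of_mem (hf i)) η
    rw [map_pure]
    simp_rw [h1]
    rw [pure_paritySign (fun _ => η), ← Finset.mul_sum, ← Prod.snd_sum, hq, mul_zero,
      paritySign_zero, one_smul]
  · simp
  · intro x y _ _ hx hy; rw [map_add, hx, hy]
  · intro r x _ hx; rw [map_smul, hx]

theorem twist_pow_single (o l : Fin n) (m : ℕ) (g : A) :
    (twist hF n o ^ m) (single 𝒜 n l g) =
      single 𝒜 n l ((nakayama hF ^ (if l = o then m else 0)) g) := by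
  induction m with
  | zero => simp
  | succ m ih =>
    rw [pow_succ', AlgEquiv.mul_apply, ih, twist_single]
    split_ifs with h
    · rw [pow_succ', AlgEquiv.mul_apply]
    · rfl

variable {o : Fin n} {m d : ℕ} {u : SuperTensorPower 𝒜 n}

theorem twist_shiftSpace {m : ℤ} (hu : u ∈ shiftSpace hF n o m) (l : Fin n) :
    twist hF n l u = u := by
  refine Submodule.span_induction (p := fun u _ => twist hF n l u = u) ?_ ?_ ?_ ?_ hu.1
  · rintro _ ⟨f, hf, rfl⟩
    rw [twist, mapEquiv_pure]
    congr 1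
    funext i
    rcases eq_or_ne i l with rfl | h
    · simpa using (hf i).1
    · simp [h]
  · simp
  · intro x y _ _ hx hy; rw [map_add, hx, hy]
  · intro r x _ hx; rw [map_smul, hx]

/-- Crossing a generator `g_l` applies the parity involution to every factor, because elements of
the twisted centre need not be homogeneous. The involution disappears only at the end, as `u` is
even as a whole. -/
theorem mul_shiftSpace (hu : u ∈ shiftSpace hF n o m) (hd : u ∈ grading 𝒜 n (d, 0))
    (f : SuperTensorPower 𝒜 n) : f * u = u * (twist hF n o ^ m) f := by
  induction f using single_induction with
  | smul_one r => rw [map_smul, map_one, smul_one_mul, mul_smul_one]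
  | single l η g hg =>
    have key : single 𝒜 n l g * u =
        map 𝒜 n (fun _ => twistInv 𝒜 η) u * (twist hF n o ^ m) (single 𝒜 n l g) := by
      refine Submodule.span_induction (p := fun u _ => single 𝒜 n l g * u =
        map 𝒜 n (fun _ => twistInv 𝒜 η) u * (twist hF n o ^ m) (single 𝒜 n l g)) ?_ ?_ ?_ ?_ hu.1
      · rintro _ ⟨f, hf, rfl⟩
        have e : nakayama hF ^ (Function.update (0 : Fin n → ℤ) o (m : ℤ) l) =
            nakayama hF ^ (if l = o then m else 0) := by
          rcases eq_or_ne l o with rfl | h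
          · simp
          · simp [h]
        have := single_mul_pure_twisted hF hf l hg (by rw [e]; exact hg.nakayama_pow hF _)
        rw [this, e, twist_pow_single]
      · simp
      · intro x y _ _ hx hy; rw [map_add, add_mul, mul_add, hx, hy]
      · intro r x _ hx; rw [map_smul, mul_smul_comm, hx, smul_mul_assoc]
    rw [key, map_twistInv_of_mem hd]
  | add a b ha hb => rw [add_mul, ha, hb, map_add, mul_add]
  | mul a b ha hb => rw [mul_assoc, hb, ← mul_assoc, ha, map_mul, mul_assoc]

end SuperTensorPower

open SuperTensorPower

/-- The trace of the super tensor power. -/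
def wreathTrace : WreathTrace (wreathData hF B hB n) where
  tr := trace 𝒜 n tr
  tr_Ψ := trace_twist hF
  tr_smul := trace_perm hF
  exists_mul := trace_exists_mul hF B hB

end Frobenius

end

/-! ### Cyclotomic polynomials and their conjugates -/

section

open Equiv

namespace AffineRep

variable {k : Type u} {R : Type v} {n : ℕ} [CommRing k] [Ring R] [Algebra k R]
  [MulSemiringAction (Perm (Fin n)) R] [SMulCommClass (Perm (Fin n)) k R]
  {D : WreathData k R n} {A : Type w} [Ring A] [Algebra k A] (ρ : AffineRep D A)

/-- The properties of the cyclotomic polynomials in the variable `x_o`; the leading terms are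
`x_o^d - c₀ x_o^(d-1)`. -/
structure IsCyclotomic (o : Fin n) (χ : A) (d : ℕ) (c₀ : R) : Prop where
  perm_comm : ∀ π : Perm (Fin n), π o = o → ρ.perm π * χ = χ * ρ.perm π
  tens_comm : ∀ f, ρ.tens f * χ = χ * ρ.tens ((D.Ψ o ^ d) f)
  x_comm : ∀ j, χ * ρ.x j = ρ.x j * χ
  leading : (d = 0 ∧ χ = 1 ∧ c₀ = 0) ∨
    ∃ m, d = m + 1 ∧ χ - ρ.x o ^ (m + 1) + ρ.tens c₀ * ρ.x o ^ m ∈ ρ.filt m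
  twist_eq : D.Ψ o c₀ = c₀

theorem x_pow_mem_filt (o : Fin n) (m : ℕ) : ρ.x o ^ m ∈ ρ.filt (m + 1) := by
  rw [← ρ.xPow_single]; exact ρ.xPow_mem_filt (by simp)

theorem tens_mul_mem_filt {m : ℕ} (f : R) {a : A} (ha : a ∈ ρ.filt m) :
    ρ.tens f * a ∈ ρ.filt m := by
  rw [← ρ.hat_C]; exact ρ.hat_mul_mem_filt _ ha

theorem filt_mul_mem {a b : A} {l m : ℕ} (ha : a ∈ ρ.filt (l + 1)) (hb : b ∈ ρ.filt m) :
    a * b ∈ ρ.filt (l + m) := by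
  cases m with
  | zero =>
    rw [ρ.filt_zero, Submodule.mem_bot] at hb
    rw [hb, mul_zero]; exact zero_mem _
  | succ m =>
    rw [show l + (m + 1) = l + 1 + m by omega]
    exact ρ.filt_mul_filt _ _ (Submodule.mul_mem_mul ha hb)

theorem tens_x_pow (f : R) (i : Fin n) (m : ℕ) :
    ρ.tens f * ρ.x i ^ m = ρ.x i ^ m * ρ.tens ((D.Ψ i ^ m) f) := by
  induction m with
  | zero => simp
  | succ m ih =>
    rw [pow_succ, ← mul_assoc, ih, mul_assoc, ρ.tens_x, ← mul_assoc, pow_succ' (D.Ψ i),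
      AlgEquiv.mul_apply]

variable {ρ} {o : Fin n}

theorem perm_x_fixed (ho : (o : ℕ) = 0) {π : Perm (Fin n)} (hπ : π o = o) :
    ρ.perm π * ρ.x o = ρ.x o * ρ.perm π := by
  have h := ρ.perm_x_first ho π
  rw [hπ, D.J_first ho, map_zero, sub_zero] at h
  conv_rhs => rw [← h, mul_assoc, ← map_mul, inv_mul_cancel, map_one, mul_one]

theorem isCyclotomic_one (o : Fin n) : ρ.IsCyclotomic o 1 0 0 where
  perm_comm π _ := by rw [mul_one, one_mul]
  tens_comm f := by simp
  x_comm j := by rw [mul_one, one_mul]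
  leading := Or.inl ⟨rfl, rfl, rfl⟩
  twist_eq := map_zero _

/-- The constant term is subleading only for a linear factor, hence the case distinction on `m = 0`.
-/
theorem isCyclotomic_pow_sub (ho : (o : ℕ) = 0) {m : ℕ} {c : R} (hΨ : ∀ l, D.Ψ l c = c)
    (hc : ∀ f, f * c = c * (D.Ψ o ^ (m + 1)) f) (hπ : ∀ π : Perm (Fin n), π o = o → π • c = c) :
    ρ.IsCyclotomic o (ρ.x o ^ (m + 1) - ρ.tens c) (m + 1) (if m = 0 then c else 0) where
  perm_comm π h := by
    have h1 : Commute (ρ.perm π) (ρ.x o ^ (m + 1)) :=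
      (show Commute (ρ.perm π) (ρ.x o) from perm_x_fixed ho h).pow_right _
    rw [mul_sub, sub_mul, ρ.perm_tens, hπ π h, h1.eq]
  tens_comm f := by
    rw [mul_sub, sub_mul, ρ.tens_x_pow, ← map_mul, hc, map_mul]
  x_comm j := by
    have h1 : Commute (ρ.x o ^ (m + 1)) (ρ.x j) := (show Commute _ _ from ρ.x_comm o j).pow_left _
    rw [mul_sub, sub_mul, ρ.tens_x, hΨ, h1.eq]
  leading := by
    refine Or.inr ⟨m, rfl, ?_⟩
    rcases Nat.eq_zero_or_pos m with rfl | hm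
    · simp
    · rw [if_neg hm.ne', map_zero, zero_mul, add_zero, sub_sub_cancel_left]
      obtain ⟨m, rfl⟩ := Nat.exists_eq_succ_of_ne_zero hm.ne'
      exact neg_mem (ρ.H_le_filt _ (ρ.tens_mem_H c))
  twist_eq := by split_ifs <;> simp [hΨ]

theorem IsCyclotomic.mul {χ χ' : A} {d d' : ℕ} {c c' : R} (h : ρ.IsCyclotomic o χ d c)
    (h' : ρ.IsCyclotomic o χ' d' c') : ρ.IsCyclotomic o (χ * χ') (d + d') (c + c') where
  perm_comm π hπ := by
    rw [← mul_assoc, h.perm_comm π hπ, mul_assoc, h'.perm_comm π hπ, mul_assoc]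
  tens_comm f := by
    rw [← mul_assoc, h.tens_comm, mul_assoc, h'.tens_comm, mul_assoc, add_comm d, pow_add,
      AlgEquiv.mul_apply]
  x_comm j := by rw [mul_assoc, h'.x_comm, ← mul_assoc, h.x_comm, mul_assoc]
  leading := by
    rcases h.leading with ⟨rfl, rfl, rfl⟩ | ⟨m, rfl, hm⟩
    · simpa using h'.leading
    rcases h'.leading with ⟨rfl, rfl, rfl⟩ | ⟨m', rfl, hm'⟩
    · exact Or.inr ⟨m, rfl, by simpa using hm⟩
    refine Or.inr ⟨m + m' + 1, by omega, ?_⟩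
    have hlow : χ' - ρ.x o ^ (m' + 1) ∈ ρ.filt (m' + 1) := by
      have h1 : χ' - ρ.x o ^ (m' + 1) = (χ' - ρ.x o ^ (m' + 1) + ρ.tens c' * ρ.x o ^ m') -
        ρ.tens c' * ρ.x o ^ m' := by abel
      rw [h1]
      exact sub_mem (ρ.filt_mono (Nat.le_succ _) hm')
        (ρ.tens_mul_mem_filt _ (ρ.x_pow_mem_filt _ _))
    have hχ' : χ' ∈ ρ.filt (m' + 1 + 1) := by
      have h1 : χ' = (χ' - ρ.x o ^ (m' + 1)) + ρ.x o ^ (m' + 1) := by abel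
      rw [h1]
      exact add_mem (ρ.filt_mono (Nat.le_succ _) hlow) (ρ.x_pow_mem_filt _ _)
    have hc : ρ.x o ^ (m + 1) * ρ.tens c' = ρ.tens c' * ρ.x o ^ (m + 1) := by
      rw [ρ.tens_x_pow]
      congr 2
      have : ∀ l, (D.Ψ o ^ l) c' = c' := fun l => by
        induction l with
        | zero => rfl
        | succ l ih => rw [pow_succ, AlgEquiv.mul_apply, h'.twist_eq, ih]
      exact (this _).symm
    have hp : ρ.x o ^ (m + 1) * ρ.x o ^ m' = ρ.x o ^ (m + m' + 1) := by
      rw [← pow_add]; congr 1; omega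
    have hp' : ρ.x o ^ m * ρ.x o ^ (m' + 1) = ρ.x o ^ (m + m' + 1) := by
      rw [← pow_add]; congr 1
    have hp2 : ρ.x o ^ (m + 1) * ρ.x o ^ (m' + 1) = ρ.x o ^ (m + m' + 1 + 1) := by
      rw [← pow_add]; congr 1; omega
    -- The product of leading parts contributes both subleading coefficients, `c'` being moved
    -- across `x_o^{m+1}` unchanged since `Ψ_o` fixes it; every other term has lower degree.
    have e : χ * χ' - ρ.x o ^ (m + m' + 1 + 1) + ρ.tens (c + c') * ρ.x o ^ (m + m' + 1) =
        (χ - ρ.x o ^ (m + 1) + ρ.tens c * ρ.x o ^ m) * χ' +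
        ρ.x o ^ (m + 1) * (χ' - ρ.x o ^ (m' + 1) + ρ.tens c' * ρ.x o ^ m') -
        ρ.tens c * (ρ.x o ^ m * (χ' - ρ.x o ^ (m' + 1))) := by
      have e1 : ρ.x o ^ (m + 1) * (ρ.tens c' * ρ.x o ^ m') =
          ρ.tens c' * ρ.x o ^ (m + m' + 1) := by rw [← mul_assoc, hc, mul_assoc, hp]
      rw [mul_add, mul_sub, mul_sub, e1, hp2, hp', map_add]
      noncomm_ring
    rw [e]
    refine sub_mem (add_mem ?_ ?_) (ρ.tens_mul_mem_filt _ ?_)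
    · have := ρ.filt_mul_filt m (m' + 1) (Submodule.mul_mem_mul hm hχ')
      rwa [← add_assoc] at this
    · have := ρ.filt_mul_mem (ρ.x_pow_mem_filt o (m + 1)) hm'
      rwa [show m + 1 + m' = m + m' + 1 by omega] at this
    · rw [add_assoc]; exact ρ.filt_mul_mem (ρ.x_pow_mem_filt o m) hlow
  twist_eq := by rw [map_add, h.twist_eq, h'.twist_eq]

theorem isCyclotomic_prod {N : ℕ} {χ : Fin N → A} {d : Fin N → ℕ} {c : Fin N → R}
    (h : ∀ i, ρ.IsCyclotomic o (χ i) (d i) (c i)) :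
    ρ.IsCyclotomic o (List.ofFn χ).prod (∑ i, d i) (∑ i, c i) := by
  induction N with
  | zero => simpa using isCyclotomic_one o
  | succ N ih =>
    rw [List.ofFn_succ, List.prod_cons, Fin.sum_univ_succ, Fin.sum_univ_succ]
    exact (h 0).mul (ih fun i => h i.succ)

theorem smul_Ψ_pow (D : WreathData k R n) (π : Perm (Fin n)) (i : Fin n) (d : ℕ) (f : R) :
    π • (D.Ψ i ^ d) f = (D.Ψ (π i) ^ d) (π • f) := by
  induction d with
  | zero => rfl
  | succ d ih => rw [pow_succ', AlgEquiv.mul_apply, D.smul_Ψ, ih, pow_succ', AlgEquiv.mul_apply]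

/-- The cyclotomic family of conjugates of a cyclotomic polynomial in the first variable. -/
def cyclotomicFamily {χ : Fin n → A} {d : ℕ} {c : Fin n → R}
    (h : ∀ o : Fin n, (o : ℕ) = 0 → ρ.IsCyclotomic o (χ o) d (c o)) : CyclotomicFamily ρ d where
  χ i := ρ.perm (swap ⟨0, i.pos⟩ i) * χ ⟨0, i.pos⟩ * ρ.perm (swap ⟨0, i.pos⟩ i)⁻¹
  φ i := D.Ψ i ^ d
  perm_χ π i := by
    have h0 := h ⟨0, i.pos⟩ rfl
    generalize (⟨0, i.pos⟩ : Fin n) = o at *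
    -- This product fixes `o`, so it commutes with `χ o`; thus the conjugate depends only on the
    -- image of `o`.
    have h1 := h0.perm_comm ((swap o (π i))⁻¹ * π * swap o i) (by simp)
    have h2 : ∀ σ τ : Perm (Fin n), ρ.perm σ * ρ.perm τ = ρ.perm (σ * τ) := fun σ τ =>
      (map_mul _ _ _).symm
    have h3 : π * swap o i = swap o (π i) * ((swap o (π i))⁻¹ * π * swap o i) := by group
    rw [← mul_assoc, ← mul_assoc, h2, h3, ← h2, mul_assoc (ρ.perm (swap o (π i))), h1, ← mul_assoc,
      mul_assoc, h2, mul_assoc (_ * _) (ρ.perm _) (ρ.perm π), h2]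
    congr 2
    group
  tens_χ f i := by
    have h0 := h ⟨0, i.pos⟩ rfl
    generalize (⟨0, i.pos⟩ : Fin n) = o at *
    have h1 : ρ.tens f * ρ.perm (swap o i) = ρ.perm (swap o i) * ρ.tens ((swap o i)⁻¹ • f) := by
      rw [ρ.perm_tens, smul_inv_smul]
    have h2 : ρ.tens ((D.Ψ o ^ d) ((swap o i)⁻¹ • f)) * ρ.perm (swap o i)⁻¹ =
        ρ.perm (swap o i)⁻¹ * ρ.tens ((D.Ψ i ^ d) f) := by
      rw [ρ.perm_tens, smul_Ψ_pow, swap_inv, swap_apply_right]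
    rw [← mul_assoc, ← mul_assoc, h1, mul_assoc (ρ.perm _) (ρ.tens _), h0.tens_comm, ← mul_assoc,
      mul_assoc, h2, mul_assoc]
    simp only [mul_assoc]
  χ_x i j hi := by
    have e : (⟨0, i.pos⟩ : Fin n) = i := Fin.ext hi.symm
    rw [e, swap_self]
    have : ρ.perm (Equiv.refl (Fin n)) = 1 := map_one ρ.perm
    rw [this, show (Equiv.refl (Fin n))⁻¹ = Equiv.refl (Fin n) from rfl, this, one_mul, mul_one]
    exact (h i hi).x_comm j
  χ_first_mem i hi := by
    have e : (⟨0, i.pos⟩ : Fin n) = i := Fin.ext hi.symm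
    rw [e, swap_self]
    have : ρ.perm (Equiv.refl (Fin n)) = 1 := map_one ρ.perm
    rw [this, show (Equiv.refl (Fin n))⁻¹ = Equiv.refl (Fin n) from rfl, this, one_mul, mul_one]
    rcases (h i hi).leading with ⟨rfl, h1, -⟩ | ⟨m, rfl, hm⟩
    · rw [h1, pow_zero, sub_self]; exact zero_mem _
    · have h1 : χ i - ρ.x i ^ (m + 1) = (χ i - ρ.x i ^ (m + 1) + ρ.tens (c i) * ρ.x i ^ m) -
        ρ.tens (c i) * ρ.x i ^ m := by abel
      rw [h1]
      exact sub_mem (ρ.filt_mono (Nat.le_succ _) hm)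
        (ρ.tens_mul_mem_filt _ (ρ.x_pow_mem_filt _ _))

theorem cyclotomicFamily_first {χ : Fin n → A} {d : ℕ} {c : Fin n → R}
    (h : ∀ o : Fin n, (o : ℕ) = 0 → ρ.IsCyclotomic o (χ o) d (c o)) {i : Fin n} (hi : (i : ℕ) = 0) :
    (cyclotomicFamily h).χ i = χ i := by
  change ρ.perm (swap ⟨0, i.pos⟩ i) * χ ⟨0, i.pos⟩ * ρ.perm (swap ⟨0, i.pos⟩ i)⁻¹ = χ i
  have e : (⟨0, i.pos⟩ : Fin n) = i := Fin.ext hi.symm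
  rw [e, swap_self]
  have : ρ.perm (Equiv.refl (Fin n)) = 1 := map_one ρ.perm
  rw [this, show (Equiv.refl (Fin n))⁻¹ = Equiv.refl (Fin n) from rfl, this, one_mul, mul_one]

end AffineRep

end

/-! ### The concrete affine algebra and its cyclotomic quotient -/

section

open Equiv

variable {k : Type u} {F : Type v} [CommRing k] [Ring F] [Algebra k F]
  {𝒜 : ℕ × ZMod 2 → Submodule k F} [GradedAlgebra 𝒜] {δ : ℕ} {tr : F →ₗ[k] k}
  (hF : IsFrobenius 𝒜 δ tr) {ι : Type w} [Fintype ι] (B : Module.Basis ι k F)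
  (hB : ∀ b, ∃ p, B b ∈ 𝒜 p) {n : ℕ}

namespace Affine

theorem rel {a b : FreeAlgebra k (Gen 𝒜 n)} (h : AffineRel hF B n a b) :
    RingQuot.mkAlgHom k (AffineRel hF B n) a = RingQuot.mkAlgHom k (AffineRel hF B n) b :=
  RingQuot.mkAlgHom_rel k h

variable (n) in
/-- The tautological representation of the affine wreath product algebra in itself. -/
def rep : AffineRep (wreathData hF B hB n) (Affine hF B n) where
  tens := AlgHom.ofLinearMap
    { toFun := fun f => gen hF B n (.tens f)
      map_add' := fun f g => (rel hF B (.tens_add f g)).trans (map_add _ _ _)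
      map_smul' := fun r f => (rel hF B (.tens_smul r f)).trans (map_smul _ _ _) }
    ((rel hF B .tens_one).trans (map_one _))
    fun f g => (rel hF B (.tens_mul f g)).trans (map_mul _ _ _)
  x i := gen hF B n (.x i)
  perm :=
    { toFun := fun π => gen hF B n (.perm π)
      map_one' := (rel hF B .perm_one).trans (map_one _)
      map_mul' := fun π σ => (rel hF B (.perm_mul π σ)).trans (map_mul _ _ _) }
  x_comm i j := by
    have := rel hF B (.x_comm i j)
    rwa [map_mul, map_mul] at this
  tens_x f i := by
    have := rel hF B (.tens_x f i)
    rw [map_mul, map_mul, ← SuperTensorPower.twist_eq_mapAt] at this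
    exact this
  simple_x_of_ne i i' j h hi hi' := by
    have := rel hF B (.simple_x_of_ne i i' j h hi hi')
    rwa [map_mul, map_mul] at this
  simple_x i i' h := by
    have := rel hF B (.simple_x i i' h)
    rwa [map_sub, map_mul, map_mul] at this
  perm_tens π f := by
    have := rel hF B (.perm_tens π f)
    rwa [map_mul, map_mul] at this

/-- The universal property of the affine wreath product algebra. -/
def lift {A : Type*} [Ring A] [Algebra k A] (ρ : AffineRep (wreathData hF B hB n) A) :
    Affine hF B n →ₐ[k] A :=
  RingQuot.liftAlgHom k ⟨FreeAlgebra.lift k fun g => match g with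
    | .x i => ρ.x i
    | .tens f => ρ.tens f
    | .perm π => ρ.perm π, by
      intro a b h
      cases h with
      | x_comm i j => simpa using ρ.x_comm i j
      | tens_add f g => simp
      | tens_smul r f => simp
      | tens_one => simp
      | tens_mul f g => simp
      | perm_one => simp
      | perm_mul π σ => simp
      | tens_x f i =>
        have := ρ.tens_x f i
        simp only [map_mul, FreeAlgebra.lift_ι_apply]
        rw [← SuperTensorPower.twist_eq_mapAt]
        exact this
      | simple_x_of_ne i i' j h hi hi' => simpa using ρ.simple_x_of_ne i i' j h hi hi'
      | simple_x i i' h =>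
        simp only [map_sub, map_mul, FreeAlgebra.lift_ι_apply]
        exact ρ.simple_x i i' h
      | perm_tens π f =>
        simp only [map_mul, FreeAlgebra.lift_ι_apply]
        exact ρ.perm_tens π f⟩

variable {A : Type*} [Ring A] [Algebra k A] (ρ : AffineRep (wreathData hF B hB n) A)

theorem lift_gen (g : Gen 𝒜 n) : lift hF B hB ρ (gen hF B n g) = match g with
    | .x i => ρ.x i
    | .tens f => ρ.tens f
    | .perm π => ρ.perm π :=
  (RingQuot.liftAlgHom_mkAlgHom_apply k _ _ _).trans (FreeAlgebra.lift_ι_apply _ _)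

theorem rep_comp_lift : (rep hF B hB n).comp (lift hF B hB ρ) = ρ := by
  cases ρ with
  | mk tens x perm h1 h2 h3 h4 h5 =>
    unfold AffineRep.comp
    congr 1
    · ext f; exact lift_gen hF B hB _ (.tens f)
    · funext i; exact lift_gen hF B hB _ (.x i)
    · ext π; exact lift_gen hF B hB _ (.perm π)

theorem adjoin_rep : Algebra.adjoin k (Set.range (rep hF B hB n).tens ∪
    Set.range (rep hF B hB n).perm ∪ Set.range (rep hF B hB n).x) = ⊤ := by
  have h1 : (⊤ : Subalgebra k (Affine hF B n)) =
      Algebra.adjoin k (Set.range (gen hF B n)) := by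
    have h2 := congrArg (Subalgebra.map (RingQuot.mkAlgHom k (AffineRel hF B n)))
      (FreeAlgebra.adjoin_range_ι (R := k) (X := Gen 𝒜 n))
    rw [Algebra.map_top, (AlgHom.range_eq_top _).2 (RingQuot.mkAlgHom_surjective k _),
      AlgHom.map_adjoin, ← Set.range_comp] at h2
    exact h2.symm
  rw [eq_top_iff, h1]
  refine Algebra.adjoin_mono ?_
  rintro _ ⟨g, rfl⟩
  cases g with
  | x i => exact Or.inr ⟨i, rfl⟩
  | tens f => exact Or.inl (Or.inl ⟨f, rfl⟩)
  | perm π => exact Or.inl (Or.inr ⟨π, rfl⟩)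

end Affine

section Cyclotomic

variable {θ : ℕ} {e : Fin θ → ℕ} {c : ∀ m : Fin θ, Fin (e m) → SuperTensorPower 𝒜 n}
  (hc : ∀ (m : Fin θ) (j : Fin (e m)),
      c m j ∈ SuperTensorPower.grading 𝒜 n (((m : ℕ) + 1) * δ, 0))
  (hc' : ∀ (m : Fin θ) (j : Fin (e m)) (i : Fin n), (i : ℕ) = 0 →
      c m j ∈ shiftSpace hF n i ((m : ℕ) + 1))

/-- The sum of the `c^{(1,j)}`, the negative of the subleading coefficient of the cyclotomic
polynomial. -/
def subleading (c : ∀ m : Fin θ, Fin (e m) → SuperTensorPower 𝒜 n) : SuperTensorPower 𝒜 n :=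
  ∑ m : Fin θ, ∑ j : Fin (e m), if (m : ℕ) = 0 then c m j else 0

include hc hc' in
theorem isCyclotomic_cycPoly (o : Fin n) (ho : (o : ℕ) = 0) :
    (Affine.rep hF B hB n).IsCyclotomic o (cycPoly hF B c o) (level e) (subleading c) := by
  have h1 : level e = ∑ m : Fin θ, ∑ _j : Fin (e m), ((m : ℕ) + 1) := by
    simp [level, mul_comm]
  rw [h1, subleading, cycPoly]
  refine AffineRep.isCyclotomic_prod fun m => AffineRep.isCyclotomic_prod fun j => ?_
  refine AffineRep.isCyclotomic_pow_sub ho (SuperTensorPower.twist_shiftSpace hF (hc' m j o ho))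
    (fun f => ?_) fun π hπ => (hc' m j o ho).2 π hπ
  exact SuperTensorPower.mul_shiftSpace hF (m := (m : ℕ) + 1)
    (by rw [Nat.cast_add, Nat.cast_one]; exact hc' m j o ho) (hc m j) f

/-- The cyclotomic family generating the kernel of the quotient map. -/
def cycFamily : CyclotomicFamily (Affine.rep hF B hB n) (level e) :=
  AffineRep.cyclotomicFamily (isCyclotomic_cycPoly hF B hB hc hc')

theorem cycFamily_first {i : Fin n} (hi : (i : ℕ) = 0) :
    (cycFamily hF B hB hc hc').χ i = cycPoly hF B c i :=
  AffineRep.cyclotomicFamily_first _ hi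

theorem mk_eq_zero {a : Affine hF B n} :
    Cyclotomic.mk hF B c a = 0 ↔ a ∈ cycIdeal hF B c := by
  rw [TwoSidedIdeal.mem_iff, ← RingCon.eq]
  rfl

/-- The cyclotomic wreath product algebra as a quotient of the affine one. -/
def cycQuotient : CyclotomicQuotient (cycFamily hF B hB hc hc') (Cyclotomic hF B c) where
  Q := Cyclotomic.mk hF B c
  surjective := RingCon.mk'_surjective _
  map_χ i := by
    have h : ∀ o : Fin n, (o : ℕ) = 0 →
        Cyclotomic.mk hF B c ((cycFamily hF B hB hc hc').χ o) = 0 := by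
      intro o ho
      rw [mk_eq_zero, cycFamily_first hF B hB hc hc' ho]
      exact TwoSidedIdeal.subset_span ⟨o, ho, rfl⟩
    obtain ⟨o, π, ho, rfl⟩ := CyclotomicFamily.exists_first i
    -- The ideal is generated by the first polynomial alone; its conjugates lie in it as well.
    rw [CyclotomicFamily.χ_eq, map_mul, map_mul, h o ho, mul_zero, zero_mul]
  exists_mem_I a ha := by
    rw [mk_eq_zero, cycIdeal] at ha
    refine (cycFamily hF B hB hc hc').exists_mem_I (Affine.adjoin_rep hF B hB) ?_
    convert ha using 3
    funext a
    exact propext (exists_congr fun i => and_congr_right fun hi => by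
      rw [cycFamily_first hF B hB hc hc' hi])
  exists_mem_filt := AffineRep.mem_filt_of_span _ (Affine.adjoin_rep hF B hB)
  Φ := Affine.lift hF B hB (wreathData hF B hB n).pbwRep
  comp_Φ := Affine.rep_comp_lift hF B hB _

end Cyclotomic

end

/-! ### Gradings from coactions, and the grading of the tensor power -/

section

open Equiv

/-- A multiplicative family of submodules that is separated by component maps and spans is a
grading. -/
@[reducible] def gradedAlgebraOfComponents {k : Type u} {A : Type v} {G : Type w} [CommRing k] [Ring A]
    [Algebra k A] [AddCommMonoid G] [DecidableEq G] (ℬ : G → Submodule k A)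
    [SetLike.GradedMonoid ℬ]
    (Δ : A →ₗ[k] AddMonoidAlgebra A G)
    (hΔ : ∀ p, ∀ a ∈ ℬ p, Δ a = AddMonoidAlgebra.single p a) (htop : ⨆ p, ℬ p = ⊤) :
    GradedAlgebra ℬ :=
  have hind : iSupIndep ℬ := by
    rw [iSupIndep_def]
    intro p
    rw [Submodule.disjoint_def]
    intro a ha ha'
    have h1 : ∀ b ∈ ⨆ q, ⨆ (_ : q ≠ p), ℬ q, (Δ b).coeff p = 0 := by
      intro b hb
      have h2 : (⨆ q, ⨆ (_ : q ≠ p), ℬ q) ≤ LinearMap.ker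
          ((Finsupp.lapply (R := k) p).comp
            ((AddMonoidAlgebra.coeffLinearEquiv k).toLinearMap.comp Δ)) := by
        refine iSup₂_le fun q hq b hb => ?_
        rw [LinearMap.mem_ker]
        change (Δ b).coeff p = 0
        rw [hΔ q b hb, AddMonoidAlgebra.coeff_single, Finsupp.single_eq_of_ne hq.symm]
      exact h2 hb
    have h3 := h1 a ha'
    rwa [hΔ p a ha, AddMonoidAlgebra.coeff_single, Finsupp.single_eq_same] at h3
  { toGradedMonoid := inferInstance
    toDecomposition :=
      (DirectSum.isInternal_submodule_of_iSupIndep_of_iSup_eq_top hind htop).chooseDecomposition }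

variable {k : Type u} {A : Type v} [CommRing k] [Ring A] [Algebra k A]
  {𝒜 : ℕ × ZMod 2 → Submodule k A} [GradedAlgebra 𝒜] {δ : ℕ} {tr : A →ₗ[k] k}
  (hF : IsFrobenius 𝒜 δ tr) {ι : Type w} [Fintype ι] (B : Module.Basis ι k A)
  (hB : ∀ b, ∃ p, B b ∈ 𝒜 p) {n : ℕ}

namespace SuperTensorPower

theorem pure_mem_grading {q : Fin n → ℕ × ZMod 2} {f : Fin n → A} (hf : ∀ i, f i ∈ 𝒜 (q i)) :
    pure 𝒜 n f ∈ grading 𝒜 n (∑ i, q i) :=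
  Submodule.subset_span ⟨q, f, hf, rfl, rfl⟩

instance : SetLike.GradedMonoid (grading 𝒜 n) where
  one_mem := by
    have h : pure 𝒜 n 1 ∈ grading 𝒜 n (∑ _i : Fin n, 0) :=
      pure_mem_grading fun i => SetLike.GradedOne.one_mem
    rwa [Finset.sum_const_zero] at h
  mul_mem p q a b ha hb := by
    induction ha using Submodule.span_induction with
    | zero => rw [zero_mul]; exact zero_mem _
    | add a a' _ _ h h' => rw [add_mul]; exact add_mem h h'
    | smul r a _ h => rw [smul_mul_assoc]; exact Submodule.smul_mem _ r h
    | mem a ha =>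
      induction hb using Submodule.span_induction with
      | zero => rw [mul_zero]; exact zero_mem _
      | add b b' _ _ h h' => rw [mul_add]; exact add_mem h h'
      | smul r b _ h => rw [mul_smul_comm]; exact Submodule.smul_mem _ r h
      | mem b hb =>
        obtain ⟨q₁, f, hf, rfl, rfl⟩ := ha
        obtain ⟨q₂, g, hg, rfl, rfl⟩ := hb
        rw [pure_mul_pure (fun i => isPar_of_mem (hf i)) fun i => isPar_of_mem (hg i),
          ← Finset.sum_add_distrib]
        exact zsmul_mem (pure_mem_grading (f := f * g) fun i =>
          SetLike.mul_mem_graded (hf i) (hg i)) _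

theorem perm_mem_grading (π : Perm (Fin n)) {p : ℕ × ZMod 2} {a : SuperTensorPower 𝒜 n}
    (ha : a ∈ grading 𝒜 n p) : perm 𝒜 n π a ∈ grading 𝒜 n p := by
  induction ha using Submodule.span_induction with
  | zero => rw [map_zero]; exact zero_mem _
  | add a a' _ _ h h' => rw [map_add]; exact add_mem h h'
  | smul r a _ h => rw [map_smul]; exact Submodule.smul_mem _ r h
  | mem a ha =>
    obtain ⟨q, f, hf, rfl, rfl⟩ := ha
    rw [perm_pure π fun i => isPar_of_mem (hf i), ← Equiv.sum_comp π.symm]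
    exact zsmul_mem (pure_mem_grading fun i => hf (π.symm i)) _

theorem map_mem_grading {g : Fin n → A →ₗ[k] A} (hg : ∀ i q, ∀ a ∈ 𝒜 q, g i a ∈ 𝒜 q)
    {p : ℕ × ZMod 2} {a : SuperTensorPower 𝒜 n} (ha : a ∈ grading 𝒜 n p) :
    map 𝒜 n g a ∈ grading 𝒜 n p := by
  induction ha using Submodule.span_induction with
  | zero => rw [map_zero]; exact zero_mem _
  | add a a' _ _ h h' => rw [map_add]; exact add_mem h h'
  | smul r a _ h => rw [map_smul]; exact Submodule.smul_mem _ r h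
  | mem a ha =>
    obtain ⟨q, f, hf, rfl, rfl⟩ := ha
    rw [map_pure]
    exact pure_mem_grading fun i => hg i _ _ (hf i)

theorem twist_mem_grading (i : Fin n) {p : ℕ × ZMod 2} {a : SuperTensorPower 𝒜 n}
    (ha : a ∈ grading 𝒜 n p) : twist hF n i a ∈ grading 𝒜 n p := by
  rw [twist_eq_mapAt]
  refine map_mem_grading (fun j q b hb => ?_) ha
  by_cases h : j = i
  · subst h; rw [Function.update_self]; exact nakayama_mem hF hb
  · rw [Function.update_of_ne h]; exact hb

theorem single_mem_grading (i : Fin n) {p : ℕ × ZMod 2} {a : A} (ha : a ∈ 𝒜 p) :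
    single 𝒜 n i a ∈ grading 𝒜 n p := by
  have h := pure_mem_grading (n := n) (q := Pi.single i p) (f := Function.update 1 i a)
    (fun j => by
      by_cases h : j = i
      · subst h; rwa [Function.update_self, Pi.single_eq_same]
      · rw [Function.update_of_ne h, Pi.single_eq_of_ne h]; exact SetLike.GradedOne.one_mem)
  rwa [Finset.sum_pi_single', if_pos (Finset.mem_univ i)] at h

-- A basis element and its left dual have degrees adding up to `(δ, 0)`.
include hB in
theorem teleporter_mem_grading (i j : Fin n) :
    teleporter hF B n i j ∈ grading 𝒜 n (δ, 0) := by
  classical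
  refine sum_mem fun b _ => ?_
  obtain ⟨p, hp⟩ := hB b
  rw [← DirectSum.sum_support_decompose 𝒜 (leftDual hF B b)]
  change _ * singleLin j _ ∈ _
  rw [map_sum, Finset.mul_sum]
  refine sum_mem fun q _ => ?_
  by_cases h : q + p = (δ, 0)
  · rw [← h, add_comm]
    exact SetLike.mul_mem_graded (single_mem_grading i hp)
      (single_mem_grading j (SetLike.coe_mem _))
  · rw [leftDual_decompose hF B hB hp h, map_zero, mul_zero]
    exact zero_mem _

include hB in
theorem span_grading : Submodule.span k (⋃ p, (grading 𝒜 n p : Set (SuperTensorPower 𝒜 n))) = ⊤ := by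
  rw [eq_top_iff, ← (basis (𝒜 := 𝒜) B n).span_eq]
  refine Submodule.span_mono ?_
  rintro _ ⟨s, rfl⟩
  rw [basis_apply]
  choose q hq using hB
  exact Set.mem_iUnion.2 ⟨_, pure_mem_grading fun i => hq (s i)⟩

include hB in
theorem grading_ext {M : Type*} [AddCommGroup M] [Module k M] {f g : SuperTensorPower 𝒜 n →ₗ[k] M}
    (h : ∀ p, ∀ a ∈ grading 𝒜 n p, f a = g a) : f = g :=
  LinearMap.ext_on (span_grading B hB) fun a ha => by
    obtain ⟨p, hp⟩ := Set.mem_iUnion.1 ha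
    exact h p a hp

theorem repr_eq_zero_of_mem {p q : ℕ × ZMod 2} {a : A} (ha : a ∈ 𝒜 p) {b : ι} (hb : B b ∈ 𝒜 q)
    (hB : ∀ b, ∃ p, B b ∈ 𝒜 p) (hpq : p ≠ q) : B.repr a b = 0 := by
  classical
  rcases subsingleton_or_nontrivial k with hk | hk
  · exact Subsingleton.elim _ _
  have h : B.coord b ∘ₗ GradedAlgebra.proj 𝒜 p = 0 := by
    refine B.ext fun c => ?_
    obtain ⟨r, hr⟩ := hB c
    rw [LinearMap.comp_apply, GradedAlgebra.proj_apply]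
    by_cases h : r = p
    · subst h
      rw [DirectSum.decompose_of_mem_same 𝒜 hr, Module.Basis.coord_apply,
        Module.Basis.repr_self, LinearMap.zero_apply]
      refine Finsupp.single_eq_of_ne ?_
      rintro rfl
      exact hpq (DirectSum.degree_eq_of_mem_mem 𝒜 hr hb (B.ne_zero b))
    · rw [DirectSum.decompose_of_mem_ne 𝒜 hr h, map_zero, LinearMap.zero_apply]
  have h1 := LinearMap.congr_fun h a
  rwa [LinearMap.comp_apply, GradedAlgebra.proj_apply, DirectSum.decompose_of_mem_same 𝒜 ha] at h1

/-- The linear map underlying the coaction corresponding to the grading. -/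
def coactLin : SuperTensorPower 𝒜 n →ₗ[k] AddMonoidAlgebra (SuperTensorPower 𝒜 n) (ℕ × ZMod 2) :=
  (basis (𝒜 := 𝒜) B n).constr k fun s =>
    AddMonoidAlgebra.single (∑ i, (hB (s i)).choose) (basis (𝒜 := 𝒜) B n s)

theorem coactLin_of_mem {p : ℕ × ZMod 2} {a : SuperTensorPower 𝒜 n} (ha : a ∈ grading 𝒜 n p) :
    coactLin B hB a = AddMonoidAlgebra.single p a := by
  induction ha using Submodule.span_induction with
  | zero => rw [map_zero, AddMonoidAlgebra.single_zero]
  | add a a' _ _ h h' => rw [map_add, h, h', AddMonoidAlgebra.single_add]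
  | smul r a _ h => rw [map_smul, h, AddMonoidAlgebra.smul_single]
  | mem a ha =>
    obtain ⟨q, f, hf, rfl, rfl⟩ := ha
    rw [coactLin, Module.Basis.constr_apply_fintype]
    conv_rhs => rw [← (basis (𝒜 := 𝒜) B n).sum_repr (pure 𝒜 n f),
      ← AddMonoidAlgebra.singleAddHom_apply, map_sum]
    refine Finset.sum_congr rfl fun s _ => ?_
    rw [AddMonoidAlgebra.smul_single, AddMonoidAlgebra.singleAddHom_apply,
      Module.Basis.equivFun_apply, basis_repr]
    -- A homogeneous pure tensor involves only basis tensors of the same degree in each factor; the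
    -- other coefficients vanish.
    by_cases h : ∀ i, q i = (hB (s i)).choose
    · simp_rw [h]
    · obtain ⟨i, hi⟩ := not_forall.1 h
      rw [Finset.prod_eq_zero (Finset.mem_univ i)
        (repr_eq_zero_of_mem B (hf i) (hB (s i)).choose_spec hB hi), zero_smul,
        AddMonoidAlgebra.single_zero, AddMonoidAlgebra.single_zero]

/-- The coaction corresponding to the grading. -/
def coact : SuperTensorPower 𝒜 n →ₐ[k] AddMonoidAlgebra (SuperTensorPower 𝒜 n) (ℕ × ZMod 2) :=
  AlgHom.ofLinearMap (coactLin B hB) (coactLin_of_mem B hB SetLike.GradedOne.one_mem)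
    fun a b => by
      have h1 : (LinearMap.mul k _).compr₂ (coactLin B hB) =
          (LinearMap.mul k _).compl₁₂ (coactLin (𝒜 := 𝒜) (n := n) B hB) (coactLin B hB) :=
        grading_ext B hB fun p a ha => grading_ext B hB fun q b hb => by
          change coactLin B hB (a * b) = coactLin B hB a * coactLin B hB b
          rw [coactLin_of_mem B hB ha, coactLin_of_mem B hB hb,
            coactLin_of_mem B hB (SetLike.mul_mem_graded ha hb),
            AddMonoidAlgebra.single_mul_single]
      exact LinearMap.congr_fun (LinearMap.congr_fun h1 a) b

theorem coact_of_mem {p : ℕ × ZMod 2} {a : SuperTensorPower 𝒜 n} (ha : a ∈ grading 𝒜 n p) :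
    coact B hB a = AddMonoidAlgebra.single p a :=
  coactLin_of_mem B hB ha

end SuperTensorPower

namespace AffineRep

open SuperTensorPower

variable {A' : Type*} [Ring A'] [Algebra k A'] (ρ : AffineRep (wreathData hF B hB n) A')

theorem coact_tens {p : ℕ × ZMod 2} {f : SuperTensorPower 𝒜 n} (hf : f ∈ grading 𝒜 n p) :
    (AddMonoidAlgebra.mapAlgHom (ℕ × ZMod 2) ρ.tens).comp (coact B hB) f =
      AddMonoidAlgebra.single p (ρ.tens f) := by
  rw [AlgHom.comp_apply, coact_of_mem B hB hf, AddMonoidAlgebra.mapAlgHom_single]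

/-- The coaction on a representation of the affine wreath product algebra for which the
variables are even of degree `δ`. -/
def coact : AffineRep (wreathData hF B hB n) (AddMonoidAlgebra A' (ℕ × ZMod 2)) where
  tens := (AddMonoidAlgebra.mapAlgHom _ ρ.tens).comp (SuperTensorPower.coact B hB)
  x i := AddMonoidAlgebra.single (δ, 0) (ρ.x i)
  perm := AddMonoidAlgebra.singleZeroRingHom.toMonoidHom.comp ρ.perm
  x_comm i j := by
    rw [AddMonoidAlgebra.single_mul_single, AddMonoidAlgebra.single_mul_single, ρ.x_comm]
  tens_x f i := by
    set T := (AddMonoidAlgebra.mapAlgHom (ℕ × ZMod 2) ρ.tens).comp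
      (SuperTensorPower.coact (𝒜 := 𝒜) (n := n) B hB) with hT
    have h : LinearMap.mulRight k (AddMonoidAlgebra.single ((δ, 0) : ℕ × ZMod 2) (ρ.x i)) ∘ₗ
        T.toLinearMap = LinearMap.mulLeft k (AddMonoidAlgebra.single (δ, 0) (ρ.x i)) ∘ₗ
        T.toLinearMap ∘ₗ (twist hF n i).toLinearMap := by
      refine grading_ext B hB fun p f hf => ?_
      change T f * _ = _ * T (twist hF n i f)
      rw [hT, coact_tens hF B hB ρ hf, coact_tens hF B hB ρ (twist_mem_grading hF i hf),
        AddMonoidAlgebra.single_mul_single, AddMonoidAlgebra.single_mul_single, add_comm]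
      exact congrArg _ (ρ.tens_x f i)
    exact LinearMap.congr_fun h f
  simple_x_of_ne i i' j h hi hi' := by
    change AddMonoidAlgebra.single 0 _ * _ = _ * AddMonoidAlgebra.single 0 _
    rw [AddMonoidAlgebra.single_mul_single, AddMonoidAlgebra.single_mul_single, add_comm,
      ρ.simple_x_of_ne i i' j h hi hi']
  simple_x i i' h := by
    change AddMonoidAlgebra.single 0 _ * _ = _ * AddMonoidAlgebra.single 0 _ -
      (AddMonoidAlgebra.mapAlgHom _ ρ.tens).comp (SuperTensorPower.coact B hB)
        (teleporter hF B n i i')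
    rw [AddMonoidAlgebra.single_mul_single, AddMonoidAlgebra.single_mul_single,
      coact_tens hF B hB ρ (teleporter_mem_grading hF B hB i i'), add_zero, zero_add,
      ρ.simple_x i i' h, AddMonoidAlgebra.single_sub]
    rfl
  perm_tens π f := by
    set T := (AddMonoidAlgebra.mapAlgHom (ℕ × ZMod 2) ρ.tens).comp
      (SuperTensorPower.coact (𝒜 := 𝒜) (n := n) B hB) with hT
    have h : LinearMap.mulLeft k (AddMonoidAlgebra.single (0 : ℕ × ZMod 2) (ρ.perm π)) ∘ₗ
        T.toLinearMap = LinearMap.mulRight k (AddMonoidAlgebra.single 0 (ρ.perm π)) ∘ₗ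
        T.toLinearMap ∘ₗ SuperTensorPower.perm 𝒜 n π := by
      refine grading_ext B hB fun p f hf => ?_
      change _ * T f =
        T (SuperTensorPower.perm 𝒜 n π f) * _
      rw [hT, coact_tens hF B hB ρ hf, coact_tens hF B hB ρ (perm_mem_grading π hf),
        AddMonoidAlgebra.single_mul_single, AddMonoidAlgebra.single_mul_single, add_comm]
      exact congrArg _ (ρ.perm_tens π f)
    exact LinearMap.congr_fun h f

end AffineRep

end

/-! ### The gradings of the affine algebra and of the cyclotomic quotient -/

section

open Equiv

variable {k : Type u} {F : Type v} [CommRing k] [Ring F] [Algebra k F]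
  {𝒜 : ℕ × ZMod 2 → Submodule k F} [GradedAlgebra 𝒜] {δ : ℕ} {tr : F →ₗ[k] k}
  (hF : IsFrobenius 𝒜 δ tr) {ι : Type w} [Fintype ι] (B : Module.Basis ι k F)
  (hB : ∀ b, ∃ p, B b ∈ 𝒜 p) {n : ℕ}

namespace Affine

theorem IsMonomial.mul {a b : Affine hF B n} {p q : ℕ × ZMod 2} (ha : IsMonomial hF B n a p)
    (hb : IsMonomial hF B n b q) : IsMonomial hF B n (a * b) (p + q) := by
  induction ha with
  | one => rwa [one_mul, zero_add]
  | x_mul i a p _ ih => rw [mul_assoc, add_assoc]; exact .x_mul i _ _ ih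
  | tens_mul f q hf a p _ ih => rw [mul_assoc, add_assoc]; exact .tens_mul f q hf _ _ ih
  | perm_mul π a p _ ih => rw [mul_assoc]; exact .perm_mul π _ _ ih

instance : SetLike.GradedMonoid (grading hF B n) where
  one_mem := Submodule.subset_span .one
  mul_mem p q a b ha hb := by
    have h := Submodule.mul_mem_mul ha hb
    rw [grading, grading, Submodule.span_mul_span] at h
    refine Submodule.span_mono ?_ h
    rintro _ ⟨a, ha, b, hb, rfl⟩
    exact IsMonomial.mul hF B ha hb

theorem x_mem_grading (i : Fin n) : gen hF B n (.x i) ∈ grading hF B n (δ, 0) := by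
  have h := IsMonomial.x_mul i 1 0 (IsMonomial.one (hF := hF) (B := B))
  rw [mul_one, add_zero] at h
  exact Submodule.subset_span h

theorem perm_mem_grading (π : Perm (Fin n)) : gen hF B n (.perm π) ∈ grading hF B n 0 := by
  have h := IsMonomial.perm_mul π 1 0 (IsMonomial.one (hF := hF) (B := B))
  rw [mul_one] at h
  exact Submodule.subset_span h

theorem tens_mem_grading {p : ℕ × ZMod 2} {f : SuperTensorPower 𝒜 n}
    (hf : f ∈ SuperTensorPower.grading 𝒜 n p) : gen hF B n (.tens f) ∈ grading hF B n p := by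
  have h := IsMonomial.tens_mul f p hf 1 0 (IsMonomial.one (hF := hF) (B := B))
  rw [mul_one, add_zero] at h
  exact Submodule.subset_span h

-- The sum of the graded pieces is a subalgebra, and it contains the generators because `F^{⊗n}` is
-- spanned by homogeneous elements.
include hB in
theorem iSup_grading : ⨆ p, grading hF B n p = ⊤ := by
  let S : Subalgebra k (Affine hF B n) := (⨆ p, grading hF B n p).toSubalgebra
    (Submodule.mem_iSup_of_mem 0 SetLike.GradedOne.one_mem) fun a b ha hb => by
      have h := Submodule.mul_mem_mul ha hb
      rw [Submodule.iSup_mul] at h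
      simp_rw [Submodule.mul_iSup] at h
      refine iSup_le (fun p => iSup_le fun q => Submodule.mul_le.2 fun a ha b hb => ?_) h
      exact Submodule.mem_iSup_of_mem (p + q) (SetLike.mul_mem_graded ha hb)
  have hS : S = ⊤ := by
    rw [eq_top_iff, ← adjoin_rep hF B hB, Algebra.adjoin_le_iff]
    rintro _ ((⟨f, rfl⟩ | ⟨π, rfl⟩) | ⟨i, rfl⟩)
    · have h : f ∈ Submodule.span k (⋃ p, (SuperTensorPower.grading 𝒜 n p :
          Set (SuperTensorPower 𝒜 n))) := by
        rw [SuperTensorPower.span_grading B hB]; trivial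
      induction h using Submodule.span_induction with
      | mem f hf =>
        obtain ⟨p, hp⟩ := Set.mem_iUnion.1 hf
        exact Submodule.mem_iSup_of_mem p (tens_mem_grading hF B hp)
      | zero => rw [map_zero]; exact zero_mem S
      | add f g _ _ h h' => rw [map_add]; exact add_mem (S := Subalgebra k _) h h'
      | smul r f _ h => rw [map_smul]; exact Subalgebra.smul_mem S h r
    · exact Submodule.mem_iSup_of_mem 0 (perm_mem_grading hF B π)
    · exact Submodule.mem_iSup_of_mem _ (x_mem_grading hF B i)
  have := congrArg Subalgebra.toSubmodule hS
  rwa [Algebra.top_toSubmodule] at this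

end Affine

namespace Cyclotomic

variable {θ : ℕ} {e : Fin θ → ℕ} (c : ∀ m : Fin θ, Fin (e m) → SuperTensorPower 𝒜 n)

theorem mk_surjective : Function.Surjective (mk hF B c) := RingCon.mk'_surjective _

instance : SetLike.GradedMonoid (grading hF B c) where
  one_mem := ⟨1, SetLike.GradedOne.one_mem, map_one (mk hF B c)⟩
  mul_mem p q a b ha hb := by
    obtain ⟨a, ha, rfl⟩ := ha
    obtain ⟨b, hb, rfl⟩ := hb
    exact ⟨a * b, SetLike.mul_mem_graded ha hb, map_mul (mk hF B c) _ _⟩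

include hB in
theorem iSup_grading : ⨆ p, grading hF B c p = ⊤ := by
  simp_rw [grading]
  rw [← Submodule.map_iSup, Affine.iSup_grading hF B hB, Submodule.map_top,
    LinearMap.range_eq_top]
  exact mk_surjective hF B c

/-- The coaction of the affine wreath product algebra on its cyclotomic quotient. -/
def coactAux : Affine hF B n →ₐ[k] AddMonoidAlgebra (Cyclotomic hF B c) (ℕ × ZMod 2) :=
  Affine.lift hF B hB (((Affine.rep hF B hB n).comp (mk hF B c)).coact hF B hB)

theorem coactAux_x (i : Fin n) : coactAux hF B hB c (Affine.gen hF B n (.x i)) =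
    AddMonoidAlgebra.single (δ, 0) (mk hF B c (Affine.gen hF B n (.x i))) :=
  Affine.lift_gen hF B hB _ (.x i)

theorem coactAux_perm (π : Perm (Fin n)) : coactAux hF B hB c (Affine.gen hF B n (.perm π)) =
    AddMonoidAlgebra.single 0 (mk hF B c (Affine.gen hF B n (.perm π))) :=
  Affine.lift_gen hF B hB _ (.perm π)

theorem coactAux_tens {p : ℕ × ZMod 2} {f : SuperTensorPower 𝒜 n}
    (hf : f ∈ SuperTensorPower.grading 𝒜 n p) :
    coactAux hF B hB c (Affine.gen hF B n (.tens f)) =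
      AddMonoidAlgebra.single p (mk hF B c (Affine.gen hF B n (.tens f))) :=
  (Affine.lift_gen hF B hB _ (.tens f)).trans (AffineRep.coact_tens hF B hB _ hf)

theorem coactAux_of_mem {p : ℕ × ZMod 2} {a : Affine hF B n} (ha : a ∈ Affine.grading hF B n p) :
    coactAux hF B hB c a = AddMonoidAlgebra.single p (mk hF B c a) := by
  induction ha using Submodule.span_induction with
  | zero => rw [map_zero, map_zero, AddMonoidAlgebra.single_zero]
  | add a a' _ _ h h' => rw [map_add, h, h', map_add, AddMonoidAlgebra.single_add]
  | smul r a _ h => rw [map_smul, h, map_smul, AddMonoidAlgebra.smul_single]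
  | mem a ha =>
    induction ha with
    | one => rw [map_one, map_one]; rfl
    | x_mul i a p _ ih =>
      rw [map_mul, coactAux_x, ih, AddMonoidAlgebra.single_mul_single, map_mul]
    | tens_mul f q hf a p _ ih =>
      rw [map_mul, coactAux_tens hF B hB c hf, ih, AddMonoidAlgebra.single_mul_single, map_mul]
    | perm_mul π a p _ ih =>
      rw [map_mul, coactAux_perm, ih, AddMonoidAlgebra.single_mul_single, map_mul, zero_add]

variable {c}
variable (hc : ∀ (m : Fin θ) (j : Fin (e m)),
      c m j ∈ SuperTensorPower.grading 𝒜 n (((m : ℕ) + 1) * δ, 0))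

include hc in
theorem exists_cycPoly_mem_grading (i : Fin n) : ∃ p, cycPoly hF B c i ∈ Affine.grading hF B n p := by
  refine ⟨_, SetLike.list_prod_ofFn_mem_graded _ _ fun m =>
    SetLike.list_prod_ofFn_mem_graded (fun _ => (((m : ℕ) + 1) * δ, 0)) _ fun j => ?_⟩
  refine sub_mem ?_ (Affine.tens_mem_grading hF B (hc m j))
  have h := SetLike.pow_mem_graded ((m : ℕ) + 1) (Affine.x_mem_grading hF B i)
  rwa [Prod.smul_mk, smul_zero, smul_eq_mul] at h

-- The cyclotomic polynomial is homogeneous, so the coaction sends it to its own image in one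
-- degree, which is zero; its kernel is an ideal.
include hc in
theorem coactAux_eq_zero {a : Affine hF B n} (ha : mk hF B c a = 0) :
    coactAux hF B hB c a = 0 := by
  have h : cycIdeal hF B c ≤ TwoSidedIdeal.ker (coactAux hF B hB c) := by
    refine TwoSidedIdeal.span_le.2 ?_
    rintro _ ⟨i, hi, rfl⟩
    obtain ⟨p, hp⟩ := exists_cycPoly_mem_grading hF B hc i
    rw [SetLike.mem_coe, TwoSidedIdeal.mem_ker, coactAux_of_mem hF B hB c hp,
      (mk_eq_zero hF B).2 (TwoSidedIdeal.subset_span ⟨i, hi, rfl⟩), AddMonoidAlgebra.single_zero]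
  exact (TwoSidedIdeal.mem_ker _).1 (h ((mk_eq_zero hF B).1 ha))

/-- The coaction on the cyclotomic quotient corresponding to its grading. -/
def coact : Cyclotomic hF B c →ₗ[k] AddMonoidAlgebra (Cyclotomic hF B c) (ℕ × ZMod 2) :=
  ((LinearMap.ker (mk hF B c).toLinearMap).liftQ (coactAux hF B hB c).toLinearMap
    fun _ ha => coactAux_eq_zero hF B hB hc ha) ∘ₗ
    ((mk hF B c).toLinearMap.quotKerEquivOfSurjective (mk_surjective hF B c)).symm.toLinearMap

theorem coact_mk (a : Affine hF B n) :
    coact hF B hB hc (mk hF B c a) = coactAux hF B hB c a := by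
  have h : ((mk hF B c).toLinearMap.quotKerEquivOfSurjective (mk_surjective hF B c)).symm
      (mk hF B c a) = Submodule.Quotient.mk a := by
    rw [LinearEquiv.symm_apply_eq]; rfl
  rw [coact, LinearMap.comp_apply, LinearEquiv.coe_coe, h]
  rfl

/-- The cyclotomic wreath product algebra is graded. -/
@[reducible] def gradedAlgebra : GradedAlgebra (grading hF B c) :=
  gradedAlgebraOfComponents _ (coact hF B hB hc) (by
    rintro p _ ⟨a, ha, rfl⟩
    exact (coact_mk hF B hB hc a).trans (coactAux_of_mem hF B hB c ha)) (iSup_grading hF B hB c)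

end Cyclotomic

end

/-! ### Criteria for Frobenius traces and Nakayama automorphisms, and tensor powers of `ψ` -/

section

open Equiv

section Frobenius

variable {k : Type u} {A : Type v} [CommRing k] [Ring A] [Algebra k A]
  {𝒜 : ℕ × ZMod 2 → Submodule k A} [GradedAlgebra 𝒜] {δ : ℕ} {tr : A →ₗ[k] k}

/-- A homogeneous linear form with `a ↦ (b ↦ tr (b a))` bijective is a Frobenius trace. -/
theorem isFrobenius_of_bijective (hfin : Module.Finite k A) (hproj : Module.Projective k A)
    (hom : ∀ p : ℕ × ZMod 2, p ≠ (δ, 0) → ∀ a ∈ 𝒜 p, tr a = 0)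
    (hbij : Function.Bijective ((LinearMap.mul k A).compr₂ tr).flip) :
    IsFrobenius 𝒜 δ tr where
  finite := hfin
  projective := hproj
  homogeneous := hom
  bijective := by
    have h1 : ∀ a, tr (parityProj 𝒜 1 a) = 0 := by
      intro a
      induction a using DirectSum.Decomposition.inductionOn 𝒜 with
      | zero => simp
      | @homogeneous p m =>
        rw [parityProj_of_mem _ m.2]
        split_ifs with h
        · exact hom p (fun e => by rw [e] at h; exact absurd h zero_ne_one) _ m.2
        · exact map_zero _
      | add a b ha hb => rw [map_add, map_add, ha, hb, add_zero]
    have h2 : ∀ ε η a b, η ≠ ε → tr (parityProj 𝒜 η b * parityProj 𝒜 ε a) = 0 := by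
      intro ε η a b h
      have h3 := h1 (parityProj 𝒜 η b * parityProj 𝒜 ε a)
      rwa [parityProj_mul, if_pos] at h3
      clear h3; revert ε η; decide
    have h3 : ⇑(traceForm 𝒜 tr) = ((LinearMap.mul k A).compr₂ tr).flip ∘ parityInv 𝒜 := by
      funext a
      ext b
      have e1 : traceForm 𝒜 tr a b = ∑ ε, ∑ η, paritySign (ε * η) •
          tr (parityProj 𝒜 η b * parityProj 𝒜 ε a) := by
        rw [traceForm, signed_apply]; rfl
      change _ = tr (b * parityInv 𝒜 a)
      rw [e1, parityInv_apply, Finset.mul_sum, map_sum]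
      refine Finset.sum_congr rfl fun ε _ => ?_
      conv_rhs => rw [← sum_parityProj (𝒜 := 𝒜) b, Finset.sum_mul, map_sum]
      refine Finset.sum_congr rfl fun η _ => ?_
      rw [mul_smul_comm, map_zsmul]
      by_cases h : η = ε
      · subst h
        congr 1
        revert η; decide
      · rw [h2 ε η a b h, smul_zero, smul_zero]
    rw [h3]
    exact hbij.comp (Function.Involutive.bijective parityInv_parityInv)

variable (hF : IsFrobenius 𝒜 δ tr)

/-- Only `c` of the same parity as `a` pair nontrivially, so the sign may be taken to depend on the
parity of `a` alone. -/
theorem nakayama_eq_of_tr_mul {ε : ZMod 2} {a b : A} (ha : IsPar 𝒜 ε a) (hb : IsPar 𝒜 ε b)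
    (h : ∀ c, tr (a * c) = paritySign ε • tr (c * b)) : nakayama hF a = b := by
  refine hF.eq_of_tr_mul fun c => ?_
  rw [← sum_parityProj (𝒜 := 𝒜) c, Finset.sum_mul, Finset.sum_mul, map_sum, map_sum]
  refine Finset.sum_congr rfl fun η _ => ?_
  have hc := isPar_proj (𝒜 := 𝒜) η c
  by_cases hη : η = ε
  · subst hη
    have h1 := tr_mul_nakayama hF ha hc
    rw [h, show η * η = η by clear * -; revert η; decide] at h1
    have h2 := congrArg (fun z => paritySign η • z) h1
    simp only [smul_smul, paritySign_mul_self, one_smul] at h2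
    exact h2.symm
  · rw [hF.tr_mul_eq_zero hc (ha.nakayama hF) hη, hF.tr_mul_eq_zero hc hb hη]

namespace SuperTensorPower

variable {n : ℕ}

/-- The tensor product of powers of the Nakayama automorphism. -/
def nakayamaPow (m : Fin n → ℕ) : SuperTensorPower 𝒜 n ≃ₐ[k] SuperTensorPower 𝒜 n :=
  mapEquiv (fun i => nakayama hF ^ m i) fun i _ _ ha => ha.nakayama_pow hF (m i)

theorem nakayamaPow_apply (m : Fin n → ℕ) (f : SuperTensorPower 𝒜 n) :
    nakayamaPow hF m f = map 𝒜 n (fun i => (nakayama hF ^ m i).toLinearMap) f := rfl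

theorem nakayamaPow_single (m : Fin n → ℕ) (i : Fin n) (a : A) :
    nakayamaPow hF m (single 𝒜 n i a) = single 𝒜 n i ((nakayama hF ^ m i) a) := by
  rw [nakayamaPow_apply, map_single fun i => map_one (nakayama hF ^ m i)]; rfl

theorem nakayamaPow_zero (f : SuperTensorPower 𝒜 n) : nakayamaPow hF 0 f = f := by
  have h : (nakayamaPow hF (n := n) 0).toAlgHom = AlgHom.id k _ :=
    algHom_ext fun i a => by
      change nakayamaPow hF 0 _ = single 𝒜 n i a
      rw [nakayamaPow_single]; rfl
  exact DFunLike.congr_fun h f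

theorem nakayamaPow_add (m l : Fin n → ℕ) (f : SuperTensorPower 𝒜 n) :
    nakayamaPow hF (m + l) f = nakayamaPow hF m (nakayamaPow hF l f) := by
  have h : (nakayamaPow hF (m + l)).toAlgHom =
      (nakayamaPow hF m).toAlgHom.comp (nakayamaPow hF l).toAlgHom :=
    algHom_ext fun i a => by
      change nakayamaPow hF _ _ = nakayamaPow hF _ (nakayamaPow hF _ _)
      rw [nakayamaPow_single, nakayamaPow_single, nakayamaPow_single, Pi.add_apply, pow_add]
      rfl
  exact DFunLike.congr_fun h f

theorem nakayamaPow_pi_single (i : Fin n) (m : ℕ) (f : SuperTensorPower 𝒜 n) :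
    nakayamaPow hF (Pi.single i m) f = (twist hF n i ^ m) f := by
  have h : (nakayamaPow hF (Pi.single i m)).toAlgHom = (twist hF n i ^ m).toAlgHom :=
    algHom_ext fun j a => by
      change nakayamaPow hF _ _ = (twist hF n i ^ m) _
      rw [nakayamaPow_single, twist_pow_single, Pi.single_apply]
  exact DFunLike.congr_fun h f

theorem nakayamaPow_mem (m : Fin n → ℕ) {p : ℕ × ZMod 2} {f : SuperTensorPower 𝒜 n}
    (hf : f ∈ grading 𝒜 n p) : nakayamaPow hF m f ∈ grading 𝒜 n p := by
  refine map_mem_grading (fun i q a ha => ?_) hf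
  change (nakayama hF ^ m i) a ∈ 𝒜 q
  induction m i with
  | zero => exact ha
  | succ l ih => rw [pow_succ', AlgEquiv.mul_apply]; exact nakayama_mem hF ih

theorem inv_of_mem {p : ℕ × ZMod 2} {f : SuperTensorPower 𝒜 n} (hf : f ∈ grading 𝒜 n p) :
    inv n 𝒜 f = paritySign p.2 • f := by
  induction hf using Submodule.span_induction with
  | zero => rw [map_zero, smul_zero]
  | add a a' _ _ h h' => rw [map_add, h, h', smul_add]
  | smul r a _ h => rw [map_smul, h, smul_comm]
  | mem a ha =>
    obtain ⟨q, f, hf, rfl, rfl⟩ := ha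
    rw [inv, map_pure]
    have h1 : (fun i => parityInv 𝒜 (f i)) = fun i => paritySign (1 * (q i).2) • f i :=
      funext fun i => by rw [(isPar_of_mem (hf i)).parityInv, one_mul]
    rw [h1, pure_paritySign (fun _ => 1) (fun i => (q i).2)]
    congr 2
    simp [Prod.snd_sum]

theorem trace_of_mem (hF : IsFrobenius 𝒜 δ tr) {p : ℕ × ZMod 2} (hp : p ≠ (n * δ, 0)) {f : SuperTensorPower 𝒜 n}
    (hf : f ∈ grading 𝒜 n p) : trace 𝒜 n tr f = 0 := by
  induction hf using Submodule.span_induction with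
  | zero => rw [map_zero]
  | add a a' _ _ h h' => rw [map_add, h, h', add_zero]
  | smul r a _ h => rw [map_smul, h, smul_zero]
  | mem a ha =>
    obtain ⟨q, f, hf, rfl, rfl⟩ := ha
    rw [trace_pure]
    have : ∃ i, q i ≠ (δ, 0) := by
      by_contra! h
      apply hp
      simp [h]
    obtain ⟨i, hi⟩ := this
    exact Finset.prod_eq_zero (Finset.mem_univ i) (hF.homogeneous _ hi _ (hf i))

variable {ι : Type w} [Fintype ι] (B : Module.Basis ι k A) (hB : ∀ b, ∃ p, B b ∈ 𝒜 p)

-- Only positions `i` and `j` matter: `Ψ_j` takes `t_{i,j}` to `t_{j,i}` and `Ψ_i` takes it back.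
include hB in
theorem nakayamaPow_teleporter {i j : Fin n} (hij : i ≠ j) (m : ℕ) :
    nakayamaPow hF (fun _ => m) (teleporter hF B n i j) = teleporter hF B n i j := by
  have h0 : nakayamaPow hF (fun _ => 1) (teleporter hF B n i j) = teleporter hF B n i j := by
    obtain ⟨par, hpar, hpar'⟩ := exists_parity hF B hB
    have h1 := congrArg (twist hF n i) (twist_teleporter hF B hpar hpar' hij)
    rw [twist_teleporter hF B hpar hpar' hij.symm] at h1
    refine Eq.trans ?_ h1
    simp only [teleporter, map_sum, map_mul, twist_single, nakayamaPow_single, if_neg hij,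
      if_neg hij.symm, if_true, pow_one]
  induction m with
  | zero => exact nakayamaPow_zero hF _
  | succ m ih =>
    have : (fun _ : Fin n => m + 1) = (fun _ => m) + fun _ => 1 := rfl
    rw [this, nakayamaPow_add, h0, ih]

end SuperTensorPower

namespace AffineRep

open SuperTensorPower

variable {n : ℕ} {ι : Type w} [Fintype ι] {B : Module.Basis ι k A} {hB : ∀ b, ∃ p, B b ∈ 𝒜 p}
  {A' : Type*} [Ring A'] [Algebra k A'] (ρ : AffineRep (wreathData hF B hB n) A')

theorem tens_xPow (α : Fin n → ℕ) (f : SuperTensorPower 𝒜 n) :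
    ρ.tens f * ρ.xPow α = ρ.xPow α * ρ.tens (nakayamaPow hF α f) := by
  have key : ∀ (s : Finset (Fin n)) f, ρ.tens f * ρ.xPow (∑ i ∈ s, Pi.single i (α i)) =
      ρ.xPow (∑ i ∈ s, Pi.single i (α i)) *
        ρ.tens (nakayamaPow hF (∑ i ∈ s, Pi.single i (α i)) f) := by
    intro s
    induction s using Finset.induction_on with
    | empty => intro f; rw [Finset.sum_empty, ρ.xPow_zero, nakayamaPow_zero, one_mul, mul_one]
    | insert i s hi ih =>
      intro f
      rw [Finset.sum_insert hi, ρ.xPow_add, ρ.xPow_single, ← mul_assoc, ρ.tens_x_pow, mul_assoc,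
        ih, ← mul_assoc]
      congr 2
      rw [add_comm, nakayamaPow_add, nakayamaPow_pi_single]
      rfl
  have h := key Finset.univ f
  rwa [Finset.univ_sum_single] at h

end AffineRep

end Frobenius

end

/-! ### The Frobenius trace of the cyclotomic quotient -/

section

open Equiv

variable {k : Type u} {F : Type v} [CommRing k] [Ring F] [Algebra k F]
  {𝒜 : ℕ × ZMod 2 → Submodule k F} [GradedAlgebra 𝒜] {δ : ℕ} {tr : F →ₗ[k] k}
  (hF : IsFrobenius 𝒜 δ tr) {ι : Type w} [Fintype ι] (B : Module.Basis ι k F)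
  (hB : ∀ b, ∃ p, B b ∈ 𝒜 p) {n : ℕ}
  {θ : ℕ} {e : Fin θ → ℕ} {c : ∀ m : Fin θ, Fin (e m) → SuperTensorPower 𝒜 n}
  (hc : ∀ (m : Fin θ) (j : Fin (e m)),
      c m j ∈ SuperTensorPower.grading 𝒜 n (((m : ℕ) + 1) * δ, 0))
  (hc' : ∀ (m : Fin θ) (j : Fin (e m)) (i : Fin n), (i : ℕ) = 0 →
      c m j ∈ shiftSpace hF n i ((m : ℕ) + 1))

namespace Cyclotomic

open SuperTensorPower

/-- The trace map of the cyclotomic wreath product algebra. -/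
def trace : Cyclotomic hF B c →ₗ[k] k :=
  (cycQuotient hF B hB hc hc').traceMap (wreathTrace hF B hB n)

theorem xPow_eq (α : Fin n → ℕ) :
    xPow hF B c α = mk hF B c ((Affine.rep hF B hB n).xPow α) :=
  AffineRep.comp_xPow (Affine.rep hF B hB n) (mk hF B c) α

theorem monomial_eq (α : Fin n → ℕ) (f : SuperTensorPower 𝒜 n) (π : Perm (Fin n)) :
    xPow hF B c α * tens hF B c f * perm hF B c π = mk hF B c
      ((Affine.rep hF B hB n).xPow α * (Affine.rep hF B hB n).tens f *
        (Affine.rep hF B hB n).perm π) := by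
  rw [xPow_eq hF B hB, map_mul, map_mul]
  rfl

theorem isTopTrace_trace : IsTopTrace hF B c (level e) (trace hF B hB hc hc') := by
  intro α f π hα
  rw [monomial_eq hF B hB]
  exact (cycQuotient hF B hB hc hc').traceMap_tens_perm (wreathTrace hF B hB n) hα f π

theorem eq_trace {T : Cyclotomic hF B c →ₗ[k] k} (hT : IsTopTrace hF B c (level e) T) :
    T = trace hF B hB hc hc' :=
  (cycQuotient hF B hB hc hc').eq_traceMap (wreathTrace hF B hB n) fun α f π hα => by
    have h := hT α f π hα
    rwa [monomial_eq hF B hB] at h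

theorem monomial_mem_grading (α : Fin n → ℕ) {p : ℕ × ZMod 2} {f : SuperTensorPower 𝒜 n}
    (hf : f ∈ SuperTensorPower.grading 𝒜 n p) (π : Perm (Fin n)) :
    xPow hF B c α * tens hF B c f * perm hF B c π ∈ grading hF B c ((∑ i, α i) • (δ, 0) + p) := by
  have h1 : xPow hF B c α ∈ grading hF B c ((∑ i, α i) • (δ, 0)) := by
    have h2 := SetLike.list_prod_ofFn_mem_graded (A := grading hF B c) (fun i => α i • (δ, 0))
      (fun i => x hF B c i ^ α i) fun i => SetLike.pow_mem_graded (α i)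
        ⟨_, Affine.x_mem_grading hF B i, rfl⟩
    rwa [List.sum_ofFn, ← Finset.sum_smul] at h2
  have h3 : perm hF B c π ∈ grading hF B c 0 := ⟨_, Affine.perm_mem_grading hF B π, rfl⟩
  have h4 := SetLike.mul_mem_graded (SetLike.mul_mem_graded h1
    (show tens hF B c f ∈ grading hF B c p from ⟨_, Affine.tens_mem_grading hF B hf, rfl⟩)) h3
  rwa [add_zero] at h4

/-- The trace precomposed with the projection to degree `(n * level e * δ, 0)` has the same values
on reduced monomials, hence equals the trace by uniqueness. -/
theorem trace_of_mem {p : ℕ × ZMod 2} (hp : p ≠ (n * level e * δ, 0)) {a : Cyclotomic hF B c}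
    (ha : a ∈ grading hF B c p) : trace hF B hB hc hc' a = 0 := by
  have hcoact : ∀ q, ∀ a ∈ grading hF B c q, coact hF B hB hc a = AddMonoidAlgebra.single q a := by
    rintro q _ ⟨a, ha, rfl⟩
    exact (coact_mk hF B hB hc a).trans (coactAux_of_mem hF B hB c ha)
  let pr : Cyclotomic hF B c →ₗ[k] Cyclotomic hF B c :=
    (Finsupp.lapply (R := k) (n * level e * δ, 0)).comp
      ((AddMonoidAlgebra.coeffLinearEquiv k).toLinearMap.comp (coact hF B hB hc))
  have hpr : ∀ q, ∀ a ∈ grading hF B c q, pr a = if q = (n * level e * δ, 0) then a else 0 := by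
    intro q a ha
    change (coact hF B hB hc a).coeff _ = _
    rw [hcoact q a ha, AddMonoidAlgebra.coeff_single, Finsupp.single_apply]
  have hT : IsTopTrace hF B c (level e) (trace hF B hB hc hc' ∘ₗ pr) := by
    intro α f π hα
    rw [← isTopTrace_trace hF B hB hc hc' α f π hα]
    let M : SuperTensorPower 𝒜 n →ₗ[k] Cyclotomic hF B c :=
      LinearMap.mulRight k (perm hF B c π) ∘ₗ LinearMap.mulLeft k (xPow hF B c α) ∘ₗ
        ((Affine.rep hF B hB n).comp (mk hF B c)).tens.toLinearMap
    have key : (trace hF B hB hc hc' ∘ₗ pr) ∘ₗ M = trace hF B hB hc hc' ∘ₗ M := by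
      refine grading_ext B hB fun q f hf => ?_
      change trace hF B hB hc hc' (pr (xPow hF B c α * tens hF B c f * perm hF B c π)) =
        trace hF B hB hc hc' (xPow hF B c α * tens hF B c f * perm hF B c π)
      rw [hpr _ _ (monomial_mem_grading hF B α hf π)]
      split_ifs with h
      · rfl
      · rw [map_zero, isTopTrace_trace hF B hB hc hc' α f π hα]
        split_ifs with h1
        · refine (SuperTensorPower.trace_of_mem hF (fun hq => h ?_) hf).symm
          -- The top monomial contributes degree `n(d-1)δ` and `tr^{⊗n}` detects degree `nδ`;
          -- together they make `ndδ`.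
          have h2 : ∑ i, α i + n = n * level e := by
            have h3 := Finset.sum_congr (rfl : Finset.univ = Finset.univ) fun i _ => h1.1 i
            simpa [Finset.sum_add_distrib] using h3
          rw [hq, ← h2, Prod.smul_mk, smul_zero, Prod.mk_add_mk, add_zero, smul_eq_mul, add_mul]
        · rfl
    exact LinearMap.congr_fun key f
  have h := LinearMap.congr_fun (eq_trace hF B hB hc hc' hT) a
  rw [← h, LinearMap.comp_apply, hpr p a ha, if_neg hp, map_zero]

theorem isFrobenius : letI := gradedAlgebra hF B hB hc
    IsFrobenius (grading hF B c) (n * level e * δ) (trace hF B hB hc hc') := by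
  let := gradedAlgebra hF B hB hc
  have h1 : Module.Finite k (SuperTensorPower 𝒜 n) := Module.Finite.of_basis (basis B n)
  have h2 : Module.Free k (SuperTensorPower 𝒜 n) := Module.Free.of_basis (basis B n)
  have h3 := (cycQuotient hF B hB hc hc').finite_free
  have h4 := h3.2
  exact isFrobenius_of_bijective h3.1 inferInstance
    (fun p hp a ha => trace_of_mem hF B hB hc hc' hp ha)
    ((cycQuotient hF B hB hc hc').traceMap_bijective (wreathTrace hF B hB n))

theorem trace_perm_mul (π : Perm (Fin n)) (a : Cyclotomic hF B c) :
    trace hF B hB hc hc' (perm hF B c π * a) = trace hF B hB hc hc' (a * perm hF B c π) :=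
  (cycQuotient hF B hB hc hc').traceMap_perm (wreathTrace hF B hB n) π a

/-- The truncated `level e - 1` is the true exponent only for positive level; for `n = 0` there are
no factors to compare. -/
theorem nakayamaPow_level (h : n = 0 ∨ 0 < level e) (f : SuperTensorPower 𝒜 n) :
    nakayamaPow hF (fun _ => level e - 1) (nakayamaPow hF (fun _ => 1) f) =
      nakayamaPow hF (fun _ => level e) f := by
  rw [← nakayamaPow_add]
  congr 2
  funext i
  have := i.pos
  simp only [Pi.add_apply]
  omega

-- At level zero no exponent is less than `d`, so the spanning set of reduced monomials is empty.
include hB hc hc' in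
theorem subsingleton (hn : n ≠ 0) (h : level e = 0) : Subsingleton (Cyclotomic hF B c) := by
  have h1 := (cycQuotient hF B hB hc hc').span_tens_perm
  have : NeZero n := ⟨hn⟩
  have h2 : {a | ∃ α f π, (∀ i, α i < level e) ∧ a = (cycQuotient hF B hB hc hc').Q
      ((Affine.rep hF B hB n).xPow α * (Affine.rep hF B hB n).tens f *
        (Affine.rep hF B hB n).perm π)} = ∅ := by
    rw [Set.eq_empty_iff_forall_notMem]
    rintro _ ⟨α, f, π, hα, -⟩
    have := hα 0
    omega
  rw [h2, Submodule.span_empty] at h1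
  exact (Submodule.subsingleton_iff k).1 (subsingleton_of_bot_eq_top h1)

/-- The top monomial contributes `ψ^{d-1}` in each factor and `tr^{⊗n}` contributes `ψ` with the
parity involution, which is a sign on homogeneous `f`. -/
theorem trace_tens_mul (h : n = 0 ∨ 0 < level e) {p : ℕ × ZMod 2} {f : SuperTensorPower 𝒜 n}
    (hf : f ∈ SuperTensorPower.grading 𝒜 n p) (a : Cyclotomic hF B c) :
    trace hF B hB hc hc' (tens hF B c f * a) = paritySign p.2 • trace hF B hB hc hc'
      (a * tens hF B c (nakayamaPow hF (fun _ => level e) f)) := by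
  have h1 := (cycQuotient hF B hB hc hc').traceMap_tens (wreathTrace hF B hB n)
    (ν := fun f => inv n 𝒜 (nakayamaPow hF (fun _ => 1) f))
    (e := nakayamaPow hF fun _ => level e - 1)
    (fun f g => by
      have := trace_mul_comm hF f g
      simp only [nakayamaPow_apply, pow_one]
      exact this)
    (fun α hα f => by
      rw [AffineRep.tens_xPow hF]
      congr 4
      funext i
      have := hα i
      omega) f a
  have h2 : nakayamaPow hF (fun _ => level e - 1) (inv n 𝒜 (nakayamaPow hF (fun _ => 1) f)) =
      paritySign p.2 • nakayamaPow hF (fun _ => level e) f := by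
    rw [inv_of_mem (nakayamaPow_mem hF _ hf), map_zsmul, nakayamaPow_level hF h]
  beta_reduce at h1
  rw [h2, map_zsmul, map_zsmul, mul_smul_comm, map_zsmul] at h1
  exact h1

theorem trace_x_mul (i : Fin n) (a : Cyclotomic hF B c) :
    trace hF B hB hc hc' (x hF B c i * a) = trace hF B hB hc hc' (a * x hF B c i) := by
  rcases Nat.eq_zero_or_pos (level e) with h0 | h0
  · have := subsingleton hF B hB hc hc' (i.pos).ne' h0
    rw [Subsingleton.elim (x hF B c i * a) (a * x hF B c i)]
  refine (cycQuotient hF B hB hc hc').traceMap_x (wreathTrace hF B hB n)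
    (c₀ := fun _ => subleading c) (fun o ho => ?_)
    (fun o ho => (isCyclotomic_cycPoly hF B hB hc hc' o ho).twist_eq) (fun i j a hij => ?_) i a
  · rw [cycFamily_first hF B hB hc hc' ho]
    rcases (isCyclotomic_cycPoly hF B hB hc hc' o ho).leading with ⟨h, -⟩ | ⟨m, h, hm⟩
    · omega
    · rw [h]; exact hm
  -- Teleporters are even and fixed by the tensor power of `ψ^d`, so they are trace-central, as the
  -- Jucys-Murphy corrections require.
  · have h := trace_tens_mul hF B hB hc hc' (Or.inr h0) (teleporter_mem_grading hF B hB i j) a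
    rw [nakayamaPow_teleporter hF B hB hij, paritySign_zero, one_smul] at h
    exact h

end Cyclotomic

end

/-! ### The Nakayama automorphism of the cyclotomic quotient -/

section

open Equiv

variable {k : Type u} {F : Type v} [CommRing k] [Ring F] [Algebra k F]
  {𝒜 : ℕ × ZMod 2 → Submodule k F} [GradedAlgebra 𝒜] {δ : ℕ} {tr : F →ₗ[k] k}
  (hF : IsFrobenius 𝒜 δ tr) {ι : Type w} [Fintype ι] (B : Module.Basis ι k F)
  (hB : ∀ b, ∃ p, B b ∈ 𝒜 p) {n : ℕ}
  {θ : ℕ} {e : Fin θ → ℕ} {c : ∀ m : Fin θ, Fin (e m) → SuperTensorPower 𝒜 n}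
  (hc : ∀ (m : Fin θ) (j : Fin (e m)),
      c m j ∈ SuperTensorPower.grading 𝒜 n (((m : ℕ) + 1) * δ, 0))
  (hc' : ∀ (m : Fin θ) (j : Fin (e m)) (i : Fin n), (i : ℕ) = 0 →
      c m j ∈ shiftSpace hF n i ((m : ℕ) + 1))

namespace Cyclotomic

open SuperTensorPower

variable [GradedAlgebra (grading hF B c)]
  (hC : IsFrobenius (grading hF B c) (n * level e * δ) (trace hF B hB hc hc'))

theorem nakayama_x (i : Fin n) : nakayama hC (x hF B c i) = x hF B c i := by
  have h : IsPar (grading hF B c) 0 (x hF B c i) :=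
    isPar_of_mem (p := (δ, 0)) ⟨_, Affine.x_mem_grading hF B i, rfl⟩
  refine nakayama_eq_of_tr_mul hC h h fun a => ?_
  rw [trace_x_mul, paritySign_zero, one_smul]

theorem nakayama_perm (π : Perm (Fin n)) : nakayama hC (perm hF B c π) = perm hF B c π := by
  have h : IsPar (grading hF B c) 0 (perm hF B c π) :=
    isPar_of_mem (p := 0) ⟨_, Affine.perm_mem_grading hF B π, rfl⟩
  refine nakayama_eq_of_tr_mul hC h h fun a => ?_
  rw [trace_perm_mul, paritySign_zero, one_smul]

theorem nakayama_tens (f : SuperTensorPower 𝒜 n) : nakayama hC (tens hF B c f) =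
    tens hF B c (map 𝒜 n (fun _ => (nakayama hF ^ level e).toLinearMap) f) := by
  by_cases h : n = 0 ∨ 0 < level e
  · let M : SuperTensorPower 𝒜 n →ₗ[k] Cyclotomic hF B c :=
      ((Affine.rep hF B hB n).comp (mk hF B c)).tens.toLinearMap
    have key : (nakayama hC).toLinearMap ∘ₗ M =
        M ∘ₗ (nakayamaPow hF fun _ => level e).toLinearMap := by
      refine grading_ext B hB fun p f hf => ?_
      change nakayama hC (tens hF B c f) = tens hF B c (nakayamaPow hF (fun _ => level e) f)
      exact nakayama_eq_of_tr_mul hC (isPar_of_mem ⟨_, Affine.tens_mem_grading hF B hf, rfl⟩)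
        (isPar_of_mem ⟨_, Affine.tens_mem_grading hF B (nakayamaPow_mem hF _ hf), rfl⟩)
        fun a => trace_tens_mul hF B hB hc hc' h hf a
    exact LinearMap.congr_fun key f
  -- With `n > 0` and level zero the quotient is trivial, so the excluded case costs nothing.
  · have := subsingleton hF B hB hc hc' (fun h' => h (Or.inl h')) (by omega)
    exact Subsingleton.elim _ _

include hB in
theorem algEquiv_eq_refl {φ : Cyclotomic hF B c ≃ₐ[k] Cyclotomic hF B c}
    (hx : ∀ i, φ (x hF B c i) = x hF B c i) (ht : ∀ f, φ (tens hF B c f) = tens hF B c f)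
    (hp : ∀ π, φ (perm hF B c π) = perm hF B c π) : φ = AlgEquiv.refl := by
  have h : φ.toAlgHom.comp (mk hF B c) = mk hF B c := by
    refine AlgHom.ext_of_adjoin_eq_top (Affine.adjoin_rep hF B hB) ?_
    rintro _ ((⟨f, rfl⟩ | ⟨π, rfl⟩) | ⟨i, rfl⟩)
    · exact ht f
    · exact hp π
    · exact hx i
  ext a
  obtain ⟨a, rfl⟩ := mk_surjective hF B c a
  exact DFunLike.congr_fun h a

theorem nakayama_eq_refl (h : nakayama hF ^ level e = 1) : nakayama hC = AlgEquiv.refl :=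
  algEquiv_eq_refl hF B hB (nakayama_x hF B hB hc hc' hC)
    (fun f => by
      rw [nakayama_tens, h]
      congr 1
      exact LinearMap.congr_fun PiTensorProduct.map_id f)
    (nakayama_perm hF B hB hc hc' hC)

end Cyclotomic

end

end

end AffineWreath

theorem mainTheorem3 {k : Type*} [CommRing k] (hk : ringChar k ≠ 2)
    {F : Type*} [Ring F] [Algebra k F]
    (𝒜 : ℕ × ZMod 2 → Submodule k F) [GradedAlgebra 𝒜]
    {δ : ℕ} {tr : F →ₗ[k] k} (hF : IsFrobenius 𝒜 δ tr)
    {ι : Type*} [Fintype ι] (B : Module.Basis ι k F) (hB : ∀ b, ∃ p, B b ∈ 𝒜 p)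
    (hθ : 0 < orderOf (nakayama hF))
    (hchar : ¬ ringChar k ∣ orderOf (nakayama hF))
    (hdiag : ∃ E : Module.Basis ι k F, ∀ b, ∃ ω : k, nakayama hF (E b) = ω • E b)
    (n : ℕ) (e : Fin (orderOf (nakayama hF)) → ℕ)
    (c : ∀ m : Fin (orderOf (nakayama hF)), Fin (e m) → SuperTensorPower 𝒜 n)
    (hc : ∀ (m : Fin (orderOf (nakayama hF))) (j : Fin (e m)),
      c m j ∈ SuperTensorPower.grading 𝒜 n (((m : ℕ) + 1) * δ, 0))
    (hc' : ∀ (m : Fin (orderOf (nakayama hF))) (j : Fin (e m)) (i : Fin n), (i : ℕ) = 0 →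
      c m j ∈ shiftSpace hF n i ((m : ℕ) + 1)) :
    ∃ trC : Cyclotomic hF B c →ₗ[k] k,
      (Cyclotomic.IsTopTrace hF B c (level e) trC ∧
        ∀ T : Cyclotomic hF B c →ₗ[k] k,
          Cyclotomic.IsTopTrace hF B c (level e) T → T = trC) ∧
      ∃ (_ : GradedAlgebra (Cyclotomic.grading hF B c))
        (hC : IsFrobenius (Cyclotomic.grading hF B c) (n * level e * δ) trC),
        (∀ i : Fin n, nakayama hC (Cyclotomic.x hF B c i) = Cyclotomic.x hF B c i) ∧
        (∀ f : SuperTensorPower 𝒜 n, nakayama hC (Cyclotomic.tens hF B c f) =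
          Cyclotomic.tens hF B c (SuperTensorPower.map 𝒜 n
            (fun _ => (nakayama hF ^ level e).toLinearMap) f)) ∧
        (∀ π : Equiv.Perm (Fin n),
          nakayama hC (Cyclotomic.perm hF B c π) = Cyclotomic.perm hF B c π) ∧
        (orderOf (nakayama hF) ∣ level e → nakayama hC = AlgEquiv.refl) ∧
        (nakayama hF = AlgEquiv.refl → nakayama hC = AlgEquiv.refl) := by
  refine ⟨Cyclotomic.trace hF B hB hc hc', ⟨Cyclotomic.isTopTrace_trace hF B hB hc hc',
    fun T hT => Cyclotomic.eq_trace hF B hB hc hc' hT⟩,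
    Cyclotomic.gradedAlgebra hF B hB hc, Cyclotomic.isFrobenius hF B hB hc hc', ?_⟩
  let := Cyclotomic.gradedAlgebra hF B hB hc
  exact ⟨Cyclotomic.nakayama_x hF B hB hc hc' _, Cyclotomic.nakayama_tens hF B hB hc hc' _,
    Cyclotomic.nakayama_perm hF B hB hc hc' _,
    fun h => Cyclotomic.nakayama_eq_refl hF B hB hc hc' _ (orderOf_dvd_iff_pow_eq_one.1 h),
    fun h => Cyclotomic.nakayama_eq_refl hF B hB hc hc' _
      ((congrArg (· ^ level e) h).trans (one_pow _))⟩
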